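/- **Corollary (Single-NF).** For strings $S,w$ over a linearly ordered alphabet $\Sigma$ let $\mathrm{occ}_S(w)$ be the number of occurrences of $w$ in $S$. The net frequency $\phi_S(w)$ is the number of pairs $(\alpha,\beta)\in\Sigma\times\Sigma$ with $\mathrm{occ}_S(\alpha w\beta)=\mathrm{occ}_S(\alpha w)=\mathrm{occ}_S(w\beta)=1$ if $\mathrm{occ}_S(w)\ge 2$, and $\phi_S(w)=0$ otherwise. For each of the two online settings (every arriving character is prepended to $S$; every arriving character is appended to $S$) there are an absolute constant $C$ and an online data structure, that is, an update program and a query program for a word RAM on which characters can only be stored and compared, such that the following holds for every linearly ordered alphabet $\Sigma$ and for every session that starts with the empty string and an all-zero memory and interleaves arrivals of characters and queries in any order. Let $S$ be the current string, $n=|S|$, and let $\sigma$ be the number of distinct characters that occur in $S$. Then 1. all updates made so far took at most $C\,n\,(\lfloor\log_2\sigma\rfloor+1)$ steps in total, that is, $O(n\log\sigma)$ (with $\lfloor\log_2 0\rfloor:=0$); 2. the next arriving character can always be processed, and the query of any pattern $w\in\Sigma^*$ of length $m$ terminates with the answer $\phi_S(w)$ after at most $C\,(m+1)(\lfloor\log_2\sigma\rfloor+1)$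 steps, that is, $O(m\log\sigma)$; 3. updates and queries use $O(n)$ space: each program uses a fixed finite number of registers and of arrays, every array has at most $C(n+1)$ cells (where $n$ counts the arriving character during an update), and each cell holds one character, the blank, or one word. Every word computed in an update is a number below $C(n+2)$, and every word computed in a query of a pattern of length $m$ is below $C(n+m+1)$. The input (the arriving character or the pattern) is read-only and is not counted. -/

import Mathlib

namespace NetFreq

/-! ### Net frequency -/

section Strings

variable {α : Type*}

/-- The number of occurrences of `w` in `S`: the number of (0-based) positions `i` at which the
length-`|w|` substring of `S` equals `w`. -/
def occ [DecidableEq α] (S w : List α) : ℕ :=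
  ((Finset.range (S.length + 1)).filter fun i => (S.drop i).take w.length = w).card

/-- `w` is a repeat in `S`. -/
def IsRepeat [DecidableEq α] (S w : List α) : Prop := 2 ≤ occ S w

/-- The set `Φ_S(w)` of pairs `(a, b)` of characters such that each of `a w b`, `a w`, `w b` occurs
exactly once in `S`, for a repeat `w`; it is empty if `w` is not a repeat. -/
def netPairs [DecidableEq α] (S w : List α) : Set (α × α) :=
  {p | IsRepeat S w ∧ occ S (p.1 :: (w ++ [p.2])) = 1 ∧ occ S (p.1 :: w) = 1 ∧
    occ S (w ++ [p.2]) = 1}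

/-- The net frequency `φ_S(w) = |Φ_S(w)|`. -/
noncomputable def netFreq [DecidableEq α] (S w : List α) : ℕ := (netPairs S w).ncard

/-- The alphabet size `σ`: the number of distinct characters that occur in `S`. -/
def alphabetSize [DecidableEq α] (S : List α) : ℕ := S.toFinset.card

end Strings

/-! ### A word RAM over a general ordered alphabet

Programs are finite texts.  The machine has word registers and word arrays, holding natural
numbers, and character registers and character arrays, holding characters of the alphabet or the
blank `⊥`, which is smaller than every character.  Characters can only be moved and compared.
A program mentions finitely many registers and arrays, each by a fixed name.
A read-only input string (the arriving character, or the query pattern) can be accessed at random.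

Executions are relative to two bounds: every array has `A` cells (an access to a cell with index
`A` or larger is impossible), and words are numbers smaller than `W` (an expression with a larger
intermediate value has no value). So a program that runs under these bounds uses at most
`k * A + k` cells, where `k` is the number of registers and arrays that it mentions. -/

/-- The unit-cost operations on words. -/
inductive BinOp where
  | add | sub | mul | div | mod | lt | eq

/-- The value of an operation; subtraction is truncated, `x / 0 = 0`, and tests give `0` or `1`. -/
def BinOp.eval : BinOp → ℕ → ℕ → ℕ
  | .add, x, y => x + y
  | .sub, x, y => x - y
  | .mul, x, y => x * y
  | .div, x, y => x / y
  | .mod, x, y => x % y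
  | .lt, x, y => if x < y then 1 else 0
  | .eq, x, y => if x = y then 1 else 0

/-- Word expressions: constants, word registers, cells of word arrays, operations, three-way
comparison of two character registers, and the length of the input string. -/
inductive Expr where
  | lit (k : ℕ)
  | reg (r : ℕ)
  | get (arr : ℕ) (idx : Expr)
  | bin (o : BinOp) (e f : Expr)
  | cmp (c d : ℕ)
  | inputLen

/-- The number of steps that the evaluation of an expression takes. -/
def Expr.size : Expr → ℕ
  | .lit _ => 1
  | .reg _ => 1
  | .get _ e => e.size + 1
  | .bin _ e f => e.size + f.size + 1
  | .cmp _ _ => 1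
  | .inputLen => 1

/-- Commands. -/
inductive Cmd where
  /-- do nothing -/
  | skip
  /-- word register `r` := `e` -/
  | assign (r : ℕ) (e : Expr)
  /-- cell `idx` of word array `arr` := `e` -/
  | store (arr : ℕ) (idx e : Expr)
  /-- character register `c` := cell `idx` of character array `arr` -/
  | loadChar (c arr : ℕ) (idx : Expr)
  /-- cell `idx` of character array `arr` := character register `c` -/
  | storeChar (arr : ℕ) (idx : Expr) (c : ℕ)
  /-- character register `c` := character number `idx` of the input, blank beyond its end -/
  | inputChar (c : ℕ) (idx : Expr)
  /-- run `p`, then `q` -/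
  | seq (p q : Cmd)
  /-- run `p` if `e` is nonzero, otherwise `q` -/
  | branch (e : Expr) (p q : Cmd)
  /-- while `e` is nonzero, run `p` -/
  | loop (e : Expr) (p : Cmd)

/-- The contents of the registers and arrays. -/
structure State (α : Type*) where
  reg : ℕ → ℕ
  arr : ℕ → ℕ → ℕ
  creg : ℕ → WithBot α
  carr : ℕ → ℕ → WithBot α

/-- The empty memory: every word is `0`, every character cell is blank. -/
def State.init (α : Type*) : State α where
  reg _ := 0
  arr _ _ := 0
  creg _ := ⊥
  carr _ _ := ⊥

section Semantics

variable {α : Type*}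

/-- Character number `i` (0-based) of the input, blank beyond its end. -/
def inputAt (inp : List α) (i : ℕ) : WithBot α :=
  match inp[i]? with
  | some a => (a : WithBot α)
  | none => ⊥

def State.setReg (s : State α) (r v : ℕ) : State α :=
  { s with reg := Function.update s.reg r v }

def State.setArr (s : State α) (a i v : ℕ) : State α :=
  { s with arr := Function.update s.arr a (Function.update (s.arr a) i v) }

def State.setCreg (s : State α) (c : ℕ) (x : WithBot α) : State α :=
  { s with creg := Function.update s.creg c x }

def State.setCarr (s : State α) (a i : ℕ) (x : WithBot α) : State α :=
  { s with carr := Function.update s.carr a (Function.update (s.carr a) i x) }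

/-- `v`, provided that it is a word. -/
def word (W v : ℕ) : Option ℕ := if v < W then some v else none

variable [LinearOrder α]

/-- The value of a word expression, if no bound is violated.  A comparison of characters gives
`0`, `1`, `2` for smaller, equal, larger. -/
def Expr.eval (A W : ℕ) (inp : List α) (s : State α) : Expr → Option ℕ
  | .lit k => word W k
  | .reg r => some (s.reg r)
  | .get a e => do
      let i ← e.eval A W inp s
      if i < A then some (s.arr a i) else none
  | .bin o e f => do
      let x ← e.eval A W inp s
      let y ← f.eval A W inp s
      word W (o.eval x y)
  | .cmp c d =>
      word W (if s.creg c < s.creg d then 0 else if s.creg c = s.creg d then 1 else 2)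
  | .inputLen => word W inp.length

/-- `Exec A W inp p s s' t`: with arrays of `A` cells, words smaller than `W` and input `inp`, the
program `p` started in the state `s` halts in the state `s'` after `t` steps. -/
inductive Exec (A W : ℕ) (inp : List α) : Cmd → State α → State α → ℕ → Prop where
  | skip (s : State α) : Exec A W inp .skip s s 0
  | assign {s : State α} {r v : ℕ} {e : Expr} (he : e.eval A W inp s = some v) :
      Exec A W inp (.assign r e) s (s.setReg r v) (e.size + 1)
  | store {s : State α} {a i v : ℕ} {idx e : Expr} (hi : idx.eval A W inp s = some i)
      (hA : i < A) (he : e.eval A W inp s = some v) :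
      Exec A W inp (.store a idx e) s (s.setArr a i v) (idx.size + e.size + 1)
  | loadChar {s : State α} {c a i : ℕ} {idx : Expr} (hi : idx.eval A W inp s = some i)
      (hA : i < A) :
      Exec A W inp (.loadChar c a idx) s (s.setCreg c (s.carr a i)) (idx.size + 1)
  | storeChar {s : State α} {c a i : ℕ} {idx : Expr} (hi : idx.eval A W inp s = some i)
      (hA : i < A) :
      Exec A W inp (.storeChar a idx c) s (s.setCarr a i (s.creg c)) (idx.size + 1)
  | inputChar {s : State α} {c i : ℕ} {idx : Expr} (hi : idx.eval A W inp s = some i) :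
      Exec A W inp (.inputChar c idx) s (s.setCreg c (inputAt inp i)) (idx.size + 1)
  | seq {s s' s'' : State α} {p q : Cmd} {t t' : ℕ} (hp : Exec A W inp p s s' t)
      (hq : Exec A W inp q s' s'' t') : Exec A W inp (.seq p q) s s'' (t + t')
  | branchTrue {s s' : State α} {e : Expr} {p q : Cmd} {v t : ℕ}
      (he : e.eval A W inp s = some v) (hv : v ≠ 0) (hp : Exec A W inp p s s' t) :
      Exec A W inp (.branch e p q) s s' (e.size + 1 + t)
  | branchFalse {s s' : State α} {e : Expr} {p q : Cmd} {t : ℕ}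
      (he : e.eval A W inp s = some 0) (hq : Exec A W inp q s s' t) :
      Exec A W inp (.branch e p q) s s' (e.size + 1 + t)
  | loopTrue {s s' s'' : State α} {e : Expr} {p : Cmd} {v t t' : ℕ}
      (he : e.eval A W inp s = some v) (hv : v ≠ 0) (hp : Exec A W inp p s s' t)
      (hl : Exec A W inp (.loop e p) s' s'' t') :
      Exec A W inp (.loop e p) s s'' (e.size + 1 + t + t')
  | loopFalse {s : State α} {e : Expr} {p : Cmd} (he : e.eval A W inp s = some 0) :
      Exec A W inp (.loop e p) s s (e.size + 1)

/-- The machine is deterministic: the final state and the number of steps are determined. -/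
theorem Exec.deterministic {A W : ℕ} {inp : List α} {p : Cmd} {s s₁ s₂ : State α} {t₁ t₂ : ℕ}
    (h₁ : Exec A W inp p s s₁ t₁) (h₂ : Exec A W inp p s s₂ t₂) : s₁ = s₂ ∧ t₁ = t₂ := by
  induction h₁ generalizing s₂ t₂ with
  | skip => cases h₂; simp
  | assign he => cases h₂; simp_all
  | store hi _ he => cases h₂; simp_all
  | loadChar hi => cases h₂; simp_all
  | storeChar hi => cases h₂; simp_all
  | inputChar hi => cases h₂; simp_all
  | seq _ _ ihp ihq =>
    cases h₂ with
    | seq hp hq =>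
      obtain ⟨rfl, rfl⟩ := ihp hp
      obtain ⟨rfl, rfl⟩ := ihq hq
      simp
  | branchTrue he hv _ ih =>
    cases h₂ with
    | branchTrue _ _ hp => obtain ⟨rfl, rfl⟩ := ih hp; simp
    | branchFalse he' _ => simp_all
  | branchFalse he _ ih =>
    cases h₂ with
    | branchTrue he' _ hp => simp_all
    | branchFalse _ hq => obtain ⟨rfl, rfl⟩ := ih hq; simp
  | loopTrue he hv _ _ ihp ihl =>
    cases h₂ with
    | loopTrue _ _ hp hl =>
      obtain ⟨rfl, rfl⟩ := ihp hp
      obtain ⟨rfl, rfl⟩ := ihl hl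
      simp
    | loopFalse he' => simp_all
  | loopFalse he =>
    cases h₂ with
    | loopTrue he' _ _ _ => simp_all
    | loopFalse _ => simp

end Semantics

/-! ### Online data structures -/

/-- The end of the string at which new characters arrive. -/
inductive Direction where
  /-- new characters are prepended -/
  | rightToLeft
  /-- new characters are appended -/
  | leftToRight

/-- The string `S` after the arrival of the character `a`. -/
def Direction.extend {α : Type*} : Direction → List α → α → List α
  | .rightToLeft, S, a => a :: S
  | .leftToRight, S, a => S ++ [a]

/-- An online data structure: a program that is run when a character arrives (the character is its
input string), and a program that is run when a pattern is queried (the pattern is its input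
string) and leaves the answer in word register `0`. -/
structure OnlineDS where
  update : Cmd
  query : Cmd

namespace OnlineDS

variable {α : Type*} [LinearOrder α]

/-- The program `p` runs on the input `inp`, in `t` steps and from state `s` to state `s'`, within
the memory granted for a string of length `n`: arrays of `C * (n + 1)` cells, and
words smaller than `C * (n + |inp| + 1)`. -/
def Runs (C n : ℕ) (p : Cmd) (inp : List α) (s s' : State α) (t : ℕ) : Prop :=
  Exec (C * (n + 1)) (C * (n + inp.length + 1)) inp p s s' t

/-- `D.Reaches C dir S s T`: some session that starts with the empty string and the empty memory
and consists of arrivals of characters and queries, interleaved in any order, leads to the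
current string `S` and the state `s`, and its updates took `T` steps in total. -/
inductive Reaches (D : OnlineDS) (C : ℕ) (dir : Direction) :
    List α → State α → ℕ → Prop where
  | start : Reaches D C dir [] (State.init α) 0
  | update {S : List α} {s s' : State α} {T t : ℕ} (a : α) (h : Reaches D C dir S s T)
      (hu : Runs C (S.length + 1) D.update [a] s s' t) :
      Reaches D C dir (dir.extend S a) s' (T + t)
  | query {S : List α} {s s' : State α} {T t : ℕ} (w : List α) (h : Reaches D C dir S s T)
      (hq : Runs C S.length D.query w s s' t) :
      Reaches D C dir S s' T

end OnlineDS

end NetFreq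

/-!
# Net frequency of single strings, online

Read from the end at which characters arrive, the current string grows at its front, so an arrival
adds one suffix. The data structure is the suffix tree with Weiner links (`Tree`). Net frequency is
invariant under reversal (`netFreq_reverse_reverse`), so the same update program serves both
directions, and the query program only differs in the order in which it reads the pattern.

*Counting.* Call `ell k` the length of the longest prefix of suffix `k` that starts at another
position as well. A suffix `k` contributes to the net frequency of its longest repeated prefix `w`
if `w` is a proper prefix of it and `ell (k + 1) ≤ ell k`. The first condition provides a
character after `w`, with which `w` is unique; the second one says that `w` is also unique with the
character in front of it.
By `netFreq_reverse_eq` the net frequency of `w` is the number of contributing suffixes. For a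
contributing suffix, `w` is the parent of its leaf (`Tree.len_par_suffix`), so the net frequencies
are stored at the nodes. An arrival changes `ell` for at most one old suffix, the one whose leaf is
the locus of the head of the new suffix, that is, of its longest prefix that occurred before
(`Tree.isEll_step`). Hence the contributions of at most three suffixes have to be revised.

*Updates.* The head is found by Weiner's algorithm: walk from the leaf of the last suffix towards
the root until a node has a link for the arriving character. The target of the link is the last
node on the path of the new suffix. If the head lies on the edge below it, then the head without its
first character is one of the nodes passed (`Tree.Walk.of_child_ne_zero`), and the edge is split
there. The walk makes the new leaf higher than the old one by the number of nodes passed, up to a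
constant, so its length is paid for by the depth of the current leaf (`Tree.Walk.depth_le`).

*Dictionaries.* Since characters can only be compared, an AVL tree translates them into the numbers
`1, …, σ` (`Alphabet`). The children and the Weiner links of a node are then kept in a binary
digital search tree on these numbers (`Dict`). Both take `O(log σ)` steps for an access. All the
digital search trees share their arrays, and the number of their entries is linear because an
arrival creates at most five of them.

*Queries.* The query program descends in the suffix tree and reads the count at the node of the
pattern, if the pattern is the string of a node; other patterns have net frequency `0`
(`Core.phi_eq`).

Running times and memory bounds are derived in a weakest precondition calculus (`WP`) for the word
RAM; the invariant of the memory is `Core`, and `Direction.reaches_spec` adds up the running times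
of a session.
-/

namespace NetFreq

set_option linter.unusedSimpArgs false

/-! ### Suffixes and explicit nodes -/

section Agree

variable {β : Type*}

/-- Suffixes are indexed by their length: if `x i` is the `i`-th character in the order of arrival,
suffix number `k` of the string `x (n-1) … x 1 x 0` is `x (k-1) … x 0`, for every `n ≥ k`.
`Agree x l k k'` says that the suffixes `k` and `k'` share their first `l` characters. -/
def Agree (x : ℕ → β) (l k k' : ℕ) : Prop :=
  l ≤ k ∧ l ≤ k' ∧ ∀ j < l, x (k - 1 - j) = x (k' - 1 - j)

variable {x y : ℕ → β} {l m k k' k₁ k₂ k₃ n : ℕ}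

theorem Agree.refl (h : l ≤ k) : Agree x l k k := ⟨h, h, fun _ _ => rfl⟩

theorem Agree.symm (h : Agree x l k k') : Agree x l k' k :=
  ⟨h.2.1, h.1, fun j hj => (h.2.2 j hj).symm⟩

theorem Agree.trans (h : Agree x l k₁ k₂) (h' : Agree x l k₂ k₃) : Agree x l k₁ k₃ :=
  ⟨h.1, h'.2.1, fun j hj => (h.2.2 j hj).trans (h'.2.2 j hj)⟩

theorem Agree.mono (h : Agree x l k k') (hm : m ≤ l) : Agree x m k k' :=
  ⟨hm.trans h.1, hm.trans h.2.1, fun j hj => h.2.2 j (hj.trans_le hm)⟩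

theorem Agree.zero : Agree x 0 k k' := ⟨by omega, by omega, by omega⟩

theorem agree_succ_iff :
    Agree x (l + 1) k k' ↔ Agree x l k k' ∧ l < k ∧ l < k' ∧ x (k - 1 - l) = x (k' - 1 - l) := by
  constructor
  · intro h
    exact ⟨h.mono (by omega), h.1, h.2.1, h.2.2 l (by omega)⟩
  · rintro ⟨h, h1, h2, h3⟩
    refine ⟨h1, h2, fun j hj => ?_⟩
    rcases Nat.lt_succ_iff_lt_or_eq.1 hj with h4 | rfl
    · exact h.2.2 j h4
    · exact h3

theorem agree_cons_iff :
    Agree x (l + 1) (k + 1) (k' + 1) ↔ x k = x k' ∧ Agree x l k k' := by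
  constructor
  · intro h
    refine ⟨by simpa using h.2.2 0 (by omega), by have := h.1; omega, by have := h.2.1; omega, ?_⟩
    intro j hj
    have := h.2.2 (j + 1) (by omega)
    rwa [show k + 1 - 1 - (j + 1) = k - 1 - j by omega,
      show k' + 1 - 1 - (j + 1) = k' - 1 - j by omega] at this
  · rintro ⟨h, h1, h2, h3⟩
    refine ⟨by omega, by omega, fun j hj => ?_⟩
    cases j with
    | zero => simpa using h
    | succ j =>
      rw [show k + 1 - 1 - (j + 1) = k - 1 - j by omega,
        show k' + 1 - 1 - (j + 1) = k' - 1 - j by omega]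
      exact h3 j (by omega)

theorem exists_lcp (h : Agree x l k k') (hm : ¬ Agree x m k k') :
    ∃ i, l ≤ i ∧ i < m ∧ Agree x i k k' ∧ ¬ Agree x (i + 1) k k' := by
  classical
  have hlm : l < m := by
    by_contra hc
    exact hm (h.mono (by omega))
  have hex : ∃ i, ¬ Agree x (i + 1) k k' := ⟨m, fun h' => hm (h'.mono (by omega))⟩
  refine ⟨Nat.find hex, ?_, ?_, ?_, Nat.find_spec hex⟩
  · by_contra hc
    exact Nat.find_spec hex (h.mono (by omega))
  · have : Nat.find hex ≤ m - 1 :=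
      Nat.find_min' hex (by rwa [show m - 1 + 1 = m by omega])
    omega
  · by_cases h0 : Nat.find hex = 0
    · rw [h0]; exact Agree.zero
    · have := Nat.find_min hex (m := Nat.find hex - 1) (by omega)
      rw [show Nat.find hex - 1 + 1 = Nat.find hex by omega] at this
      exact not_not.1 this

theorem Agree.congr (hxy : ∀ i < n, x i = y i) (hk : k ≤ n) (hk' : k' ≤ n)
    (h : Agree x l k k') : Agree y l k k' := by
  refine ⟨h.1, h.2.1, fun j hj => ?_⟩
  have h1 := h.1
  have h2 := h.2.1
  rw [← hxy _ (by omega), ← hxy _ (by omega)]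
  exact h.2.2 j hj

theorem agree_congr (hxy : ∀ i < n, x i = y i) (hk : k ≤ n) (hk' : k' ≤ n) :
    Agree x l k k' ↔ Agree y l k k' :=
  ⟨Agree.congr hxy hk hk', Agree.congr (fun i hi => (hxy i hi).symm) hk hk'⟩

/-- The first `l` characters of suffix `k` are an explicit node of the suffix tree of the first
`n` characters: two occurrences of that factor are followed by different characters, or one of
them ends the string. In both cases `l` is the exact length of the longest common prefix of `k`
with some suffix `k'`, where `k' = k` covers the whole suffix (`l = k`). -/
def IsNode (x : ℕ → β) (n k l : ℕ) : Prop :=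
  k ≤ n ∧ ∃ k' ≤ n, Agree x l k k' ∧ ¬ Agree x (l + 1) k k'

theorem IsNode.le (h : IsNode x n k l) : l ≤ k := by
  obtain ⟨_, k', _, h, _⟩ := h
  exact h.1

theorem IsNode.self (h : k ≤ n) : IsNode x n k k :=
  ⟨h, k, h, Agree.refl le_rfl, fun h' => by have := h'.1; omega⟩

theorem IsNode.zero (h : k ≤ n) : IsNode x n k 0 :=
  ⟨h, 0, by omega, Agree.zero, fun h' => by have := h'.2.1; omega⟩

theorem IsNode.transfer (h : IsNode x n k l) (hk : Agree x l k k₂) (hn : k₂ ≤ n) :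
    IsNode x n k₂ l := by
  obtain ⟨h0, k', h1, h2, h3⟩ := h
  by_cases h4 : Agree x (l + 1) k₂ k'
  · exact ⟨hn, k, h0, hk.symm, fun h5 => h3 (h5.symm.trans h4)⟩
  · exact ⟨hn, k', h1, hk.symm.trans h2, h4⟩

/-- Suffix links lead from explicit nodes to explicit nodes. -/
theorem IsNode.tail (h : IsNode x n (k + 1) (l + 1)) : IsNode x n k l := by
  obtain ⟨h0, k', h1, h2, h3⟩ := h
  obtain ⟨k', rfl⟩ : ∃ i, k' = i + 1 := ⟨k' - 1, by have := h2.2.1; omega⟩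
  rw [agree_cons_iff] at h2 h3
  exact ⟨by omega, k', by omega, h2.2, fun h4 => h3 ⟨h2.1, h4⟩⟩

theorem isNode_congr (hxy : ∀ i < n, x i = y i) : IsNode x n k l ↔ IsNode y n k l := by
  unfold IsNode
  constructor
  · rintro ⟨h0, k', h1, h2, h3⟩
    exact ⟨h0, k', h1, h2.congr hxy h0 h1, fun h => h3 ((agree_congr hxy h0 h1).2 h)⟩
  · rintro ⟨h0, k', h1, h2, h3⟩
    exact ⟨h0, k', h1, (agree_congr hxy h0 h1).2 h2, fun h => h3 ((agree_congr hxy h0 h1).1 h)⟩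

/-- `h` is the length of the longest prefix of suffix `n + 1` that occurs in suffix `n`. -/
def IsHead (x : ℕ → β) (n h : ℕ) : Prop :=
  (∃ k ≤ n, Agree x h (n + 1) k) ∧ ∀ k ≤ n, ¬ Agree x (h + 1) (n + 1) k

theorem exists_isHead (x : ℕ → β) (n : ℕ) : ∃ h, IsHead x n h := by
  classical
  let p : ℕ → Prop := fun h => ∃ k ≤ n, Agree x h (n + 1) k
  have h0 : p 0 := ⟨0, by omega, Agree.zero⟩
  refine ⟨Nat.findGreatest p (n + 1), Nat.findGreatest_spec (P := p) (Nat.zero_le _) h0, ?_⟩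
  intro k hk hc
  have h1 : Nat.findGreatest p (n + 1) + 1 ≤ n + 1 := hc.1
  have := Nat.le_findGreatest (P := p) h1 ⟨k, hk, hc⟩
  omega

variable {h : ℕ}

theorem IsHead.le_of_agree (hh : IsHead x n h) (hk : k ≤ n) (ha : Agree x l (n + 1) k) :
    l ≤ h := by
  by_contra hc
  exact hh.2 k hk (ha.mono (by omega))

/-- Of the old factors, only the head of the new suffix can become a node. -/
theorem isNode_succ_iff (hh : IsHead x n h) (hk : k ≤ n) :
    IsNode x (n + 1) k l ↔ IsNode x n k l ∨ (l = h ∧ Agree x h k (n + 1)) := by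
  constructor
  · rintro ⟨_, k', h1, h2, h3⟩
    by_cases hk' : k' ≤ n
    · exact .inl ⟨hk, k', hk', h2, h3⟩
    · obtain rfl : k' = n + 1 := by omega
      have hl := hh.le_of_agree hk h2.symm
      rcases Nat.lt_or_eq_of_le hl with hl | rfl
      · obtain ⟨k₀, hk₀, h4⟩ := hh.1
        refine .inl ⟨hk, k₀, hk₀, h2.trans (h4.mono hl.le), fun h5 => h3 (h5.trans ?_)⟩
        exact (h4.mono hl).symm
      · exact .inr ⟨rfl, h2⟩
  · rintro (⟨_, k', h1, h2⟩ | ⟨rfl, h2⟩)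
    · exact ⟨by omega, k', by omega, h2⟩
    · exact ⟨by omega, n + 1, le_rfl, h2, fun h3 => hh.2 k hk h3.symm⟩

/-- The nodes on the path of the new suffix: its leaf, its head, and the old nodes above the
head. -/
theorem isNode_new_iff (hh : IsHead x n h) {k₀ : ℕ} (hk₀ : k₀ ≤ n) (h₀ : Agree x h (n + 1) k₀) :
    IsNode x (n + 1) (n + 1) l ↔ l = n + 1 ∨ (l ≤ h ∧ (IsNode x n k₀ l ∨ l = h)) := by
  constructor
  · intro hn
    rcases eq_or_ne l (n + 1) with rfl | hl
    · exact .inl rfl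
    right
    obtain ⟨_, k', h1, h2, h3⟩ := id hn
    have hk' : k' ≤ n := by
      by_contra hc
      obtain rfl : k' = n + 1 := by omega
      exact h3 (Agree.refl (by have := h2.1; omega))
    have hlh := hh.le_of_agree hk' h2
    refine ⟨hlh, ?_⟩
    have := hn.transfer (h₀.mono hlh) (by omega)
    rw [isNode_succ_iff hh hk₀] at this
    tauto
  · rintro (rfl | ⟨h1, h2⟩)
    · exact IsNode.self le_rfl
    · have : IsNode x (n + 1) k₀ l := by
        rw [isNode_succ_iff hh hk₀]
        rcases h2 with h2 | rfl
        · exact .inl h2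
        · exact .inr ⟨rfl, h₀.symm⟩
      exact this.transfer (h₀.symm.mono h1) le_rfl

end Agree

/-! ### The suffix tree with Weiner links -/

/-- The dictionary `F` with the entry for owner `o` and key `c` set to `v`. -/
def setEntry (F : ℕ → ℕ → ℕ) (o c v : ℕ) : ℕ → ℕ → ℕ :=
  Function.update F o (Function.update (F o) c v)

theorem setEntry_apply (F : ℕ → ℕ → ℕ) (o c v o' c' : ℕ) :
    setEntry F o c v o' c' = if o' = o ∧ c' = c then v else F o' c' := by
  unfold setEntry
  by_cases h : o' = o
  · subst h
    by_cases h' : c' = c <;> simp [h']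
  · simp [h]

/-- A compacted trie of the factors `(k, l)` (the first `l` characters of suffix `k`, `k ≤ n`) that
satisfy `P`. The nodes are the numbers in `V`, with root `0`, and `v` stands for the factor
`(pos v, len v)`. The dictionary `F` holds at owner `2 * v` the children of `v`, by the first
character of the edge, and at owner `2 * v + 1` the Weiner links of `v`: the key `c` leads to the
node whose string is that of `v` preceded by `c`, if there is one. The value `0` means absence. -/
structure Tree (x : ℕ → ℕ) (n : ℕ) (P : ℕ → ℕ → Prop) (len pos par : ℕ → ℕ) (F : ℕ → ℕ → ℕ)
    (V : Set ℕ) : Prop where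
  root : 0 ∈ V
  len_root : len 0 = 0
  pos_le : ∀ v ∈ V, pos v ≤ n
  node : ∀ v ∈ V, P (pos v) (len v)
  surj : ∀ k ≤ n, ∀ l, P k l → ∃ v ∈ V, len v = l ∧ Agree x l k (pos v)
  inj : ∀ v ∈ V, ∀ w ∈ V, len v = len w → Agree x (len v) (pos v) (pos w) → v = w
  par_mem : ∀ v ∈ V, v ≠ 0 → par v ∈ V
  par_lt : ∀ v ∈ V, v ≠ 0 → len (par v) < len v
  par_agree : ∀ v ∈ V, v ≠ 0 → Agree x (len (par v)) (pos v) (pos (par v))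
  par_max : ∀ v ∈ V, v ≠ 0 → ∀ l, len (par v) < l → l < len v → ¬ P (pos v) l
  child_of : ∀ v c, F (2 * v) c ≠ 0 → F (2 * v) c ∈ V ∧ par (F (2 * v) c) = v ∧
    x (pos (F (2 * v) c) - 1 - len v) = c
  of_child : ∀ z ∈ V, z ≠ 0 → F (2 * par z) (x (pos z - 1 - len (par z))) = z
  link_of : ∀ v c, F (2 * v + 1) c ≠ 0 → v ∈ V ∧ F (2 * v + 1) c ∈ V ∧
    len (F (2 * v + 1) c) = len v + 1 ∧ x (pos (F (2 * v + 1) c) - 1) = c ∧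
    Agree x (len v) (pos (F (2 * v + 1) c) - 1) (pos v)
  of_link : ∀ v ∈ V, ∀ y ∈ V, len y = len v + 1 → Agree x (len v) (pos y - 1) (pos v) →
    F (2 * v + 1) (x (pos y - 1)) = y

/-- `P` only depends on the factor, not on its occurrence. -/
def Invariant (x : ℕ → ℕ) (n : ℕ) (P : ℕ → ℕ → Prop) : Prop :=
  (∀ k l, P k l → l ≤ k) ∧ ∀ k l k', P k l → k' ≤ n → Agree x l k k' → P k' l

theorem isNode_invariant (x : ℕ → ℕ) (n : ℕ) : Invariant x n (IsNode x n) :=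
  ⟨fun _ _ h => h.le, fun _ _ _ h hk ha => h.transfer ha hk⟩

namespace Tree

variable {x : ℕ → ℕ} {n : ℕ} {P : ℕ → ℕ → Prop} {len pos par : ℕ → ℕ} {F : ℕ → ℕ → ℕ} {V : Set ℕ}

theorem congr_pred {Q : ℕ → ℕ → Prop} (hT : Tree x n P len pos par F V)
    (hPQ : ∀ k ≤ n, ∀ l, P k l ↔ Q k l) : Tree x n Q len pos par F V where
  root := hT.root
  len_root := hT.len_root
  pos_le := hT.pos_le
  node v hv := (hPQ _ (hT.pos_le v hv) _).1 (hT.node v hv)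
  surj k hk l h := hT.surj k hk l ((hPQ k hk l).2 h)
  inj := hT.inj
  par_mem := hT.par_mem
  par_lt := hT.par_lt
  par_agree := hT.par_agree
  par_max v hv h0 l h1 h2 h := hT.par_max v hv h0 l h1 h2 ((hPQ _ (hT.pos_le v hv) _).2 h)
  child_of := hT.child_of
  of_child := hT.of_child
  link_of := hT.link_of
  of_link := hT.of_link

theorem len_pos (hT : Tree x n P len pos par F V) {v : ℕ} (hv : v ∈ V) (h0 : v ≠ 0) :
    0 < len v := by
  have := hT.par_lt v hv h0
  omega

/-- Every factor that occurs has a locus: the first node that extends it. -/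
theorem exists_locus (hT : Tree x n P len pos par F V) (hP : Invariant x n P)
    (hself : ∀ k ≤ n, P k k) {k l : ℕ} (hk : k ≤ n) (hl : 0 < l) (hlk : l ≤ k) :
    ∃ z ∈ V, z ≠ 0 ∧ l ≤ len z ∧ Agree x l k (pos z) ∧ len (par z) < l := by
  classical
  have hex : ∃ l', l ≤ l' ∧ P k l' := ⟨k, hlk, hself k hk⟩
  obtain ⟨h1, h2⟩ := Nat.find_spec hex
  obtain ⟨z, hz, hzl, ha⟩ := hT.surj k hk _ h2
  have hz0 : z ≠ 0 := by
    rintro rfl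
    rw [hT.len_root] at hzl
    omega
  refine ⟨z, hz, hz0, by omega, ha.mono h1, ?_⟩
  by_contra hc
  have h3 := hT.par_lt z hz hz0
  have h4 : P k (len (par z)) := by
    refine hP.2 _ _ _ (hT.node _ (hT.par_mem z hz hz0)) hk ?_
    exact ((ha.mono (by omega)).trans (hT.par_agree z hz hz0)).symm
  have := Nat.find_min' hex ⟨by omega, h4⟩
  omega

theorem par_eq_of (hT : Tree x n P len pos par F V) (hP : Invariant x n P) {z b : ℕ} (hz : z ∈ V)
    (hz0 : z ≠ 0) (hb : b ∈ V) (hlt : len b < len z) (hle : len (par z) ≤ len b)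
    (ha : Agree x (len b) (pos z) (pos b)) : par z = b := by
  have h1 := hT.par_mem z hz hz0
  have h2 : ¬ len (par z) < len b := fun h =>
    hT.par_max z hz hz0 _ h hlt (hP.2 _ _ _ (hT.node b hb) (hT.pos_le z hz) ha.symm)
  have h3 : len (par z) = len b := by omega
  exact hT.inj _ h1 _ hb h3 ((hT.par_agree z hz hz0).symm.trans (h3 ▸ ha))

/-- Every occurrence of the string of `b` that does not end the text continues into a child of
`b`. -/
theorem child_ne_zero (hT : Tree x n P len pos par F V) (hP : Invariant x n P)
    (hself : ∀ k ≤ n, P k k) {b k : ℕ} (hb : b ∈ V) (hk : k ≤ n) (hlt : len b < k)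
    (ha : Agree x (len b) k (pos b)) :
    F (2 * b) (x (k - 1 - len b)) ∈ V ∧ F (2 * b) (x (k - 1 - len b)) ≠ 0 ∧
    Agree x (len b + 1) k (pos (F (2 * b) (x (k - 1 - len b)))) := by
  obtain ⟨z, hz, hz0, h1, h2, h3⟩ := hT.exists_locus hP hself hk (Nat.succ_pos (len b)) hlt
  have hp : par z = b := hT.par_eq_of hP hz hz0 hb (by omega) (by omega)
    ((h2.mono (by omega)).symm.trans ha)
  have := hT.of_child z hz hz0
  rw [hp, ← (agree_succ_iff.1 h2).2.2.2] at this
  rw [this]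
  exact ⟨hz, hz0, h2⟩

/-- Splitting the edge above `z` at depth `h`. The new node `u` has a single child `z` and a single
incoming Weiner link, from `y`. -/
theorem split (hT : Tree x n P len pos par F V) (hP : Invariant x n P)
    (htail : ∀ k l, P (k + 1) (l + 1) → P k l) {z y u h : ℕ} (hz : z ∈ V) (hz0 : z ≠ 0)
    (hh1 : len (par z) < h) (hh2 : h < len z) (hy : y ∈ V) (hyl : len y + 1 = h)
    (hya : Agree x (len y) (pos z - 1) (pos y)) (hu : u ∉ V) :
    Tree x n (fun k l => P k l ∨ (l = h ∧ Agree x h k (pos z)))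
      (Function.update len u h) (Function.update pos u (pos z))
      (Function.update (Function.update par u (par z)) z u)
      (setEntry (setEntry (setEntry F (2 * par z) (x (pos z - 1 - len (par z))) u)
        (2 * u) (x (pos z - 1 - h)) z) (2 * y + 1) (x (pos z - 1)) u)
      (insert u V) := by
  have hu0 : u ≠ 0 := fun e => hu (e ▸ hT.root)
  have hzu : z ≠ u := fun e => hu (e ▸ hz)
  have hyu : y ≠ u := fun e => hu (e ▸ hy)
  have hne : ∀ v ∈ V, v ≠ u := fun v hv e => hu (e ▸ hv)
  have hzpos := hP.1 _ _ (hT.node z hz)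
  have hpz := hT.par_mem z hz hz0
  have hnot : ∀ k ≤ n, Agree x h k (pos z) → ¬ P k h := fun k hk ha hPk =>
    hT.par_max z hz hz0 h hh1 hh2 (hP.2 _ _ _ hPk (hT.pos_le z hz) ha)
  have hnotV : ∀ v ∈ V, len v = h → ¬ Agree x h (pos v) (pos z) := fun v hv e ha =>
    hnot _ (hT.pos_le v hv) ha (e ▸ hT.node v hv)
  have hFu : ∀ c, F (2 * u) c = 0 := by
    intro c
    by_contra hc
    obtain ⟨h1, h2, _⟩ := hT.child_of u c hc
    refine hu (h2 ▸ hT.par_mem _ h1 hc)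
  have hlr : Function.update len u h 0 = 0 := by
    rw [Function.update_of_ne hu0.symm, hT.len_root]
  have hFz := hT.of_child z hz hz0
  constructor
  case root => exact .inr hT.root
  case len_root => exact hlr
  case pos_le =>
    rintro v (rfl | hv)
    · simpa using hT.pos_le z hz
    · simpa [hne v hv] using hT.pos_le v hv
  case node =>
    rintro v (rfl | hv)
    · simpa using Or.inr (Agree.refl (x := x) (by omega : h ≤ pos z))
    · simpa [hne v hv] using Or.inl (hT.node v hv)
  case surj =>
    rintro k hk l (hPk | ⟨rfl, ha⟩)
    · obtain ⟨v, hv, h1⟩ := hT.surj k hk l hPk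
      exact ⟨v, .inr hv, by simpa [hne v hv] using h1⟩
    · exact ⟨u, .inl rfl, by simpa using ha⟩
  case inj =>
    rintro v (rfl | hv) w (rfl | hw)
    · simp
    · simp only [Function.update_self, Function.update_of_ne (hne w hw)]
      intro e ha
      exact absurd ha.symm (hnotV w hw e.symm)
    · simp only [Function.update_self, Function.update_of_ne (hne v hv)]
      intro e ha
      rw [e] at ha
      exact absurd ha (hnotV v hv e)
    · simp only [Function.update_of_ne (hne v hv), Function.update_of_ne (hne w hw)]
      exact hT.inj v hv w hw
  case par_mem =>
    rintro v (rfl | hv) h0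
    · simpa [hzu.symm] using Or.inr hpz
    · by_cases hvz : v = z
      · simp [hvz]
      · simpa [hvz, hne v hv] using Or.inr (hT.par_mem v hv h0)
  case par_lt =>
    rintro v (rfl | hv) h0
    · simpa [hzu.symm, hne _ hpz] using hh1
    · by_cases hvz : v = z
      · simpa [hvz, hzu] using hh2
      · simpa [hvz, hne v hv, hne _ (hT.par_mem v hv h0)] using hT.par_lt v hv h0
  case par_agree =>
    rintro v (rfl | hv) h0
    · simpa [hzu.symm, hne _ hpz] using hT.par_agree z hz hz0
    · by_cases hvz : v = z
      · simpa [hvz, hzu] using Agree.refl (x := x) (by omega : h ≤ pos z)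
      · simpa [hvz, hne v hv, hne _ (hT.par_mem v hv h0)] using hT.par_agree v hv h0
  case par_max =>
    rintro v (rfl | hv) h0 l
    · simp only [Function.update_self, Function.update_of_ne hzu.symm,
        Function.update_of_ne (hne _ hpz)]
      rintro h1 h2 (h3 | ⟨rfl, _⟩)
      · exact hT.par_max z hz hz0 l h1 (by omega) h3
      · omega
    · by_cases hvz : v = z
      · subst hvz
        simp only [Function.update_self, Function.update_of_ne hzu]
        rintro h1 h2 (h3 | ⟨rfl, _⟩)
        · exact hT.par_max v hz hz0 l (by omega) h2 h3
        · omega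
      · have hpv := hT.par_mem v hv h0
        simp only [Function.update_of_ne hvz, Function.update_of_ne (hne v hv),
          Function.update_of_ne (hne _ hpv)]
        rintro h1 h2 (h3 | ⟨rfl, h3⟩)
        · exact hT.par_max v hv h0 l h1 h2 h3
        -- the factors `(v, len v)` and `z` would both be the locus of the new node
        · refine hvz ?_
          have h4 := hT.par_lt z hz hz0
          have hm : Agree x l (pos z) (pos v) := h3.symm
          have e1 : len (par z) = len (par v) := by
            rcases lt_trichotomy (len (par z)) (len (par v)) with hlt | he | hlt
            · refine absurd (hP.2 _ _ _ (hT.node _ hpv) (hT.pos_le z hz) ?_)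
                (hT.par_max z hz hz0 _ hlt (by omega))
              exact (hT.par_agree v hv h0).symm.trans (h3.mono h1.le)
            · exact he
            · refine absurd (hP.2 _ _ _ (hT.node _ hpz) (hT.pos_le v hv) ?_)
                (hT.par_max v hv h0 _ hlt (by omega))
              exact (hT.par_agree z hz hz0).symm.trans (hm.mono hh1.le)
          have e2 : par z = par v := hT.inj _ hpz _ hpv e1
            ((hT.par_agree z hz hz0).symm.trans ((hm.mono hh1.le).trans
              (e1 ▸ hT.par_agree v hv h0)))
          have e3 := hT.of_child v hv h0
          rw [← e2, h3.2.2 _ hh1, hFz] at e3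
          exact e3.symm
  case child_of =>
    intro v c
    have hodd : ∀ w, ¬ (2 * v = 2 * w + 1 ∧ c = x (pos z - 1)) := by omega
    simp only [setEntry_apply, hodd, if_false]
    by_cases h1 : v = u
    · subst h1
      by_cases h2 : c = x (pos z - 1 - h)
      · simp only [h2, and_self, if_true]
        exact fun _ => ⟨.inr hz, by simp, by simp [hzu]⟩
      · have hpv : v ≠ par z := (hne _ hpz).symm
        simp [h2, hpv, hFu]
    · simp only [show ¬ (2 * v = 2 * u ∧ c = x (pos z - 1 - h)) by omega, if_false]
      by_cases h2 : v = par z ∧ c = x (pos z - 1 - len (par z))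
      · obtain ⟨rfl, rfl⟩ := h2
        simp only [and_self, if_true]
        exact fun _ => ⟨.inl rfl, by simp [hzu.symm], by simp [hne _ hpz]⟩
      · rw [if_neg (by omega)]
        intro hc
        obtain ⟨h3, h4, h5⟩ := hT.child_of v c hc
        have h6 : F (2 * v) c ≠ z := by
          intro e
          rw [e] at h4 h5
          exact h2 ⟨h4.symm, by rw [h4, h5]⟩
        exact ⟨.inr h3, by simpa [h6, hne _ h3] using h4, by simpa [hne _ h3, h1] using h5⟩
  case of_child =>
    have hodd : ∀ v w c, ¬ (2 * v = 2 * w + 1 ∧ c = x (pos z - 1)) := by omega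
    rintro v (rfl | hv) h0
    · simp only [setEntry_apply, hodd, if_false, Function.update_self,
        Function.update_of_ne hzu.symm, Function.update_of_ne (hne _ hpz)]
      rw [if_neg]
      · simp
      · have := hne _ hpz
        omega
    · by_cases hvz : v = z
      · subst hvz
        simp [setEntry_apply, hodd, hzu]
      · have hpv := hT.par_mem v hv h0
        simp only [setEntry_apply, hodd, if_false, Function.update_of_ne hvz,
          Function.update_of_ne (hne v hv), Function.update_of_ne (hne _ hpv)]
        rw [if_neg (by have := hne _ hpv; omega), if_neg, hT.of_child v hv h0]
        rintro ⟨h1, h2⟩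
        have h3 := hT.of_child v hv h0
        rw [h1, h2, hFz] at h3
        exact hvz h3.symm
  case link_of =>
    intro v c
    have heven : ∀ w d, ¬ (2 * v + 1 = 2 * w ∧ c = d) := by omega
    simp only [setEntry_apply, heven, if_false]
    by_cases h1 : v = y ∧ c = x (pos z - 1)
    · obtain ⟨rfl, rfl⟩ := h1
      simp only [and_self, if_true]
      exact fun _ => ⟨.inr hy, .inl rfl, by simp [hyu, hyl], by simp, by simpa [hyu] using hya⟩
    · rw [if_neg (by omega)]
      intro hc
      obtain ⟨h2, h3, h4, h5, h6⟩ := hT.link_of v c hc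
      exact ⟨.inr h2, .inr h3, by simpa [hne _ h3, hne _ h2] using h4,
        by simpa [hne _ h3] using h5, by simpa [hne _ h3, hne _ h2] using h6⟩
  case of_link =>
    have heven : ∀ v w c d : ℕ, ¬ (2 * v + 1 = 2 * w ∧ c = d) := by omega
    rintro v (rfl | hv) w (rfl | hw)
    · simp
    -- a node whose suffix link is the new node would have made it explicit before
    · simp only [Function.update_self, Function.update_of_ne (hne w hw)]
      intro e ha
      exfalso
      have h1 := hP.1 _ _ (hT.node w hw)
      refine hnot (pos w - 1) (by have := hT.pos_le w hw; omega) ha (htail _ _ ?_)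
      rw [← e, show pos w - 1 + 1 = pos w by omega]
      exact hT.node w hw
    · simp only [Function.update_self, Function.update_of_ne (hne v hv)]
      intro e ha
      have : v = y := by
        refine hT.inj v hv y hy (by omega) (ha.symm.trans ?_)
        rwa [show len v = len y by omega]
      subst this
      simp [setEntry_apply]
    · simp only [Function.update_of_ne (hne v hv), Function.update_of_ne (hne w hw)]
      intro e ha
      simp only [setEntry_apply, heven, if_false]
      rw [if_neg, hT.of_link v hv w hw e ha]
      rintro ⟨h1, h2⟩
      obtain rfl : v = y := by omega
      refine hnotV w hw (by omega) ?_
      have h4 := hP.1 _ _ (hT.node w hw)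
      obtain ⟨i, hi⟩ : ∃ i, pos w = i + 1 := ⟨pos w - 1, by omega⟩
      obtain ⟨j, hj⟩ : ∃ j, pos z = j + 1 := ⟨pos z - 1, by omega⟩
      rw [hi, hj] at h2
      rw [← hyl, hi, hj, agree_cons_iff]
      refine ⟨by simpa using h2, ?_⟩
      rw [hi] at ha
      rw [hj] at hya
      simpa using ha.trans hya.symm

/-- Adding suffix `n + 1` as a leaf `u` below a node `q`, where the string of `q` is the longest
prefix of the new suffix that occurs before. Its Weiner link comes from the node `s` of
suffix `n`. -/
theorem addLeaf (hT : Tree x n P len pos par F V) (hP : Invariant x n P) {q s u : ℕ}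
    (hq : q ∈ V) (hqa : Agree x (len q) (n + 1) (pos q)) (hh : IsHead x n (len q))
    (hs : s ∈ V) (hsp : pos s = n) (hsl : len s = n) (hu : u ∉ V) :
    Tree x (n + 1) (fun k l => (k ≤ n ∧ P k l) ∨
        (k = n + 1 ∧ (l = n + 1 ∨ (l ≤ len q ∧ P (pos q) l))))
      (Function.update len u (n + 1)) (Function.update pos u (n + 1))
      (Function.update par u q)
      (setEntry (setEntry F (2 * q) (x (n - len q)) u) (2 * s + 1) (x n) u)
      (insert u V) := by
  have hu0 : u ≠ 0 := fun e => hu (e ▸ hT.root)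
  have hqu : q ≠ u := fun e => hu (e ▸ hq)
  have hsu : s ≠ u := fun e => hu (e ▸ hs)
  have hne : ∀ v ∈ V, v ≠ u := fun v hv e => hu (e ▸ hv)
  have hqp := hP.1 _ _ (hT.node q hq)
  have hqn := hT.pos_le q hq
  have hlen : ∀ v ∈ V, len v ≤ n := fun v hv => (hP.1 _ _ (hT.node v hv)).trans (hT.pos_le v hv)
  have hFq : F (2 * q) (x (n - len q)) = 0 := by
    by_contra hc
    obtain ⟨h1, h2, h3⟩ := hT.child_of _ _ hc
    set z := F (2 * q) (x (n - len q))
    refine hh.2 (pos z) (hT.pos_le z h1) (agree_succ_iff.2 ⟨?_, by omega, ?_, ?_⟩)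
    · have := hT.par_agree z h1 hc
      rw [h2] at this
      exact hqa.trans this.symm
    · have := hT.par_lt z h1 hc
      rw [h2] at this
      exact this.trans_le (hP.1 _ _ (hT.node z h1))
    · rw [h3]
      congr 1
  constructor
  case root => exact .inr hT.root
  case len_root => rw [Function.update_of_ne hu0.symm, hT.len_root]
  case pos_le =>
    rintro v (rfl | hv)
    · simp
    · rw [Function.update_of_ne (hne v hv)]
      exact (hT.pos_le v hv).trans (by omega)
  case node =>
    rintro v (rfl | hv)
    · simp
    · simp only [Function.update_of_ne (hne v hv)]
      exact .inl ⟨hT.pos_le v hv, hT.node v hv⟩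
  case surj =>
    rintro k - l (⟨hk, h1⟩ | ⟨rfl, rfl | ⟨h1, h2⟩⟩)
    · obtain ⟨v, hv, h2⟩ := hT.surj k hk l h1
      exact ⟨v, .inr hv, by simpa [hne v hv] using h2⟩
    · exact ⟨u, .inl rfl, by simpa using Agree.refl (x := x) le_rfl⟩
    · obtain ⟨v, hv, h3, h4⟩ := hT.surj _ hqn l h2
      refine ⟨v, .inr hv, ?_⟩
      simpa [hne v hv] using ⟨h3, (hqa.mono h1).trans h4⟩
  case inj =>
    rintro v (rfl | hv) w (rfl | hw)
    · simp
    · simp only [Function.update_self, Function.update_of_ne (hne w hw)]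
      intro e
      have := hlen w hw
      omega
    · simp only [Function.update_self, Function.update_of_ne (hne v hv)]
      intro e
      have := hlen v hv
      omega
    · simp only [Function.update_of_ne (hne v hv), Function.update_of_ne (hne w hw)]
      exact hT.inj v hv w hw
  case par_mem =>
    rintro v (rfl | hv) h0
    · simpa using Or.inr hq
    · simpa [hne v hv] using Or.inr (hT.par_mem v hv h0)
  case par_lt =>
    rintro v (rfl | hv) h0
    · simp only [Function.update_self, Function.update_of_ne hqu]
      omega
    · simpa [hne v hv, hne _ (hT.par_mem v hv h0)] using hT.par_lt v hv h0
  case par_agree =>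
    rintro v (rfl | hv) h0
    · simpa [hqu] using hqa
    · simpa [hne v hv, hne _ (hT.par_mem v hv h0)] using hT.par_agree v hv h0
  case par_max =>
    rintro v (rfl | hv) h0 l
    · simp only [Function.update_self, Function.update_of_ne hqu]
      omega
    · simp only [Function.update_of_ne (hne v hv), Function.update_of_ne (hne _ (hT.par_mem v hv h0))]
      rintro h1 h2 (⟨_, h3⟩ | ⟨h3, _⟩)
      · exact hT.par_max v hv h0 l h1 h2 h3
      · have := hT.pos_le v hv
        omega
  case child_of =>
    intro v c
    have hodd : ∀ w, ¬ (2 * v = 2 * w + 1 ∧ c = x n) := by omega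
    simp only [setEntry_apply, hodd, if_false]
    by_cases h2 : v = q ∧ c = x (n - len q)
    · obtain ⟨rfl, rfl⟩ := h2
      simp only [and_self, if_true]
      exact fun _ => ⟨.inl rfl, by simp, by simp [hqu]⟩
    · rw [if_neg (by omega)]
      intro hc
      obtain ⟨h3, h4, h5⟩ := hT.child_of v c hc
      have hv : v ≠ u := hne v (h4 ▸ hT.par_mem _ h3 hc)
      exact ⟨.inr h3, by simpa [hne _ h3] using h4, by simpa [hne _ h3, hv] using h5⟩
  case of_child =>
    have hodd : ∀ v w c, ¬ (2 * v = 2 * w + 1 ∧ c = x n) := by omega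
    rintro v (rfl | hv) h0
    · simp [setEntry_apply, hodd, hqu]
    · have hpv := hT.par_mem v hv h0
      simp only [setEntry_apply, hodd, if_false, Function.update_of_ne (hne v hv),
        Function.update_of_ne (hne _ hpv)]
      rw [if_neg, hT.of_child v hv h0]
      rintro ⟨h1, h2⟩
      have h3 := hT.of_child v hv h0
      rw [h1, h2, hFq] at h3
      exact h0 h3.symm
  case link_of =>
    intro v c
    have heven : ∀ w d, ¬ (2 * v + 1 = 2 * w ∧ c = d) := by omega
    simp only [setEntry_apply, heven, if_false]
    by_cases h1 : v = s ∧ c = x n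
    · obtain ⟨rfl, rfl⟩ := h1
      simp only [and_self, if_true]
      refine fun _ => ⟨.inr hs, .inl rfl, by simp [hsu, hsl], by simp, ?_⟩
      simpa [hsu, hsl, hsp] using Agree.refl (x := x) le_rfl
    · rw [if_neg (by omega)]
      intro hc
      obtain ⟨h2, h3, h4, h5, h6⟩ := hT.link_of v c hc
      exact ⟨.inr h2, .inr h3, by simpa [hne _ h3, hne _ h2] using h4,
        by simpa [hne _ h3] using h5, by simpa [hne _ h3, hne _ h2] using h6⟩
  case of_link =>
    have heven : ∀ v w c d : ℕ, ¬ (2 * v + 1 = 2 * w ∧ c = d) := by omega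
    rintro v (rfl | hv) w (rfl | hw)
    · simp
    · simp only [Function.update_self, Function.update_of_ne (hne w hw)]
      intro e
      have := hlen w hw
      omega
    · simp only [Function.update_self, Function.update_of_ne (hne v hv)]
      intro e ha
      have : v = s := by
        refine hT.inj v hv s hs (by omega) ?_
        rw [hsp]
        exact ha.symm
      subst this
      simp [setEntry_apply]
    · simp only [Function.update_of_ne (hne v hv), Function.update_of_ne (hne w hw)]
      intro e ha
      simp only [setEntry_apply, heven, if_false]
      rw [if_neg, hT.of_link v hv w hw e ha]
      rintro ⟨h1, h2⟩
      obtain rfl : v = s := by omega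
      have := hlen w hw
      omega

end Tree

/-! ### A program logic with running times -/

section StateLemmas

variable {α : Type*} (s : State α) (r v a i : ℕ) (c : ℕ) (ch : WithBot α)

@[simp] theorem State.setReg_reg : (s.setReg r v).reg = Function.update s.reg r v := rfl
@[simp] theorem State.setReg_arr : (s.setReg r v).arr = s.arr := rfl
@[simp] theorem State.setReg_creg : (s.setReg r v).creg = s.creg := rfl
@[simp] theorem State.setReg_carr : (s.setReg r v).carr = s.carr := rfl
@[simp] theorem State.setArr_reg : (s.setArr a i v).reg = s.reg := rfl
@[simp] theorem State.setArr_arr :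
    (s.setArr a i v).arr = Function.update s.arr a (Function.update (s.arr a) i v) := rfl
@[simp] theorem State.setArr_creg : (s.setArr a i v).creg = s.creg := rfl
@[simp] theorem State.setArr_carr : (s.setArr a i v).carr = s.carr := rfl
@[simp] theorem State.setCreg_reg : (s.setCreg c ch).reg = s.reg := rfl
@[simp] theorem State.setCreg_arr : (s.setCreg c ch).arr = s.arr := rfl
@[simp] theorem State.setCreg_creg : (s.setCreg c ch).creg = Function.update s.creg c ch := rfl
@[simp] theorem State.setCreg_carr : (s.setCreg c ch).carr = s.carr := rfl
@[simp] theorem State.setCarr_reg : (s.setCarr a i ch).reg = s.reg := rfl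
@[simp] theorem State.setCarr_arr : (s.setCarr a i ch).arr = s.arr := rfl
@[simp] theorem State.setCarr_creg : (s.setCarr a i ch).creg = s.creg := rfl
@[simp] theorem State.setCarr_carr :
    (s.setCarr a i ch).carr = Function.update s.carr a (Function.update (s.carr a) i ch) := rfl

end StateLemmas

section Logic

variable {α : Type*} [LinearOrder α] {A W : ℕ} {inp : List α}

/-- The value of a word expression, regardless of the bounds. -/
@[simp] def Expr.val (inp : List α) (s : State α) : Expr → ℕ
  | .lit k => k
  | .reg r => s.reg r
  | .get a e => s.arr a (e.val inp s)
  | .bin o e f => o.eval (e.val inp s) (f.val inp s)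
  | .cmp c d => if s.creg c < s.creg d then 0 else if s.creg c = s.creg d then 1 else 2
  | .inputLen => inp.length

/-- No bound is violated in the evaluation of a word expression. -/
@[simp] def Expr.Ok (A W : ℕ) (inp : List α) (s : State α) : Expr → Prop
  | .lit k => k < W
  | .reg _ => True
  | .get _ e => e.Ok A W inp s ∧ e.val inp s < A
  | .bin o e f => e.Ok A W inp s ∧ f.Ok A W inp s ∧ o.eval (e.val inp s) (f.val inp s) < W
  | .cmp c d => (if s.creg c < s.creg d then 0 else if s.creg c = s.creg d then 1 else 2) < W
  | .inputLen => inp.length < W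

theorem Expr.eval_eq_some_iff (s : State α) (e : Expr) (v : ℕ) :
    e.eval A W inp s = some v ↔ e.Ok A W inp s ∧ v = e.val inp s := by
  induction e generalizing v with
  | lit k => simp [Expr.eval, word, eq_comm]
  | reg r => simp [Expr.eval, eq_comm]
  | get a e ih =>
    simp only [Expr.eval, Option.bind_eq_bind, Option.bind_eq_some_iff, ih, Expr.Ok, Expr.val]
    constructor
    · rintro ⟨i, ⟨h1, rfl⟩, h2⟩
      split_ifs at h2 with h3
      exact ⟨⟨h1, h3⟩, by simpa using h2.symm⟩
    · rintro ⟨⟨h1, h2⟩, rfl⟩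
      exact ⟨_, ⟨h1, rfl⟩, by simp [h2]⟩
  | bin o e f ihe ihf =>
    simp only [Expr.eval, Option.bind_eq_bind, Option.bind_eq_some_iff, ihe, ihf, Expr.Ok,
      Expr.val, word]
    constructor
    · rintro ⟨a, ⟨h1, rfl⟩, b, ⟨h2, rfl⟩, h3⟩
      split_ifs at h3 with h4
      exact ⟨⟨h1, h2, h4⟩, by simpa using h3.symm⟩
    · rintro ⟨⟨h1, h2, h3⟩, rfl⟩
      exact ⟨_, ⟨h1, rfl⟩, _, ⟨h2, rfl⟩, by simp [h3]⟩
  | cmp c d => simp only [Expr.eval, word, Expr.Ok, Expr.val]; split_ifs <;> simp_all [eq_comm]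
  | inputLen => simp [Expr.eval, word, eq_comm]

theorem Expr.Ok.eval {s : State α} {e : Expr} (h : e.Ok A W inp s) :
    e.eval A W inp s = some (e.val inp s) :=
  (Expr.eval_eq_some_iff s e _).2 ⟨h, rfl⟩

/-- The weakest precondition for total correctness: `p` halts from the state `s`, and the final
state and the number of steps satisfy `Q`. -/
def WP (A W : ℕ) (inp : List α) (p : Cmd) (s : State α) (Q : State α → ℕ → Prop) : Prop :=
  ∃ s' t, Exec A W inp p s s' t ∧ Q s' t

variable {s : State α} {p q : Cmd} {Q R : State α → ℕ → Prop}

theorem WP.exists_exec (h : WP A W inp p s Q) : ∃ s' t, Exec A W inp p s s' t ∧ Q s' t := h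

theorem WP.mono (h : WP A W inp p s Q) (hQ : ∀ s' t, Q s' t → R s' t) : WP A W inp p s R := by
  obtain ⟨s', t, h1, h2⟩ := h
  exact ⟨s', t, h1, hQ _ _ h2⟩

@[simp] theorem wp_skip : WP A W inp .skip s Q ↔ Q s 0 := by
  constructor
  · rintro ⟨s', t, h, hQ⟩
    cases h
    exact hQ
  · exact fun h => ⟨s, 0, .skip s, h⟩

@[simp] theorem wp_assign {r : ℕ} {e : Expr} : WP A W inp (.assign r e) s Q ↔
    e.Ok A W inp s ∧ Q (s.setReg r (e.val inp s)) (e.size + 1) := by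
  constructor
  · rintro ⟨s', t, h, hQ⟩
    cases h with
    | assign he =>
      obtain ⟨h1, rfl⟩ := (Expr.eval_eq_some_iff _ _ _).1 he
      exact ⟨h1, hQ⟩
  · exact fun h => ⟨_, _, .assign h.1.eval, h.2⟩

@[simp] theorem wp_store {a : ℕ} {i e : Expr} : WP A W inp (.store a i e) s Q ↔
    (i.Ok A W inp s ∧ i.val inp s < A ∧ e.Ok A W inp s) ∧
      Q (s.setArr a (i.val inp s) (e.val inp s)) (i.size + e.size + 1) := by
  constructor
  · rintro ⟨s', t, h, hQ⟩
    cases h with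
    | store hi hA he =>
      obtain ⟨h1, rfl⟩ := (Expr.eval_eq_some_iff _ _ _).1 hi
      obtain ⟨h2, rfl⟩ := (Expr.eval_eq_some_iff _ _ _).1 he
      exact ⟨⟨h1, hA, h2⟩, hQ⟩
  · exact fun h => ⟨_, _, .store h.1.1.eval h.1.2.1 h.1.2.2.eval, h.2⟩

@[simp] theorem wp_loadChar {c a : ℕ} {i : Expr} : WP A W inp (.loadChar c a i) s Q ↔
    (i.Ok A W inp s ∧ i.val inp s < A) ∧
      Q (s.setCreg c (s.carr a (i.val inp s))) (i.size + 1) := by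
  constructor
  · rintro ⟨s', t, h, hQ⟩
    cases h with
    | loadChar hi hA =>
      obtain ⟨h1, rfl⟩ := (Expr.eval_eq_some_iff _ _ _).1 hi
      exact ⟨⟨h1, hA⟩, hQ⟩
  · exact fun h => ⟨_, _, .loadChar h.1.1.eval h.1.2, h.2⟩

@[simp] theorem wp_storeChar {c a : ℕ} {i : Expr} : WP A W inp (.storeChar a i c) s Q ↔
    (i.Ok A W inp s ∧ i.val inp s < A) ∧
      Q (s.setCarr a (i.val inp s) (s.creg c)) (i.size + 1) := by
  constructor
  · rintro ⟨s', t, h, hQ⟩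
    cases h with
    | storeChar hi hA =>
      obtain ⟨h1, rfl⟩ := (Expr.eval_eq_some_iff _ _ _).1 hi
      exact ⟨⟨h1, hA⟩, hQ⟩
  · exact fun h => ⟨_, _, .storeChar h.1.1.eval h.1.2, h.2⟩

@[simp] theorem wp_inputChar {c : ℕ} {i : Expr} : WP A W inp (.inputChar c i) s Q ↔
    i.Ok A W inp s ∧ Q (s.setCreg c (inputAt inp (i.val inp s))) (i.size + 1) := by
  constructor
  · rintro ⟨s', t, h, hQ⟩
    cases h with
    | inputChar hi =>
      obtain ⟨h1, rfl⟩ := (Expr.eval_eq_some_iff _ _ _).1 hi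
      exact ⟨h1, hQ⟩
  · exact fun h => ⟨_, _, .inputChar h.1.eval, h.2⟩

@[simp] theorem wp_seq : WP A W inp (.seq p q) s Q ↔
    WP A W inp p s fun s' t => WP A W inp q s' fun s'' t' => Q s'' (t + t') := by
  constructor
  · rintro ⟨s', t, h, hQ⟩
    cases h with
    | seq hp hq => exact ⟨_, _, hp, _, _, hq, hQ⟩
  · rintro ⟨s', t, h, s'', t', h', hQ⟩
    exact ⟨_, _, .seq h h', hQ⟩

theorem wp_branch {e : Expr} : WP A W inp (.branch e p q) s Q ↔ e.Ok A W inp s ∧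
    (e.val inp s ≠ 0 → WP A W inp p s fun s' t => Q s' (e.size + 1 + t)) ∧
    (e.val inp s = 0 → WP A W inp q s fun s' t => Q s' (e.size + 1 + t)) := by
  constructor
  · rintro ⟨s', t, h, hQ⟩
    cases h with
    | branchTrue he hv hp =>
      obtain ⟨h1, rfl⟩ := (Expr.eval_eq_some_iff _ _ _).1 he
      exact ⟨h1, fun _ => ⟨_, _, hp, hQ⟩, fun h => absurd h hv⟩
    | branchFalse he hp =>
      obtain ⟨h1, h2⟩ := (Expr.eval_eq_some_iff _ _ _).1 he
      exact ⟨h1, fun h => absurd h2.symm h, fun _ => ⟨_, _, hp, hQ⟩⟩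
  · rintro ⟨h, h1, h2⟩
    by_cases hv : e.val inp s = 0
    · obtain ⟨s', t, h3, h4⟩ := h2 hv
      exact ⟨_, _, .branchFalse (by rw [h.eval, hv]) h3, h4⟩
    · obtain ⟨s', t, h3, h4⟩ := h1 hv
      exact ⟨_, _, .branchTrue h.eval hv h3, h4⟩

/-- A loop whose body takes at most `K` steps and decreases the variant `m`. The bound on the
running time is in terms of the actual decrease of the variant. -/
theorem wp_loop {e : Expr} (K : ℕ) (I : ℕ → State α → Prop)
    (hI : ∀ m s, I m s → e.Ok A W inp s ∧ (e.val inp s ≠ 0 →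
      WP A W inp p s fun s' t => t ≤ K ∧ ∃ m' < m, I m' s'))
    {m : ℕ} (h : I m s) :
    WP A W inp (.loop e p) s fun s' t => ∃ m' ≤ m, I m' s' ∧ e.val inp s' = 0 ∧
      t ≤ (m - m') * (K + e.size + 1) + (e.size + 1) := by
  induction m using Nat.strong_induction_on generalizing s with
  | _ m ih =>
    obtain ⟨hok, hb⟩ := hI m s h
    by_cases hv : e.val inp s = 0
    · exact ⟨_, _, .loopFalse (by rw [hok.eval, hv]), m, le_rfl, h, hv, by omega⟩
    · obtain ⟨s', t, h1, h2, m', h3, h4⟩ := hb hv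
      obtain ⟨s'', t', h5, m'', h6, h7, h8, h9⟩ := ih m' h3 h4
      refine ⟨_, _, .loopTrue hok.eval hv h1 h5, m'', by omega, h7, h8, ?_⟩
      have h10 : (m' - m'' + 1) * (K + e.size + 1) ≤ (m - m'') * (K + e.size + 1) :=
        Nat.mul_le_mul_right _ (by omega)
      rw [Nat.add_mul] at h10
      omega

end Logic

/-- `f` and `g` agree outside the list `l`. -/
def SameOff {γ : Type*} (l : List ℕ) (f g : ℕ → γ) : Prop := ∀ r, r ∉ l → f r = g r

@[simp] theorem SameOff.refl {γ : Type*} {l : List ℕ} {f : ℕ → γ} : SameOff l f f := fun _ _ => rfl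

theorem SameOff.trans {γ : Type*} {l : List ℕ} {f g h : ℕ → γ} (h₁ : SameOff l f g)
    (h₂ : SameOff l g h) : SameOff l f h := fun r hr => (h₁ r hr).trans (h₂ r hr)

theorem SameOff.mono {γ : Type*} {l l' : List ℕ} {f g : ℕ → γ} (h : SameOff l f g)
    (hl : l ⊆ l') : SameOff l' f g := fun r hr => h r fun h' => hr (hl h')

@[simp] theorem SameOff.update_iff {γ : Type*} {l : List ℕ} {f g : ℕ → γ} {r : ℕ} {v : γ}
    (hr : r ∈ l) : SameOff l (Function.update f r v) g ↔ SameOff l f g := by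
  have h : ∀ i ∉ l, Function.update f r v i = f i := fun i hi =>
    Function.update_of_ne (fun e => hi (by rwa [e])) _ _
  exact ⟨fun h' i hi => (h i hi).symm.trans (h' i hi), fun h' i hi => (h i hi).trans (h' i hi)⟩

theorem ite_lt_of {c : Prop} [Decidable c] {W : ℕ} (hW : 1 < W) : (if c then 1 else 0) < W := by
  split_ifs <;> omega

theorem mul_one_sub_ite_le (a : ℕ) (c : Prop) [Decidable c] :
    a * (1 - if c then 1 else 0) ≤ a := by
  split_ifs <;> simp

attribute [simp] Expr.size BinOp.eval

-- from here on, proofs about programs only use the rules above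
attribute [irreducible] WP

/-! ### Notation for programs -/

infixr:50 " ;; " => Cmd.seq
infix:60 " ≔ " => Cmd.assign
infixl:65 " +. " => Expr.bin BinOp.add
infixl:65 " -. " => Expr.bin BinOp.sub
infixl:70 " *. " => Expr.bin BinOp.mul
infixl:70 " /. " => Expr.bin BinOp.div
infixl:70 " %. " => Expr.bin BinOp.mod
infix:62 " <. " => Expr.bin BinOp.lt
infix:62 " =. " => Expr.bin BinOp.eq

/-! ### The dictionary: digital search trees -/

-- Names that start with `a` stand for arrays, with `r` for word registers, with `c` for character
-- registers.
notation "aLink" => 4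
notation "aKey" => 5
notation "aVal" => 6
notation "rCount" => 4
notation "rOwner" => 20
notation "rKey" => 21
notation "rEntry" => 22
notation "rLoc" => 23
notation "rBits" => 24
notation "rFound" => 26
notation "rValue" => 27

/-- The memory cell that is inspected after `d` steps of the search for key `c` of owner `o`. The
cell `3 * o` holds the first entry of owner `o`, and the cells `3 * e + 1` and `3 * e + 2` hold the
two entries below the entry `e`; the search is directed by the binary digits of `c`, starting with
the least significant one. -/
def cellAt (lk : ℕ → ℕ) (o c : ℕ) : ℕ → ℕ
  | 0 => 3 * o
  | d + 1 => 3 * lk (cellAt lk o c d) + 1 + c / 2 ^ d % 2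

/-- The memory cells `lk`, the keys and the values represent the dictionary `F`, by the entries
`1, …, E`; the entry `e` belongs to the owner `own e` and is found after `dep e` steps. By `walk`,
an entry that is met after `d` steps agrees with the key searched for in the `d` least significant
digits, so the depth of the entries is bounded by the number of digits of the keys. -/
structure Dict (lk key val : ℕ → ℕ) (E : ℕ) (own dep : ℕ → ℕ) (F : ℕ → ℕ → ℕ) : Prop where
  link_one : lk 1 = 0
  link_two : lk 2 = 0
  val_zero : val 0 = 0
  walk : ∀ o c d, lk (cellAt lk o c d) ≠ 0 → lk (cellAt lk o c d) ≤ E ∧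
    own (lk (cellAt lk o c d)) = o ∧ dep (lk (cellAt lk o c d)) = d ∧
    key (lk (cellAt lk o c d)) % 2 ^ d = c % 2 ^ d
  reach : ∀ e, e ≠ 0 → e ≤ E → lk (cellAt lk (own e) (key e) (dep e)) = e
  val_eq : ∀ e, e ≠ 0 → e ≤ E → val e = F (own e) (key e) ∧ val e ≠ 0
  surj : ∀ o c, F o c ≠ 0 → ∃ e, e ≠ 0 ∧ e ≤ E ∧ own e = o ∧ key e = c
  inj : ∀ e e', e ≠ 0 → e ≤ E → e' ≠ 0 → e' ≤ E → own e = own e' → key e = key e' → e = e'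
  fresh : ∀ e, E < e → lk (3 * e + 1) = 0 ∧ lk (3 * e + 2) = 0

theorem mod_two_pow_succ_eq_iff (a b d : ℕ) :
    a % 2 ^ (d + 1) = b % 2 ^ (d + 1) ↔ a % 2 ^ d = b % 2 ^ d ∧ a / 2 ^ d % 2 = b / 2 ^ d % 2 := by
  have h : ∀ u : ℕ, u % 2 ^ (d + 1) = u % 2 ^ d + 2 ^ d * (u / 2 ^ d % 2) := fun u => by
    rw [pow_succ, Nat.mod_mul]
  constructor
  · intro e
    have h1 : a % 2 ^ d = b % 2 ^ d := by
      have := congrArg (· % 2 ^ d) e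
      simpa [pow_succ] using this
    refine ⟨h1, ?_⟩
    rw [h, h, h1] at e
    exact Nat.eq_of_mul_eq_mul_left (Nat.two_pow_pos d) (Nat.add_left_cancel e)
  · rintro ⟨h1, h2⟩
    rw [h, h, h1, h2]

namespace Dict

variable {lk key val own dep : ℕ → ℕ} {E : ℕ} {F : ℕ → ℕ → ℕ}

theorem link_eq_zero_of_zero (hD : Dict lk key val E own dep F) {o c d : ℕ}
    (h : lk (cellAt lk o c d) = 0) : lk (cellAt lk o c (d + 1)) = 0 := by
  rw [cellAt, h]
  have := hD.link_one
  have := hD.link_two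
  rcases Nat.mod_two_eq_zero_or_one (c / 2 ^ d) with e | e <;> simpa [e]

theorem ne_zero_of_le (hD : Dict lk key val E own dep F) {o c d d' : ℕ}
    (h : lk (cellAt lk o c d) ≠ 0) (hd : d' ≤ d) : lk (cellAt lk o c d') ≠ 0 := by
  induction d, hd using Nat.le_induction with
  | base => exact h
  | succ d hd ih => exact ih fun h' => h (hD.link_eq_zero_of_zero h')

/-- The outcome of a search that stops at an empty cell or at an entry with the key `c`. -/
theorem val_eq_of_search (hD : Dict lk key val E own dep F) {o c d : ℕ}
    (hd : ∀ i < d, key (lk (cellAt lk o c i)) ≠ c)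
    (h : lk (cellAt lk o c d) = 0 ∨ key (lk (cellAt lk o c d)) = c) :
    val (lk (cellAt lk o c d)) = F o c := by
  by_cases h0 : lk (cellAt lk o c d) = 0
  · rw [h0, hD.val_zero]
    by_contra hc
    obtain ⟨e, he0, heE, rfl, rfl⟩ := hD.surj o c (Ne.symm hc)
    have h1 := hD.reach e he0 heE
    rcases lt_or_ge (dep e) d with h2 | h2
    · exact hd _ h2 (by rw [h1])
    · exact hD.ne_zero_of_le (d := dep e) (by rwa [h1]) h2 h0
  · obtain ⟨h1, h2, -, -⟩ := hD.walk o c d h0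
    have h3 := h.resolve_left h0
    rw [(hD.val_eq _ h0 h1).1, h2, h3]

theorem cell_inj (hD : Dict lk key val E own dep F) {o c d o' c' d' : ℕ}
    (hd : ∀ i < d, lk (cellAt lk o c i) ≠ 0) (hd' : ∀ i < d', lk (cellAt lk o' c' i) ≠ 0)
    (h : cellAt lk o' c' d' = cellAt lk o c d) :
    o' = o ∧ d' = d ∧ c' % 2 ^ d = c % 2 ^ d := by
  cases d with
  | zero =>
    cases d' with
    | zero => simp only [cellAt] at h; exact ⟨by omega, rfl, by simp [Nat.mod_one]⟩
    | succ d' => simp only [cellAt] at h; omega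
  | succ d =>
    cases d' with
    | zero => simp only [cellAt] at h; omega
    | succ d' =>
      simp only [cellAt] at h
      have h1 : lk (cellAt lk o' c' d') = lk (cellAt lk o c d) := by omega
      have h2 : c' / 2 ^ d' % 2 = c / 2 ^ d % 2 := by omega
      obtain ⟨-, h3, h4, h5⟩ := hD.walk _ _ _ (hd d (by omega))
      obtain ⟨-, h3', h4', h5'⟩ := hD.walk _ _ _ (hd' d' (by omega))
      rw [h1] at h3' h4' h5'
      obtain rfl : d = d' := h4.symm.trans h4'
      exact ⟨h3'.symm.trans h3, rfl, (mod_two_pow_succ_eq_iff _ _ _).2 ⟨h5'.symm.trans h5, h2⟩⟩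

/-- A new entry is stored in the empty cell at which the search for its key ends. -/
theorem insert (hD : Dict lk key val E own dep F) {o c d v : ℕ} (hv : v ≠ 0)
    (hd : ∀ i < d, lk (cellAt lk o c i) ≠ 0) (h0 : lk (cellAt lk o c d) = 0) (hF : F o c = 0) :
    Dict (Function.update lk (cellAt lk o c d) (E + 1)) (Function.update key (E + 1) c)
      (Function.update val (E + 1) v) (E + 1) (Function.update own (E + 1) o)
      (Function.update dep (E + 1) d) (setEntry F o c v) := by
  set ℓ := cellAt lk o c d with hℓ
  set lk' := Function.update lk ℓ (E + 1) with hlk'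
  have hlt : ∀ i < d, lk (cellAt lk o c i) ≤ E := fun i hi => (hD.walk _ _ _ (hd i hi)).1
  -- the cells of the null entry and of entries that are not yet in use are different from `ℓ`
  have hℓne : ∀ e b, b < 2 → (e = 0 ∨ E < e) → 3 * e + 1 + b ≠ ℓ := by
    intro e b hb he h
    cases d with
    | zero => simp only [cellAt] at hℓ; omega
    | succ d =>
      simp only [cellAt] at hℓ
      have h1 := hd d (by omega)
      have h2 := hlt d (by omega)
      omega
  have hzero : ∀ e b, b < 2 → (e = 0 ∨ E < e) → lk' (3 * e + 1 + b) = 0 := by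
    intro e b hb he
    rw [hlk', Function.update_of_ne (hℓne e b hb he)]
    rcases he with rfl | he
    · interval_cases b
      · exact hD.link_one
      · exact hD.link_two
    · obtain ⟨h1, h2⟩ := hD.fresh e he
      interval_cases b
      · exact h1
      · exact h2
  have hold : ∀ o' c' d', (∀ i < d', lk (cellAt lk o' c' i) ≠ 0) →
      cellAt lk' o' c' d' = cellAt lk o' c' d' := by
    intro o' c' d'
    induction d' with
    | zero => intro; rfl
    | succ d' ih =>
      intro h
      have h1 := h d' (by omega)
      have h2 : cellAt lk o' c' d' ≠ ℓ := fun e => h1 (by rw [e, h0])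
      simp only [cellAt]
      rw [ih fun i hi => h i (by omega), hlk', Function.update_of_ne h2]
  have hold' : ∀ o' c' d', lk (cellAt lk o' c' d') ≠ 0 →
      lk' (cellAt lk' o' c' d') = lk (cellAt lk o' c' d') := by
    intro o' c' d' h
    rw [hold o' c' d' fun i hi => hD.ne_zero_of_le h hi.le, hlk', Function.update_of_ne]
    exact fun e => h (by rw [e, h0])
  have hnew : ∀ o' c' d', lk' (cellAt lk' o' c' d') ≠ 0 →
      (lk (cellAt lk o' c' d') ≠ 0) ∨
      (lk' (cellAt lk' o' c' d') = E + 1 ∧ o' = o ∧ d' = d ∧ c' % 2 ^ d = c % 2 ^ d) := by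
    intro o' c' d'
    induction d' with
    | zero =>
      intro h
      by_cases h1 : cellAt lk o' c' 0 = ℓ
      · right
        obtain ⟨rfl, rfl, h2⟩ := hD.cell_inj hd (by simp) h1
        refine ⟨?_, rfl, rfl, h2⟩
        change lk' (cellAt lk o' c' 0) = _
        rw [h1, hlk', Function.update_self]
      · left
        change lk' (cellAt lk o' c' 0) ≠ 0 at h
        rwa [hlk', Function.update_of_ne h1] at h
    | succ d' ih =>
      intro h
      have hb : c' / 2 ^ d' % 2 < 2 := Nat.mod_lt _ (by omega)
      have hw : lk' (cellAt lk' o' c' d') ≠ 0 := by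
        intro hw
        apply h
        rw [cellAt, hw]
        exact hzero 0 _ hb (.inl rfl)
      rcases ih hw with h1 | ⟨h1, -⟩
      · have hpre : ∀ i < d' + 1, lk (cellAt lk o' c' i) ≠ 0 :=
          fun i hi => hD.ne_zero_of_le h1 (by omega)
        have h2 := hold o' c' (d' + 1) hpre
        by_cases h3 : cellAt lk o' c' (d' + 1) = ℓ
        · right
          obtain ⟨rfl, h4, h5⟩ := hD.cell_inj hd hpre h3
          refine ⟨?_, rfl, h4, h5⟩
          rw [h2, h3, hlk', Function.update_self]
        · left
          rw [h2] at h
          rwa [hlk', Function.update_of_ne h3] at h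
      · refine absurd ?_ h
        rw [cellAt, h1]
        exact hzero (E + 1) _ hb (.inr (by omega))
  have hFe : ∀ e, e ≠ 0 → e ≤ E → ¬ (own e = o ∧ key e = c) := by
    rintro e he0 heE ⟨rfl, rfl⟩
    have h1 := hD.val_eq e he0 heE
    rw [hF] at h1
    exact h1.2 h1.1
  constructor
  case link_one => exact hzero 0 0 (by omega) (.inl rfl)
  case link_two => exact hzero 0 1 (by omega) (.inl rfl)
  case val_zero => rw [Function.update_of_ne (by omega), hD.val_zero]
  case walk =>
    intro o' c' d' h
    rcases hnew o' c' d' h with h1 | ⟨h1, rfl, rfl, h2⟩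
    · rw [hold' o' c' d' h1]
      obtain ⟨h2, h3, h4, h5⟩ := hD.walk _ _ _ h1
      have h6 : lk (cellAt lk o' c' d') ≠ E + 1 := by omega
      simp only [Function.update_of_ne h6]
      exact ⟨by omega, h3, h4, h5⟩
    · rw [h1]
      simpa using h2.symm
  case reach =>
    intro e he0 heE
    rcases Nat.lt_or_eq_of_le heE with h | rfl
    · have h6 : e ≠ E + 1 := by omega
      simp only [Function.update_of_ne h6]
      have h1 := hD.reach e he0 (by omega)
      rw [hold', h1]
      rwa [h1]
    · simp only [Function.update_self]
      rw [hold o c d hd, hlk', ← hℓ, Function.update_self]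
  case val_eq =>
    intro e he0 heE
    rcases Nat.lt_or_eq_of_le heE with h | rfl
    · have h6 : e ≠ E + 1 := by omega
      simp only [Function.update_of_ne h6, setEntry_apply]
      rw [if_neg (hFe e he0 (by omega))]
      exact hD.val_eq e he0 (by omega)
    · simp [setEntry_apply, hv]
  case surj =>
    intro o' c' h
    rw [setEntry_apply] at h
    split_ifs at h with h1
    · exact ⟨E + 1, by omega, le_rfl, by simp [h1.1], by simp [h1.2]⟩
    · obtain ⟨e, h2, h3, h4⟩ := hD.surj o' c' h
      exact ⟨e, h2, by omega, by simpa [show e ≠ E + 1 by omega] using h4⟩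
  case inj =>
    intro e e' he0 heE he0' heE'
    rcases Nat.lt_or_eq_of_le heE with h | rfl
    · rcases Nat.lt_or_eq_of_le heE' with h' | rfl
      · simp only [Function.update_of_ne (show e ≠ E + 1 by omega),
          Function.update_of_ne (show e' ≠ E + 1 by omega)]
        exact hD.inj e e' he0 (by omega) he0' (by omega)
      · simp only [Function.update_of_ne (show e ≠ E + 1 by omega), Function.update_self]
        exact fun h1 h2 => absurd ⟨h1, h2⟩ (hFe e he0 (by omega))
    · rcases Nat.lt_or_eq_of_le heE' with h' | rfl
      · simp only [Function.update_of_ne (show e' ≠ E + 1 by omega), Function.update_self]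
        exact fun h1 h2 => absurd ⟨h1.symm, h2.symm⟩ (hFe e' he0' (by omega))
      · simp
  case fresh =>
    intro e he
    exact ⟨hzero e 0 (by omega) (.inr (by omega)), hzero e 1 (by omega) (.inr (by omega))⟩

theorem replace (hD : Dict lk key val E own dep F) {e v : ℕ} (hv : v ≠ 0) (he0 : e ≠ 0)
    (heE : e ≤ E) :
    Dict lk key (Function.update val e v) E own dep (setEntry F (own e) (key e) v) where
  link_one := hD.link_one
  link_two := hD.link_two
  val_zero := by rw [Function.update_of_ne he0.symm, hD.val_zero]
  walk := hD.walk
  reach := hD.reach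
  val_eq e' he0' heE' := by
    rw [setEntry_apply]
    by_cases h : e' = e
    · subst h
      simp [hv]
    · rw [if_neg, Function.update_of_ne h]
      · exact hD.val_eq e' he0' heE'
      · exact fun h1 => h (hD.inj e' e he0' heE' he0 heE h1.1 h1.2)
  surj o c h := by
    rw [setEntry_apply] at h
    split_ifs at h with h1
    · exact ⟨e, he0, heE, h1.1.symm, h1.2.symm⟩
    · exact hD.surj o c h
  inj := hD.inj
  fresh := hD.fresh

end Dict

/-- The memory with `E` dictionary entries, whose keys are at most `σ`, represents `F`. -/
def HasDict (arr : ℕ → ℕ → ℕ) (E σ : ℕ) (F : ℕ → ℕ → ℕ) : Prop :=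
  (∃ own dep, Dict (arr aLink) (arr aKey) (arr aVal) E own dep F) ∧
    ∀ e ≤ E, arr aKey e ≤ σ

open NetFreq.Expr NetFreq.Cmd in
/-- Search for the key in `rKey` of the owner in `rOwner`. Afterwards `rFound` holds the value, or
`0`; `rEntry` is the entry, or `0`, and `rLoc` is the cell that holds it. -/
def findEntry : Cmd :=
  rLoc ≔ lit 3 *. reg rOwner ;;
  rEntry ≔ get aLink (reg rLoc) ;;
  rBits ≔ reg rKey ;;
  loop (reg rEntry *. (lit 1 -. (get aKey (reg rEntry) =. reg rKey))) (
    rLoc ≔ lit 3 *. reg rEntry +. lit 1 +. reg rBits %. lit 2 ;;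
    rEntry ≔ get aLink (reg rLoc) ;;
    rBits ≔ reg rBits /. lit 2) ;;
  rFound ≔ get aVal (reg rEntry)

open NetFreq.Expr NetFreq.Cmd in
/-- Set the value of the key in `rKey` of the owner in `rOwner` to `rValue`. -/
def setValue : Cmd :=
  findEntry ;;
  branch (reg rEntry)
    (store aVal (reg rEntry) (reg rValue))
    (rCount ≔ reg rCount +. lit 1 ;;
     store aLink (reg rLoc) (reg rCount) ;;
     store aKey (reg rCount) (reg rKey) ;;
     store aVal (reg rCount) (reg rValue))

section

variable {α : Type*} [LinearOrder α] {A W : ℕ} {inp : List α} {s : State α}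
  {lk key val own dep : ℕ → ℕ} {E σ : ℕ} {F : ℕ → ℕ → ℕ}

/-- The search takes at most one step for each binary digit of the keys: keys of at most `L` digits
that agree in the first `L` digits are equal. -/
theorem findEntry_spec (hD : Dict (s.arr aLink) (s.arr aKey) (s.arr aVal) E own dep F)
    (hσ : ∀ e ≤ E, s.arr aKey e ≤ σ) (hc : s.reg rKey ≤ σ)
    (hA : 3 * s.reg rOwner < A) (hA' : 3 * E + 2 < A) (hAW : A ≤ W) (hW : 3 < W) (hσW : σ < W) :
    WP A W inp findEntry s fun s' t =>
      s'.arr = s.arr ∧ s'.carr = s.carr ∧ s'.creg = s.creg ∧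
      SameOff [rEntry, rLoc, rBits, rFound] s'.reg s.reg ∧
      s'.reg rFound = F (s.reg rOwner) (s.reg rKey) ∧
      t ≤ 40 * (Nat.log 2 σ + 2) ∧
      ∃ d, s'.reg rLoc = cellAt (s.arr aLink) (s.reg rOwner) (s.reg rKey) d ∧
        s'.reg rEntry = s.arr aLink (s'.reg rLoc) ∧
        (∀ i < d, s.arr aLink (cellAt (s.arr aLink) (s.reg rOwner) (s.reg rKey) i) ≠ 0) ∧
        (s'.reg rEntry = 0 ∨ s.arr aKey (s'.reg rEntry) = s.reg rKey) ∧
        s'.reg rFound = s.arr aVal (s'.reg rEntry) := by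
  set lk := s.arr aLink with hlk
  set o := s.reg rOwner with ho
  set c := s.reg rKey with hc'
  have hle : ∀ d, lk (cellAt lk o c d) ≤ E := by
    intro d
    by_cases h : lk (cellAt lk o c d) = 0
    · omega
    · exact (hD.walk _ _ _ h).1
  have hcell : ∀ d, cellAt lk o c d < A := by
    intro d
    cases d with
    | zero => exact hA
    | succ d =>
      have := hle d
      simp only [cellAt]
      omega
  set L := Nat.log 2 σ + 1 with hL
  have hσL : ∀ i ≤ σ, i < 2 ^ L := fun i hi =>
    hi.trans_lt (Nat.lt_pow_succ_log_self (by omega) σ)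
  let I : ℕ → State α → Prop := fun m s' =>
    s'.arr = s.arr ∧ s'.carr = s.carr ∧ s'.creg = s.creg ∧
    SameOff [rEntry, rLoc, rBits, rFound] s'.reg s.reg ∧
    ∃ d, m + d = L ∧ s'.reg rLoc = cellAt lk o c d ∧ s'.reg rEntry = lk (cellAt lk o c d) ∧
      s'.reg rBits = c / 2 ^ d ∧
      ∀ i < d, lk (cellAt lk o c i) ≠ 0 ∧ s.arr aKey (lk (cellAt lk o c i)) ≠ c
  simp only [findEntry]
  have h0 := hcell 0
  simp only [cellAt] at h0
  simp [← hlk, ← ho, ← hc', h0]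
  refine ⟨⟨by omega, by omega⟩, ?_⟩
  refine WP.mono (wp_loop 20 I ?_ (m := L) ?_) ?_
  · rintro m s' ⟨h1, h2, h3, h4, d, h5, h6, h7, h8, h9⟩
    have hk : s'.reg rKey = c := h4 _ (by simp)
    have h10 := hle d
    have h11 := hcell (d + 1)
    have h12 : lk (cellAt lk o c d) * (1 - if s.arr aKey (lk (cellAt lk o c d)) = c then 1 else 0)
        ≤ lk (cellAt lk o c d) := by
      split_ifs <;> simp
    simp only [Expr.Ok, Expr.val, BinOp.eval, h1, hk, h7]
    refine ⟨⟨trivial, ⟨by omega, ⟨⟨trivial, by omega⟩, trivial, ?_⟩, ?_⟩, by omega⟩, ?_⟩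
    · split_ifs <;> omega
    · split_ifs <;> omega
    · intro h13
      have h14 : lk (cellAt lk o c d) ≠ 0 := by
        intro h; simp [h] at h13
      have h15 : s.arr aKey (lk (cellAt lk o c d)) ≠ c := by
        intro h; simp [h] at h13
      have hdL : d < L := by
        by_contra hcon
        have h16 := (hD.walk _ _ _ h14).2.2.2
        rw [show d = L by omega, Nat.mod_eq_of_lt (hσL _ hc),
          Nat.mod_eq_of_lt (hσL _ (hσ _ (by have := hle L; omega)))] at h16
        exact h15 (by rw [show d = L by omega]; exact h16)
      have h16 : c / 2 ^ d ≤ c := Nat.div_le_self _ _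
      simp only [cellAt] at h11
      simp [h1, h7, h8, ← hlk]
      refine ⟨by omega, h11, by omega, m - 1, by omega, ?_⟩
      refine ⟨h1, h2, h3, ?_, d + 1, by omega, ?_, ?_, ?_, ?_⟩
      · simp [h4]
      · simp [cellAt]
      · simp [cellAt]
      · simp [Nat.div_div_eq_div_mul, pow_succ]
      · intro i hi
        rcases Nat.lt_succ_iff_lt_or_eq.1 hi with h | rfl
        · exact h9 i h
        · exact ⟨h14, h15⟩
  · refine ⟨rfl, rfl, rfl, ?_, 0, rfl, ?_, ?_, ?_, ?_⟩
    · simp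
    · simp [cellAt]
    · simp [cellAt]
    · simp
    · simp
  · rintro s' t ⟨m', hm', ⟨h1, h2, h3, h4, d, h5, h6, h7, h8, h9⟩, hz, ht⟩
    have hk : s'.reg rKey = c := h4 _ (by simp)
    have hend : lk (cellAt lk o c d) = 0 ∨ s.arr aKey (lk (cellAt lk o c d)) = c := by
      by_contra hcon
      simp [h1, hk, h7, not_or.1 hcon] at hz
    have hm'' : (L - m') * 28 ≤ L * 28 := Nat.mul_le_mul_right _ (by omega)
    simp at ht
    rw [h1, h2, h3, h6, h7]
    refine ⟨?_, rfl, rfl, rfl, ?_, ?_, ?_, d, rfl, rfl, fun i hi => (h9 i hi).1, hend, ?_⟩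
    · have := hle d
      omega
    · simpa using h4
    · exact hD.val_eq_of_search (fun i hi => (h9 i hi).2) hend
    · omega
    · simp

/-- Setting a value keeps the representation, at the cost of at most one new entry. -/
theorem setValue_spec (hD : HasDict s.arr (s.reg rCount) σ F)
    (hc : s.reg rKey ≤ σ) (hv : s.reg rValue ≠ 0)
    (hA : 3 * s.reg rOwner < A) (hA' : 3 * s.reg rCount + 5 < A) (hAW : A ≤ W) (hW : 3 < W)
    (hσW : σ < W) :
    WP A W inp setValue s fun s' t =>
      SameOff [aLink, aKey, aVal] s'.arr s.arr ∧ s'.carr = s.carr ∧ s'.creg = s.creg ∧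
      SameOff [rEntry, rLoc, rBits, rFound, rCount] s'.reg s.reg ∧
      s'.reg rCount ≤ s.reg rCount + 1 ∧
      HasDict s'.arr (s'.reg rCount) σ
        (setEntry F (s.reg rOwner) (s.reg rKey) (s.reg rValue)) ∧
      t ≤ 40 * (Nat.log 2 σ + 2) + 20 := by
  obtain ⟨⟨own, dep, hD⟩, hσ⟩ := hD
  simp only [setValue, wp_seq]
  refine (findEntry_spec hD hσ hc hA (by omega) hAW hW hσW).mono ?_
  rintro s' t ⟨h1, h2, h3, h4, h5, h6, d, h7, h8, h9, h10, h11⟩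
  have hE : s'.reg rCount = s.reg rCount := h4 _ (by simp)
  have hK : s'.reg rKey = s.reg rKey := h4 _ (by simp)
  have hV : s'.reg rValue = s.reg rValue := h4 _ (by simp)
  have hle : ∀ o c d, s.arr aLink (cellAt (s.arr aLink) o c d) ≤ s.reg rCount := by
    intro o c d
    by_cases h : s.arr aLink (cellAt (s.arr aLink) o c d) = 0
    · omega
    · exact (hD.walk _ _ _ h).1
  have hloc : s'.reg rLoc < A := by
    rw [h7]
    cases d with
    | zero => exact hA
    | succ d =>
      have := hle (s.reg rOwner) (s.reg rKey) d
      simp only [cellAt]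
      omega
  have hent : s'.reg rEntry ≤ s.reg rCount := by
    rw [h8, h7]
    exact hle _ _ _
  rw [wp_branch]
  refine ⟨by simp, fun hne => ?_, fun he => ?_⟩
  · simp only [Expr.val] at hne
    simp [hV]
    have hk := h10.resolve_left hne
    have ho := (hD.walk (s.reg rOwner) (s.reg rKey) d (by rwa [← h7, ← h8])).2.1
    rw [← h7, ← h8] at ho
    refine ⟨by omega, ?_, h2, h3, ?_, by omega, ⟨⟨own, dep, ?_⟩, ?_⟩, by omega⟩
    · rw [h1]
      simp
    · exact h4.mono (by simp)
    · have := hD.replace hv hne hent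
      rw [hk, ho] at this
      simpa [h1, hE] using this
    · simpa [h1, hE] using hσ
  · simp only [Expr.val] at he
    have hF : F (s.reg rOwner) (s.reg rKey) = 0 := by
      rw [← h5, h11, he, hD.val_zero]
    simp [hE, hV, hK]
    refine ⟨by omega, by omega, by omega, ?_, h2, h3, ?_, ⟨⟨
      Function.update own (s.reg rCount + 1) (s.reg rOwner),
      Function.update dep (s.reg rCount + 1) d, ?_⟩, ?_⟩, by omega⟩
    · rw [h1]
      simp
    · simpa using h4.mono (by simp)
    · have := hD.insert hv h9 (by rw [← h7, ← h8, he]) hF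
      rw [← h7] at this
      simpa [h1] using this
    · intro e heE
      by_cases h : e = s.reg rCount + 1
      · simpa [h1, h] using hc
      · simpa [h1, h] using hσ e (by omega)

end

/-! ### The alphabet: an AVL tree -/

-- The characters are numbered in the order of their first arrival: `aChar` lists them, and these
-- numbers are the nodes of the search tree.
notation "aChild" => 11
notation "aHeight" => 12
notation "aPathNode" => 13
notation "aPathDir" => 14
notation "aChar" => 0
notation "cInput" => 0
notation "cNode" => 1
notation "rSigma" => 2
notation "rRoot" => 3
notation "rId" => 10
notation "rCmp" => 12
notation "rDepth" => 13
notation "rSub" => 14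
notation "rTop" => 15
notation "rDir" => 16
notation "rSib" => 17
notation "rIn" => 18

/-- Binary trees of memory addresses. -/
inductive Tr where
  | nil
  | node (l : Tr) (q : ℕ) (r : Tr)

namespace Tr

/-- The address of the root, `0` for the empty tree. -/
def root : Tr → ℕ
  | nil => 0
  | node _ q _ => q

@[simp] theorem root_nil : nil.root = 0 := rfl

@[simp] theorem root_node (l : Tr) (q : ℕ) (r : Tr) : (node l q r).root = q := rfl

/-- The addresses in symmetric order. -/
@[simp] def toList : Tr → List ℕ
  | nil => []
  | node l q r => l.toList ++ q :: r.toList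

/-- The height. -/
@[simp] def ht : Tr → ℕ
  | nil => 0
  | node l _ r => 1 + max l.ht r.ht

/-- The AVL condition. -/
@[simp] def Bal : Tr → Prop
  | nil => True
  | node l _ r => l.ht ≤ r.ht + 1 ∧ r.ht ≤ l.ht + 1 ∧ l.Bal ∧ r.Bal

/-- The memory with children `ch` and heights `h` contains the tree. The children of `q` are in the
cells `3 * q` and `3 * q + 2`. -/
@[simp] def Rep (ch h : ℕ → ℕ) : Tr → Prop
  | nil => True
  | node l q r => q ≠ 0 ∧ ch (3 * q) = l.root ∧ ch (3 * q + 2) = r.root ∧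
      h q = 1 + max l.ht r.ht ∧ l.Rep ch h ∧ r.Rep ch h

/-- The tree with root `q`, the subtree `a` on side `d` (left for `0`, right for `2`) and `b` on the
other side. -/
def join (d : ℕ) (a : Tr) (q : ℕ) (b : Tr) : Tr := if d = 0 then node a q b else node b q a

variable {ch h ch' h' : ℕ → ℕ} {d p q i : ℕ} {t a b x y u v : Tr}

theorem rep_join (hd : d = 0 ∨ d = 2) : (join d a q b).Rep ch h ↔ q ≠ 0 ∧
    ch (3 * q + d) = a.root ∧ ch (3 * q + (2 - d)) = b.root ∧
    h q = 1 + max a.ht b.ht ∧ a.Rep ch h ∧ b.Rep ch h := by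
  rcases hd with rfl | rfl
  · simp [join]
  · simp only [join, OfNat.ofNat_ne_zero, if_false, Rep, Nat.sub_self, Nat.add_zero,
      max_comm b.ht a.ht]
    tauto

@[simp] theorem root_join : (join d a q b).root = q := by
  unfold join; split_ifs <;> rfl

@[simp] theorem ht_join : (join d a q b).ht = 1 + max a.ht b.ht := by
  unfold join; split_ifs <;> simp [max_comm]

@[simp] theorem bal_join :
    (join d a q b).Bal ↔ a.ht ≤ b.ht + 1 ∧ b.ht ≤ a.ht + 1 ∧ a.Bal ∧ b.Bal := by
  unfold join
  split_ifs
  · simp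
  · simp only [Bal]; tauto

@[simp] theorem mem_join {r : ℕ} :
    r ∈ (join d a q b).toList ↔ r ∈ a.toList ∨ r = q ∨ r ∈ b.toList := by
  unfold join
  split_ifs
  · simp
  · simp only [toList, List.mem_append, List.mem_cons]; tauto

theorem toList_rotate :
    (join d x p (join d y q b)).toList = (join d (join d x p y) q b).toList := by
  unfold join; split_ifs <;> simp

theorem toList_double : (join d (join d x p u) i (join d v q b)).toList =
    (join d (join d x p (join d u i v)) q b).toList := by
  unfold join; split_ifs <;> simp

theorem exists_join (d : ℕ) (ht : 0 < t.ht) : ∃ a q b, t = join d a q b := by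
  cases t with
  | nil => simp at ht
  | node l q r =>
    by_cases hd : d = 0
    · exact ⟨l, q, r, by simp [join, hd]⟩
    · exact ⟨r, q, l, by simp [join, hd]⟩

theorem nodup_join : (join d a q b).toList.Nodup ↔ a.toList.Nodup ∧ b.toList.Nodup ∧
    q ∉ a.toList ∧ q ∉ b.toList ∧ ∀ r ∈ a.toList, r ∉ b.toList := by
  unfold join
  split_ifs
  · simp only [toList, List.nodup_append, List.nodup_cons, List.mem_cons]
    constructor
    · rintro ⟨h1, ⟨h2, h3⟩, h4⟩
      exact ⟨h1, h3, fun hq => h4 q hq q (.inl rfl) rfl, h2, fun r hr hr' => h4 r hr r (.inr hr') rfl⟩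
    · rintro ⟨h1, h2, h3, h4, h5⟩
      refine ⟨h1, ⟨h4, h2⟩, ?_⟩
      rintro r hr r' (rfl | hr') rfl
      · exact h3 hr
      · exact h5 r hr hr'
  · simp only [toList, List.nodup_append, List.nodup_cons, List.mem_cons]
    constructor
    · rintro ⟨h1, ⟨h2, h3⟩, h4⟩
      exact ⟨h3, h1, h2, fun hq => h4 q hq q (.inl rfl) rfl, fun r hr hr' => h4 r hr' r (.inr hr) rfl⟩
    · rintro ⟨h1, h2, h3, h4, h5⟩
      refine ⟨h2, ⟨h3, h1⟩, ?_⟩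
      rintro r hr r' (rfl | hr') rfl
      · exact h4 hr
      · exact h5 r hr' hr

theorem Rep.congr (ht : t.Rep ch h) (hh : ∀ q ∈ t.toList,
    ch' (3 * q) = ch (3 * q) ∧ ch' (3 * q + 2) = ch (3 * q + 2) ∧ h' q = h q) : t.Rep ch' h' := by
  induction t with
  | nil => trivial
  | node l q r ihl ihr =>
    obtain ⟨h1, h2, h3, h4, h5, h6⟩ := ht
    obtain ⟨e1, e2, e3⟩ := hh q (by simp)
    exact ⟨h1, by rw [e1, h2], by rw [e2, h3], by rw [e3, h4],
      ihl h5 fun q hq => hh q (by simp [hq]), ihr h6 fun q hq => hh q (by simp [hq])⟩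

theorem Rep.height (ht : t.Rep ch h) (h0 : h 0 = 0) : h t.root = t.ht := by
  cases t with
  | nil => exact h0
  | node l q r => exact ht.2.2.2.1

theorem ht_le_length : t.ht ≤ t.toList.length := by
  induction t with
  | nil => simp
  | node l q r => simp; omega

/-- The number of nodes of an AVL tree is exponential in its height. -/
theorem two_pow_ht_le (hb : t.Bal) : 2 ^ ((t.ht + 1) / 2) ≤ t.toList.length + 1 := by
  induction t with
  | nil => simp
  | node l q r ihl ihr =>
    obtain ⟨h1, h2, h3, h4⟩ := hb
    have el := ihl h3
    have er := ihr h4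
    have key : ∀ m n : ℕ, m ≤ n → n ≤ m + 1 →
        2 ^ ((1 + n + 1) / 2) ≤ 2 ^ ((m + 1) / 2) + 2 ^ ((n + 1) / 2) := by
      intro m n hmn hnm
      have e1 : 2 ^ ((1 + n + 1) / 2) = 2 ^ (n / 2) + 2 ^ (n / 2) := by
        rw [show (1 + n + 1) / 2 = n / 2 + 1 by omega]; ring
      have e2 : 2 ^ (n / 2) ≤ 2 ^ ((m + 1) / 2) := Nat.pow_le_pow_right (by omega) (by omega)
      have e3 : 2 ^ (n / 2) ≤ 2 ^ ((n + 1) / 2) := Nat.pow_le_pow_right (by omega) (by omega)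
      omega
    simp only [ht, toList, List.length_append, List.length_cons]
    rcases le_total l.ht r.ht with hc | hc
    · rw [max_eq_right hc]
      have := key _ _ hc h2
      omega
    · rw [max_eq_left hc]
      have := key _ _ hc h1
      omega

theorem ht_le_log (hb : t.Bal) : t.ht ≤ 2 * Nat.log 2 (t.toList.length + 1) := by
  have := Nat.le_log_of_pow_le (by omega) (two_pow_ht_le hb)
  omega

end Tr

/-- A path from a subtree up to the root: the sides on which the path branches off, the nodes on the
path and their other subtrees. -/
abbrev Ctx := List (ℕ × ℕ × Tr)

namespace Ctx

/-- The tree with `t` at the end of the path. -/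
@[simp] def plug : Ctx → Tr → Tr
  | [], t => t
  | (d, q, b) :: c, t => plug c (Tr.join d t q b)

/-- The addresses to the left of the end of the path. -/
@[simp] def left : Ctx → List ℕ
  | [] => []
  | (d, q, b) :: c => if d = 0 then left c else left c ++ (b.toList ++ [q])

/-- The addresses to the right of the end of the path. -/
@[simp] def right : Ctx → List ℕ
  | [] => []
  | (d, q, b) :: c => if d = 0 then q :: b.toList ++ right c else right c

/-- The stacks `pn` and `pd` hold the nodes and the sides of the path. -/
@[simp] def Stack (pn pd : ℕ → ℕ) : Ctx → Prop
  | [] => True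
  | (d, q, _) :: c => pn (List.length c) = q ∧ pd (List.length c) = d ∧ Stack pn pd c

/-- The memory holds the trees along the path. The heights of the nodes on the path are not
considered. -/
@[simp] def Rep (ch h : ℕ → ℕ) : Ctx → Prop
  | [] => True
  | (d, q, b) :: c => (d = 0 ∨ d = 2) ∧ q ≠ 0 ∧ ch (3 * q + (2 - d)) = b.root ∧ b.Rep ch h ∧
      Rep ch h c

/-- The AVL condition holds along the path if a tree of height `H` is at its end. -/
@[simp] def Bal : Ctx → ℕ → Prop
  | [], _ => True
  | (_, _, b) :: c, H => b.Bal ∧ H ≤ b.ht + 1 ∧ b.ht ≤ H + 1 ∧ Bal c (1 + max H b.ht)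

/-- The sides are `0` or `2`. -/
@[simp] def Sides : Ctx → Prop
  | [] => True
  | (d, _, _) :: c => (d = 0 ∨ d = 2) ∧ Sides c

variable {ch h ch' h' pn pd pn' pd' : ℕ → ℕ} {c : Ctx} {t t' : Tr}

theorem toList_plug (c : Ctx) (t : Tr) :
    (c.plug t).toList = left c ++ (t.toList ++ right c) := by
  induction c generalizing t with
  | nil => simp
  | cons e c ih =>
    obtain ⟨d, q, b⟩ := e
    simp only [plug, ih, left, right, Tr.join]
    split_ifs <;> simp

theorem rep_of_plug (hs : Sides c) (h1 : (c.plug t).Rep ch h) : t.Rep ch h ∧ c.Rep ch h := by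
  induction c generalizing t with
  | nil => exact ⟨h1, trivial⟩
  | cons e c ih =>
    obtain ⟨d, q, b⟩ := e
    obtain ⟨h2, h3⟩ := ih hs.2 h1
    rw [Tr.rep_join hs.1] at h2
    exact ⟨h2.2.2.2.2.1, hs.1, h2.1, h2.2.2.1, h2.2.2.2.2.2, h3⟩

theorem bal_of_plug (h1 : (c.plug t).Bal) : t.Bal ∧ Bal c t.ht := by
  induction c generalizing t with
  | nil => exact ⟨h1, trivial⟩
  | cons e c ih =>
    obtain ⟨d, q, b⟩ := e
    obtain ⟨h2, h3⟩ := ih h1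
    rw [Tr.bal_join] at h2
    rw [Tr.ht_join] at h3
    exact ⟨h2.2.2.1, h2.2.2.2, h2.1, h2.2.1, h3⟩

theorem length_add_ht_le (c : Ctx) (t : Tr) : c.length + t.ht ≤ (c.plug t).ht := by
  induction c generalizing t with
  | nil => simp
  | cons e c ih =>
    obtain ⟨d, q, b⟩ := e
    have := ih (Tr.join d t q b)
    simp at this ⊢
    omega

theorem Rep.congr (hc : c.Rep ch h) (hh : ∀ q ∈ left c ++ right c,
    ch' (3 * q) = ch (3 * q) ∧ ch' (3 * q + 2) = ch (3 * q + 2) ∧ h' q = h q) :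
    c.Rep ch' h' := by
  induction c with
  | nil => trivial
  | cons e c ih =>
    obtain ⟨d, q, b⟩ := e
    obtain ⟨h1, h2, h3, h4, h5⟩ := hc
    have hm : ∀ r, r = q ∨ r ∈ b.toList ∨ r ∈ left c ++ right c →
        r ∈ left ((d, q, b) :: c) ++ right ((d, q, b) :: c) := by
      intro r
      simp only [left, right]
      split_ifs <;> simp <;> tauto
    refine ⟨h1, h2, ?_, h4.congr fun r hr => hh r (hm r (by tauto)),
      ih h5 fun r hr => hh r (hm r (by tauto))⟩
    obtain ⟨e1, e2, -⟩ := hh q (hm q (by tauto))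
    rcases h1 with rfl | rfl
    · exact e2.trans h3
    · exact e1.trans h3

theorem Stack.congr (hc : Stack pn pd c) (hh : ∀ i < c.length, pn' i = pn i ∧ pd' i = pd i) :
    Stack pn' pd' c := by
  induction c with
  | nil => trivial
  | cons e c ih =>
    obtain ⟨d, q, b⟩ := e
    obtain ⟨h1, h2, h3⟩ := hc
    obtain ⟨e1, e2⟩ := hh c.length (by simp)
    exact ⟨e1.trans h1, e2.trans h2, ih h3 fun i hi => hh i (by simp; omega)⟩

end Ctx

namespace Tr

variable {ch h : ℕ → ℕ} {d p q i : ℕ} {t b x y u v : Tr}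

/-- The memory after the writes of a rebalancing step without rotation. -/
theorem rep_noRotation (hd : d = 0 ∨ d = 2) (hn : (join d t q b).toList.Nodup) (hq : q ≠ 0)
    (ht : t.Rep ch h) (hb : b.Rep ch h) (hc : ch (3 * q + (2 - d)) = b.root) :
    (join d t q b).Rep (Function.update ch (3 * q + d) t.root)
      (Function.update h q (1 + max t.ht b.ht)) := by
  obtain ⟨-, -, h1, h2, -⟩ := nodup_join.1 hn
  rw [rep_join hd]
  refine ⟨hq, by simp, ?_, by simp, ht.congr ?_, hb.congr ?_⟩
  · rw [Function.update_of_ne (by omega), hc]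
  all_goals
    intro r hr
    have hrq : r ≠ q := by rintro rfl; contradiction
    refine ⟨?_, ?_, ?_⟩ <;> rw [Function.update_of_ne (by omega)]

/-- The memory after the writes of a single rotation. -/
theorem rep_singleRotation (hd : d = 0 ∨ d = 2)
    (hn : (join d (join d x p y) q b).toList.Nodup) (hq : q ≠ 0)
    (ht : (join d x p y).Rep ch h) (hb : b.Rep ch h) (hc : ch (3 * q + (2 - d)) = b.root) :
    (join d x p (join d y q b)).Rep
      (Function.update (Function.update ch (3 * q + d) y.root) (3 * p + (2 - d)) q)
      (Function.update (Function.update h q (1 + max y.ht b.ht)) p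
        (1 + max x.ht (1 + max y.ht b.ht))) := by
  obtain ⟨h3, -, h1, h2, h4⟩ := nodup_join.1 hn
  obtain ⟨-, -, h5, h6, h7⟩ := nodup_join.1 h3
  have hpq : p ≠ q := fun e => h1 (by simp [e])
  have hpb : p ∉ b.toList := h4 p (by simp)
  simp only [mem_join, not_or] at h1
  rw [rep_join hd] at ht
  obtain ⟨e1, e2, e3, e4, e5, e6⟩ := ht
  rw [rep_join hd, rep_join hd]
  refine ⟨e1, ?_, by rw [root_join, Function.update_self], by simp, e5.congr ?_, hq, ?_, ?_, ?_,
    e6.congr ?_, hb.congr ?_⟩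
  · rw [Function.update_of_ne (by omega), Function.update_of_ne (by omega), e2]
  · intro r hr
    have hrq : r ≠ q := by rintro rfl; tauto
    have hrp : r ≠ p := by rintro rfl; tauto
    refine ⟨?_, ?_, ?_⟩ <;>
      rw [Function.update_of_ne (by omega), Function.update_of_ne (by omega)]
  · rw [Function.update_of_ne (by omega), Function.update_self]
  · rw [Function.update_of_ne (by omega), Function.update_of_ne (by omega), hc]
  · rw [Function.update_of_ne (by omega), Function.update_self]
  all_goals
    intro r hr
    have hrq : r ≠ q := by rintro rfl; tauto
    have hrp : r ≠ p := by rintro rfl; tauto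
    refine ⟨?_, ?_, ?_⟩ <;>
      rw [Function.update_of_ne (by omega), Function.update_of_ne (by omega)]

/-- The memory after the writes of a double rotation. -/
theorem rep_doubleRotation (hd : d = 0 ∨ d = 2)
    (hn : (join d (join d x p (join d u i v)) q b).toList.Nodup) (hq : q ≠ 0)
    (ht : (join d x p (join d u i v)).Rep ch h) (hb : b.Rep ch h)
    (hc : ch (3 * q + (2 - d)) = b.root) :
    (join d (join d x p u) i (join d v q b)).Rep
      (Function.update (Function.update (Function.update (Function.update ch
        (3 * p + (2 - d)) u.root) (3 * q + d) v.root) (3 * i + d) p) (3 * i + (2 - d)) q)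
      (Function.update (Function.update (Function.update h
        i (1 + max (1 + max x.ht u.ht) (1 + max v.ht b.ht))) p (1 + max x.ht u.ht))
        q (1 + max v.ht b.ht)) := by
  obtain ⟨h3, -, h1, h2, h4⟩ := nodup_join.1 hn
  obtain ⟨-, h8, h5, h6, h7⟩ := nodup_join.1 h3
  obtain ⟨-, -, h9, h10, h11⟩ := nodup_join.1 h8
  have hpq : p ≠ q := fun e => h1 (by simp [e])
  have hiq : i ≠ q := fun e => h1 (by simp [e])
  have hip : i ≠ p := fun e => h6 (by simp [e])
  have hpb : p ∉ b.toList := h4 p (by simp)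
  have hib : i ∉ b.toList := h4 i (by simp)
  have hix : i ∉ x.toList := fun hi => h7 i hi (by simp)
  rw [rep_join hd, rep_join hd] at ht
  obtain ⟨e1, e2, e3, e4, e5, f1, f2, f3, f4, f5, f6⟩ := ht
  have hoff : ∀ w : Tr, q ∉ w.toList → p ∉ w.toList → i ∉ w.toList → w.Rep ch h → w.Rep
      (Function.update (Function.update (Function.update (Function.update ch
        (3 * p + (2 - d)) u.root) (3 * q + d) v.root) (3 * i + d) p) (3 * i + (2 - d)) q)
      (Function.update (Function.update (Function.update h
        i (1 + max (1 + max x.ht u.ht) (1 + max v.ht b.ht))) p (1 + max x.ht u.ht))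
        q (1 + max v.ht b.ht)) := by
    intro w hw1 hw2 hw3 hw
    refine hw.congr fun r hr => ?_
    have hrq : r ≠ q := fun e => hw1 (e ▸ hr)
    have hrp : r ≠ p := fun e => hw2 (e ▸ hr)
    have hri : r ≠ i := fun e => hw3 (e ▸ hr)
    clear hw hw1 hw2 hw3 hr h1 h2 h4 h5 h6 h7 h9 h10 h11 hn h3 h8
    refine ⟨?_, ?_, ?_⟩
    · rw [Function.update_of_ne (by omega), Function.update_of_ne (by omega),
        Function.update_of_ne (by omega), Function.update_of_ne (by omega)]
    · rw [Function.update_of_ne (by omega), Function.update_of_ne (by omega),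
        Function.update_of_ne (by omega), Function.update_of_ne (by omega)]
    · rw [Function.update_of_ne hrq, Function.update_of_ne hrp, Function.update_of_ne hri]
  rw [rep_join hd, rep_join hd, rep_join hd]
  simp only [root_join, ht_join]
  refine ⟨f1, ?_, by simp, ?_, ⟨e1, ?_, ?_, ?_, ?_, ?_⟩, hq, ?_, ?_, by simp, ?_, ?_⟩
  · rw [Function.update_of_ne (by omega), Function.update_self]
  · rw [Function.update_of_ne hiq, Function.update_of_ne hip, Function.update_self]
  · rw [Function.update_of_ne (by omega), Function.update_of_ne (by omega),
      Function.update_of_ne (by omega), Function.update_of_ne (by omega), e2]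
  · rw [Function.update_of_ne (by omega), Function.update_of_ne (by omega),
      Function.update_of_ne (by omega), Function.update_self]
  · rw [Function.update_of_ne hpq, Function.update_self]
  · exact hoff x (fun hx => h1 (by simp [hx])) h5 hix e5
  · exact hoff u (fun hx => h1 (by simp [hx])) (fun hx => h6 (by simp [hx])) h9 f5
  · rw [Function.update_of_ne (by omega), Function.update_of_ne (by omega), Function.update_self]
  · rw [Function.update_of_ne (by omega), Function.update_of_ne (by omega),
      Function.update_of_ne (by omega), Function.update_of_ne (by omega), hc]
  · exact hoff v (fun hx => h1 (by simp [hx])) (fun hx => h6 (by simp [hx])) h10 f6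
  · exact hoff b h2 hpb hib hb

end Tr

open NetFreq.Expr NetFreq.Cmd in
/-- Replace the subtree at `rTop`, which has `rSub` as its subtree on side `rDir` and `rSib` as the
other one, by a balanced tree with the same nodes; `rSub` becomes its root. The tree `rSub` may be
higher than `rSib` by at most two. -/
def rebalance : Cmd :=
  store aChild (lit 3 *. reg rTop +. reg rDir) (reg rSub) ;;
  rSib ≔ get aChild (lit 3 *. reg rTop +. (lit 2 -. reg rDir)) ;;
  branch (get aHeight (reg rSib) +. lit 1 <. get aHeight (reg rSub))
    (rIn ≔ get aChild (lit 3 *. reg rSub +. (lit 2 -. reg rDir)) ;;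
     branch (get aHeight (get aChild (lit 3 *. reg rSub +. reg rDir)) <. get aHeight (reg rIn))
      (store aChild (lit 3 *. reg rSub +. (lit 2 -. reg rDir))
         (get aChild (lit 3 *. reg rIn +. reg rDir)) ;;
       store aChild (lit 3 *. reg rTop +. reg rDir)
         (get aChild (lit 3 *. reg rIn +. (lit 2 -. reg rDir))) ;;
       store aChild (lit 3 *. reg rIn +. reg rDir) (reg rSub) ;;
       store aChild (lit 3 *. reg rIn +. (lit 2 -. reg rDir)) (reg rTop) ;;
       store aHeight (reg rIn) (get aHeight (reg rSub)) ;;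
       store aHeight (reg rSub) (get aHeight (reg rSub) -. lit 1) ;;
       store aHeight (reg rTop) (get aHeight (reg rSib) +. lit 1) ;;
       rSub ≔ reg rIn)
      (store aChild (lit 3 *. reg rTop +. reg rDir) (reg rIn) ;;
       store aChild (lit 3 *. reg rSub +. (lit 2 -. reg rDir)) (reg rTop) ;;
       store aHeight (reg rTop) (get aHeight (reg rIn) +. lit 1) ;;
       store aHeight (reg rSub) (get aHeight (reg rTop) +. lit 1)))
    (branch (get aHeight (reg rSib) <. get aHeight (reg rSub))
      (store aHeight (reg rTop) (get aHeight (reg rSub) +. lit 1))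
      (store aHeight (reg rTop) (get aHeight (reg rSib) +. lit 1)) ;;
     rSub ≔ reg rTop)

section

variable {α : Type*} [LinearOrder α] {A W : ℕ} {inp : List α} {s : State α}

theorem Tr.root_le {t : Tr} {M : ℕ} (h : ∀ r ∈ t.toList, r ≤ M) : t.root ≤ M := by
  cases t with
  | nil => simp
  | node l q r => exact h q (by simp)

theorem Tr.root_ne {t : Tr} {q : ℕ} (hq : q ≠ 0) (h : q ∉ t.toList) : t.root ≠ q := by
  cases t with
  | nil => exact hq.symm
  | node l r' r => rintro rfl; simp at h

theorem update_cell_of_ne {f : ℕ → ℕ} {q r d v : ℕ} (hd : d < 3) (h : r ≠ q) :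
    Function.update f (3 * q + d) v (3 * r) = f (3 * r) ∧
    Function.update f (3 * q + d) v (3 * r + 2) = f (3 * r + 2) :=
  ⟨Function.update_of_ne (by omega) _ _, Function.update_of_ne (by omega) _ _⟩

theorem cell_ne {p q d e : ℕ} (hd : d < 3) (he : e < 3) (h : p ≠ q) : 3 * p + d ≠ 3 * q + e := by
  omega

/-- The heights in a single rotation: the subtrees `x` and `y` of the taller subtree, which had
height `H` before the insertion, and the other subtree `b`. -/
theorem heights_of_single {x y b H : ℕ} (hxy : y ≤ x) (h1 : H ≤ 1 + max x y)
    (h2 : 1 + max x y ≤ H + 1) (h3 : H ≤ b + 1) (hlt : b + 1 < 1 + max x y)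
    (hb : x ≤ y + 1) : x = b + 1 ∧ H = b + 1 ∧ max y b = y ∧ b ≤ y ∧ y ≤ b + 1 := by
  rw [max_eq_left hxy] at h1 h2 hlt
  have hby : b ≤ y := by omega
  exact ⟨by omega, by omega, max_eq_left hby, hby, by omega⟩

/-- The heights in a double rotation: the outer subtree `x` and the two subtrees `u` and `v` of the
inner subtree of the taller one, and the other subtree `b`. -/
theorem heights_of_double {x u v b H : ℕ} (hxy : x < 1 + max u v)
    (h2 : 1 + max x (1 + max u v) ≤ H + 1) (h3 : H ≤ b + 1)
    (hlt : b + 1 < 1 + max x (1 + max u v)) (hb : 1 + max u v ≤ x + 1) (h4 : u ≤ v + 1)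
    (h5 : v ≤ u + 1) :
    x = b ∧ H = b + 1 ∧ max u v = b ∧ max x u = b ∧ max v b = b ∧ u ≤ b ∧ b ≤ u + 1 ∧
      b ≤ v + 1 ∧ v ≤ b := by
  have hu : u ≤ max u v := le_max_left _ _
  have hv : v ≤ max u v := le_max_right _ _
  have huv : max u v = u ∨ max u v = v := max_choice _ _
  rw [max_eq_right (by omega : x ≤ 1 + max u v)] at h2 hlt
  have e : max u v = b := by omega
  rw [e] at hu hv huv hxy hb
  have ex : x = b := by omega
  exact ⟨ex, by omega, e, by rw [ex, max_eq_left hu], max_eq_right hv, hu, by omega, by omega, hv⟩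

set_option maxHeartbeats 1000000 in
/-- One step of the walk back to the root. If the height of the subtree grew from `H` by at most
one, the height of the whole changes from `1 + max H b.ht` by at most one. -/
theorem rebalance_spec {t b : Tr} {q d H M : ℕ} (hd : d = 0 ∨ d = 2) (hT : s.reg rTop = q)
    (hD : s.reg rDir = d) (hS : s.reg rSub = t.root) (hn : (Tr.join d t q b).toList.Nodup)
    (hq : q ≠ 0) (ht : t.Rep (s.arr aChild) (s.arr aHeight))
    (hb : b.Rep (s.arr aChild) (s.arr aHeight))
    (hc : s.arr aChild (3 * q + (2 - d)) = b.root) (h0 : s.arr aHeight 0 = 0)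
    (bt : t.Bal) (bb : b.Bal) (h1 : H ≤ t.ht) (h2 : t.ht ≤ H + 1) (h3 : H ≤ b.ht + 1)
    (h4 : b.ht ≤ H + 1) (hM : ∀ r ∈ (Tr.join d t q b).toList, r ≤ M) (hA : 3 * M + 2 < A)
    (hAW : A ≤ W) (hlt : t.ht ≤ M) (hlb : b.ht ≤ M) (hW : 3 < W) :
    WP A W inp rebalance s fun s' τ => ∃ t' : Tr,
      s'.reg rSub = t'.root ∧ t'.Rep (s'.arr aChild) (s'.arr aHeight) ∧ t'.Bal ∧
      1 + max H b.ht ≤ t'.ht ∧ t'.ht ≤ 1 + max H b.ht + 1 ∧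
      t'.toList = (Tr.join d t q b).toList ∧
      (∀ r ∉ (Tr.join d t q b).toList, s'.arr aChild (3 * r) = s.arr aChild (3 * r) ∧
        s'.arr aChild (3 * r + 2) = s.arr aChild (3 * r + 2) ∧
        s'.arr aHeight r = s.arr aHeight r) ∧
      SameOff [aChild, aHeight] s'.arr s.arr ∧ s'.carr = s.carr ∧ s'.creg = s.creg ∧
      SameOff [rSub, rSib, rIn] s'.reg s.reg ∧ τ ≤ 200 := by
  have hqM : q ≤ M := hM q (by simp)
  have htM : ∀ r ∈ t.toList, r ≤ M := fun r hr => hM r (by simp [hr])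
  have hbM : b.root ≤ M := Tr.root_le fun r hr => hM r (by simp [hr])
  have hrt := Tr.root_le htM
  have hd1 : d < 3 := by omega
  have hd2 : 2 - d < 3 := by omega
  have e0 : 3 * q + (2 - d) ≠ 3 * q + d := by omega
  have hht := ht.height h0
  have hhb := hb.height h0
  obtain ⟨-, -, nqt, nqb, -⟩ := Tr.nodup_join.1 hn
  have ht' : t.Rep (Function.update (s.arr aChild) (3 * q + d) t.root) (s.arr aHeight) :=
    ht.congr fun r hr => by
      have hrq : r ≠ q := fun e => nqt (e ▸ hr)
      rw [Function.update_of_ne (by omega), Function.update_of_ne (by omega)]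
      exact ⟨rfl, rfl, rfl⟩
  have hb' : b.Rep (Function.update (s.arr aChild) (3 * q + d) t.root) (s.arr aHeight) :=
    hb.congr fun r hr => by
      have hrq : r ≠ q := fun e => nqb (e ▸ hr)
      rw [Function.update_of_ne (by omega), Function.update_of_ne (by omega)]
      exact ⟨rfl, rfl, rfl⟩
  have hc' : Function.update (s.arr aChild) (3 * q + d) t.root (3 * q + (2 - d)) = b.root := by
    rw [Function.update_of_ne e0, hc]
  rw [rebalance]
  simp only [wp_seq]
  simp [hT, hD, hS]
  refine ⟨by omega, by omega, ?_⟩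
  rw [wp_branch]
  simp [hT, hD, hS, Function.update_of_ne e0, hc, hht, hhb]
  refine ⟨⟨⟨by omega, by omega⟩, by omega, ite_lt_of (by omega)⟩, ?_, ?_⟩
  · intro hlt
    obtain ⟨x, p, y, rfl⟩ := Tr.exists_join d (by omega : 0 < t.ht)
    obtain ⟨n1, -, n2, -⟩ := Tr.nodup_join.1 hn
    have hpq : p ≠ q := fun e => n2 (by simp [e])
    have e1 := cell_ne hd2 hd1 hpq
    have e2 := cell_ne hd1 hd1 hpq
    obtain ⟨r1, r2, r3, r4, r5, r6⟩ := (Tr.rep_join hd).1 ht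
    have hpM : p ≤ M := htM p (by simp)
    have hxM : x.root ≤ M := Tr.root_le fun r hr => htM r (by simp [hr])
    have hyM : y.root ≤ M := Tr.root_le fun r hr => htM r (by simp [hr])
    have hhx := r5.height h0
    have hhy := r6.height h0
    simp only [Tr.ht_join, Tr.bal_join] at hlt h1 h2 bt hlt
    simp [Function.update_of_ne e1, r3]
    refine ⟨by omega, ?_⟩
    rw [wp_branch]
    simp [hT, hD, hS, Function.update_of_ne e1, Function.update_of_ne e2, hht, hhb, r2, r3, hhx, hhy]
    refine ⟨⟨by omega, by omega, ite_lt_of (by omega)⟩, ?_, ?_⟩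
    · intro hxy
      obtain ⟨u, i, v, rfl⟩ := Tr.exists_join d (by omega : 0 < y.ht)
      obtain ⟨-, n3, -, n4, -⟩ := Tr.nodup_join.1 n1
      have hiq : i ≠ q := fun e => n2 (by simp [e])
      have hip : i ≠ p := fun e => n4 (by simp [e])
      obtain ⟨f1, f2, f3, f4, f5, f6⟩ := (Tr.rep_join hd).1 r6
      have hiM : i ≤ M := htM i (by simp)
      have huM : u.root ≤ M := Tr.root_le fun r hr => htM r (by simp [hr])
      have hvM : v.root ≤ M := Tr.root_le fun r hr => htM r (by simp [hr])
      have e3 := cell_ne hd1 hd1 hiq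
      have e4 := cell_ne hd2 hd1 hiq
      have e5 := cell_ne hd2 hd2 hip
      have hbi : b.root ≠ i := Tr.root_ne f1 fun hi => (Tr.nodup_join.1 hn).2.2.2.2 i (by simp) hi
      have hbp : b.root ≠ p := Tr.root_ne r1 fun hi => (Tr.nodup_join.1 hn).2.2.2.2 p (by simp) hi
      simp only [Tr.ht_join, Tr.bal_join] at hxy h1 h2 bt hlt r4
      obtain ⟨m1, m2, m3, m4, m5, m6, m7, m8, m9⟩ := heights_of_double hxy h2 h3 hlt bt.2.1
        bt.2.2.2.1 bt.2.2.2.2.1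
      obtain ⟨-, -, bx, -, -, bu, bv⟩ := bt
      rw [m3, m1, max_eq_right (by omega : b.ht ≤ 1 + b.ht)] at r4
      clear hxy h1 h2 hlt h3 h4
      simp [hT, hD, hS, Function.update_of_ne e3, Function.update_of_ne e4,
        Function.update_of_ne e5, Function.update_of_ne hip, Function.update_of_ne hip.symm, f2, f3,
        Function.update_of_ne hbi, Function.update_of_ne hbp, hhb, r4]
      refine ⟨by omega, by omega, by omega, by omega, by omega, by omega, by omega,
        Tr.join d (Tr.join d x p u) i (Tr.join d v q b), by simp, ?_, ?_, ?_, ?_, ?_, ?_⟩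
      · have := Tr.rep_doubleRotation hd hn hq ht' hb' hc'
        rw [Tr.root_join, m4, m5, max_self, Nat.add_comm 1 b.ht] at this
        rwa [Nat.add_comm 1 b.ht]
      · simp only [Tr.bal_join, Tr.ht_join, m4, m5]
        exact ⟨by omega, by omega, ⟨by omega, by omega, bx, bu⟩, by omega, by omega, bv, bb⟩
      · simp only [Tr.ht_join, m4, m5, m2]
        omega
      · simp only [Tr.ht_join, m4, m5, m2]
        omega
      · exact Tr.toList_double
      · intro r _ hrp _ hri _ hrq _
        rw [(update_cell_of_ne hd2 hri).1, (update_cell_of_ne hd1 hri).1,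
          (update_cell_of_ne hd1 hrq).1, (update_cell_of_ne hd2 hrp).1,
          (update_cell_of_ne hd1 hrq).1,
          (update_cell_of_ne hd2 hri).2, (update_cell_of_ne hd1 hri).2,
          (update_cell_of_ne hd1 hrq).2, (update_cell_of_ne hd2 hrp).2,
          (update_cell_of_ne hd1 hrq).2,
          Function.update_of_ne hrq, Function.update_of_ne hrp, Function.update_of_ne hri]
        exact ⟨rfl, rfl, rfl⟩
    · intro hxy
      obtain ⟨m1, m2, m3, m4, m5⟩ := heights_of_single hxy h1 h2 h3 hlt bt.1
      clear h1 h2 hlt h3 h4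
      refine ⟨by omega, by omega, by omega, by omega, Tr.join d x p (Tr.join d y q b), by simp,
        ?_, ?_, ?_, ?_, Tr.toList_rotate, ?_⟩
      · have := Tr.rep_singleRotation hd hn hq ht' hb' hc'
        rw [Tr.root_join, m3, max_eq_right (by omega : x.ht ≤ 1 + y.ht)] at this
        rwa [Nat.add_comm 1 y.ht, Nat.add_comm 1 (y.ht + 1),
          Function.update_idem] at this
      · simp only [Tr.bal_join, Tr.ht_join, m3]
        exact ⟨by omega, by omega, bt.2.2.1, by omega, by omega, bt.2.2.2, bb⟩
      · simp only [Tr.ht_join, m3, m2]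
        omega
      · simp only [Tr.ht_join, m3, m2]
        omega
      · intro r _ hrp _ hrq _
        rw [(update_cell_of_ne hd2 hrp).1, (update_cell_of_ne hd1 hrq).1,
          (update_cell_of_ne hd2 hrp).2, (update_cell_of_ne hd1 hrq).2,
          Function.update_of_ne hrp, Function.update_of_ne hrq]
        exact ⟨rfl, rfl, rfl⟩
  · intro hlt
    rw [wp_branch]
    simp [hT, hD, hS, Function.update_of_ne e0, hc, hht, hhb]
    refine ⟨⟨by omega, by omega, ite_lt_of (by omega)⟩, ?_, ?_⟩
    · intro hlt'
      refine ⟨by omega, Tr.join d t q b, by simp, ?_, ?_, ?_, ?_, rfl, ?_⟩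
      · have := Tr.rep_noRotation hd hn hq ht hb hc
        rwa [show 1 + max t.ht b.ht = t.ht + 1 by omega] at this
      · rw [Tr.bal_join]; exact ⟨by omega, by omega, bt, bb⟩
      · rw [Tr.ht_join]; omega
      · rw [Tr.ht_join]; omega
      · intro r _ hrq _
        rw [Function.update_of_ne (by omega), Function.update_of_ne (by omega),
          Function.update_of_ne hrq]
        exact ⟨rfl, rfl, rfl⟩
    · intro hlt'
      refine ⟨by omega, Tr.join d t q b, by simp, ?_, ?_, ?_, ?_, rfl, ?_⟩
      · have := Tr.rep_noRotation hd hn hq ht hb hc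
        rwa [show 1 + max t.ht b.ht = b.ht + 1 by omega] at this
      · rw [Tr.bal_join]; exact ⟨by omega, by omega, bt, bb⟩
      · rw [Tr.ht_join]; omega
      · rw [Tr.ht_join]; omega
      · intro r _ hrq _
        rw [Function.update_of_ne (by omega), Function.update_of_ne (by omega),
          Function.update_of_ne hrq]
        exact ⟨rfl, rfl, rfl⟩
end

open NetFreq.Expr NetFreq.Cmd in
/-- Search for the character in `cInput`. Afterwards `rId` is its number, or `0` if the character is
not in the tree; the nodes on the search path and the directions taken are on a stack. -/
def findChar : Cmd :=
  rId ≔ reg rRoot ;;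
  rDepth ≔ lit 0 ;;
  rCmp ≔ lit 0 ;;
  loop (reg rId *. (lit 1 -. (reg rCmp =. lit 1))) (
    loadChar cNode aChar (reg rId) ;;
    rCmp ≔ cmp cInput cNode ;;
    branch (reg rCmp =. lit 1) skip
      (store aPathNode (reg rDepth) (reg rId) ;;
       store aPathDir (reg rDepth) (reg rCmp) ;;
       rDepth ≔ reg rDepth +. lit 1 ;;
       rId ≔ get aChild (lit 3 *. reg rId +. reg rCmp)))

open NetFreq.Expr NetFreq.Cmd in
/-- Insert the character in `cInput` under a new number at the end of the search path. -/
def insertChar : Cmd :=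
  rSigma ≔ reg rSigma +. lit 1 ;;
  rId ≔ reg rSigma ;;
  rSub ≔ reg rSigma ;;
  storeChar aChar (reg rSub) cInput ;;
  store aHeight (reg rSub) (lit 1) ;;
  store aChild (lit 3 *. reg rSub) (lit 0) ;;
  store aChild (lit 3 *. reg rSub +. lit 2) (lit 0) ;;
  loop (reg rDepth) (
    rDepth ≔ reg rDepth -. lit 1 ;;
    rTop ≔ get aPathNode (reg rDepth) ;;
    rDir ≔ get aPathDir (reg rDepth) ;;
    rebalance) ;;
  rRoot ≔ reg rSub

open NetFreq.Expr NetFreq.Cmd in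
/-- Set `rId` to the number of the character in `cInput`, which is new if need be. -/
def charNumber : Cmd :=
  findChar ;; branch (reg rId) skip insertChar

/-- The AVL tree `t` in memory contains the numbers `1, …, σ`, in the order of the characters
`key i` that they stand for. -/
structure Alphabet {α : Type*} [LinearOrder α] (ch h : ℕ → ℕ) (key : ℕ → WithBot α) (root σ : ℕ)
    (t : Tr) : Prop where
  root_eq : t.root = root
  rep : t.Rep ch h
  bal : t.Bal
  height_zero : h 0 = 0
  sorted : t.toList.Pairwise fun i j => key i < key j
  perm : t.toList.Perm (List.range' 1 σ)

section

variable {α : Type*} [LinearOrder α] {A W : ℕ} {inp : List α} {s : State α}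

namespace Alphabet

variable {ch h : ℕ → ℕ} {key : ℕ → WithBot α} {root σ : ℕ} {t : Tr}

theorem mem_iff (hT : Alphabet ch h key root σ t) {i : ℕ} : i ∈ t.toList ↔ 1 ≤ i ∧ i ≤ σ := by
  rw [hT.perm.mem_iff, List.mem_range'_1]
  omega

theorem length_eq (hT : Alphabet ch h key root σ t) : t.toList.length = σ := by
  rw [hT.perm.length_eq, List.length_range']

theorem ht_le (hT : Alphabet ch h key root σ t) : t.ht ≤ 2 * Nat.log 2 σ + 2 := by
  have h1 := Tr.ht_le_log hT.bal
  rw [hT.length_eq] at h1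
  have h2 : Nat.log 2 (σ + 1) ≤ Nat.log 2 σ + 1 := by
    rcases Nat.eq_zero_or_pos σ with rfl | hσ
    · simp
    · calc Nat.log 2 (σ + 1) ≤ Nat.log 2 (σ * 2) := Nat.log_mono_right (by omega)
        _ = Nat.log 2 σ + 1 := Nat.log_mul_base (by omega) (by omega)
  omega

end Alphabet

/-- The search ends at the subtree `u`, after the path `c`. The numbers to the left of the path stand
for smaller characters than the one searched for, those to the right for larger ones. -/
theorem findChar_spec {σ : ℕ} {t : Tr}
    (hT : Alphabet (s.arr aChild) (s.arr aHeight) (s.carr aChar) (s.reg rRoot) σ t)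
    (hA : 3 * σ + 3 < A) (hAW : A ≤ W) (hW : 3 < W) :
    WP A W inp findChar s fun s' τ =>
      SameOff [aPathNode, aPathDir] s'.arr s.arr ∧ s'.carr = s.carr ∧
      s'.creg cInput = s.creg cInput ∧ SameOff [rId, rCmp, rDepth] s'.reg s.reg ∧
      τ ≤ 100 * (Nat.log 2 σ + 2) ∧
      ∃ (c : Ctx) (u : Tr), c.plug u = t ∧ c.Sides ∧ u.root = s'.reg rId ∧
        s'.reg rDepth = c.length ∧ c.Stack (s'.arr aPathNode) (s'.arr aPathDir) ∧
        (∀ i ∈ c.left, s.carr aChar i < s.creg cInput) ∧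
        (∀ i ∈ c.right, s.creg cInput < s.carr aChar i) ∧
        (s'.reg rId = 0 ∨ s.carr aChar (s'.reg rId) = s.creg cInput) := by
  set x := s.creg cInput with hx
  set key := s.carr aChar with hkey
  set ch := s.arr aChild with hch
  have hlen : t.ht ≤ σ := hT.length_eq ▸ Tr.ht_le_length
  let I : ℕ → State α → Prop := fun m s' =>
    SameOff [aPathNode, aPathDir] s'.arr s.arr ∧ s'.carr = s.carr ∧
    s'.creg cInput = x ∧ SameOff [rId, rCmp, rDepth] s'.reg s.reg ∧
    ∃ (c : Ctx) (u : Tr), c.plug u = t ∧ c.Sides ∧ u.root = s'.reg rId ∧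
      s'.reg rDepth = c.length ∧ c.Stack (s'.arr aPathNode) (s'.arr aPathDir) ∧
      (∀ i ∈ c.left, key i < x) ∧ (∀ i ∈ c.right, x < key i) ∧
      (s'.reg rCmp = 1 ∧ key (s'.reg rId) = x ∧ m = 0 ∨
        s'.reg rCmp ≠ 1 ∧ m + c.length = t.ht + 1)
  have hrt : s.reg rRoot ≤ σ := by
    rw [← hT.root_eq]
    exact Tr.root_le fun r hr => (hT.mem_iff.1 hr).2
  simp only [findChar]
  simp
  refine ⟨by omega, ?_⟩
  refine WP.mono (wp_loop 30 I ?_ (m := t.ht + 1) ?_) ?_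
  · rintro m s' ⟨h1, h2, h3, h4, c, u, h5, h6, h7, h8, h9, h10, h11, h12⟩
    have h13 := c.length_add_ht_le u
    rw [h5] at h13
    have hsub : ∀ i ∈ u.toList, i ∈ t.toList := by
      intro i hi
      rw [← h5, Ctx.toList_plug]
      simp [hi]
    have hid : s'.reg rId ≤ σ := by
      rw [← h7]
      exact Tr.root_le fun r hr => (hT.mem_iff.1 (hsub r hr)).2
    have harr : s'.arr aChild = ch := h1 _ (by simp)
    simp only [Expr.Ok, Expr.val, BinOp.eval]
    refine ⟨⟨trivial, ⟨by omega, ⟨trivial, by omega, ite_lt_of (by omega)⟩, ?_⟩,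
      (mul_one_sub_ite_le _ _).trans_lt (by omega)⟩, ?_⟩
    · split_ifs <;> omega
    intro hne
    have hcmp : s'.reg rCmp ≠ 1 := by
      intro h
      simp [h] at hne
    have hid0 : s'.reg rId ≠ 0 := by
      intro h
      simp [h] at hne
    have hm := h12.resolve_left fun h => hcmp h.1
    rcases u with _ | ⟨l, q, r⟩
    · exact absurd h7.symm hid0
    simp only [Tr.root_node] at h7
    have hq : q ≤ σ := h7 ▸ hid
    simp [h2, h3, ← h7, ← hkey]
    refine ⟨by omega, by split_ifs <;> omega, ?_⟩
    rw [wp_branch]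
    obtain ⟨hr1, hr2⟩ := Ctx.rep_of_plug (c := c) h6 (h5.symm ▸ hT.rep)
    obtain ⟨-, hl, hr, -⟩ := hr1
    have hs := hT.sorted
    rw [← h5, Ctx.toList_plug] at hs
    have hs' := (List.pairwise_append.1 (List.pairwise_append.1 hs).2.1).1
    simp only [Tr.toList, List.pairwise_append, List.pairwise_cons] at hs'
    obtain ⟨-, ⟨hs1, -⟩, hs2⟩ := hs'
    have hstack : ∀ d, Ctx.Stack (Function.update (s'.arr aPathNode) c.length q)
        (Function.update (s'.arr aPathDir) c.length d) c := fun d =>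
      h9.congr fun i hi => ⟨Function.update_of_ne (by omega) _ _,
        Function.update_of_ne (by omega) _ _⟩
    simp only [Tr.ht] at h13
    rcases lt_trichotomy x (key q) with hlt | heq | hgt
    · simp [h8, harr, ← h7, hlt]
      refine ⟨by omega, by omega, by omega, ⟨⟨by omega, by omega⟩, by omega⟩, m - 1, by omega,
        by simpa using h1,
        by simpa using h2, by simpa using h3, by simpa using h4, (0, q, r) :: c, l, ?_, ?_⟩
      · simpa [Tr.join] using h5
      · simp [h6, hl, hstack]
        exact ⟨h10, ⟨hlt, fun i hi => hi.elim (fun hi => hlt.trans (hs1 i hi)) (h11 i)⟩, by omega⟩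
    · simp [h8, harr, ← h7, heq]
      exact ⟨by omega, 0, by omega, by simpa using h1, by simpa using h2, by simpa using h3,
        by simpa using h4, c, _, h5, h6, by simpa using h7, by simpa using h8, by simpa using h9,
        h10, h11, by simp [← h7, heq]⟩
    · simp [h8, harr, ← h7, hgt.not_gt, hgt.ne']
      refine ⟨by omega, by omega, by omega, ⟨⟨⟨by omega, by omega⟩, by omega⟩, by omega⟩, m - 1,
        by omega, by simpa using h1,
        by simpa using h2, by simpa using h3, by simpa using h4, (2, q, l) :: c, r, ?_, ?_⟩
      · simpa [Tr.join] using h5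
      · simp [h6, hr, hstack]
        refine ⟨?_, h11, by omega⟩
        rintro i (hi | hi | rfl)
        · exact h10 i hi
        · exact (hs2 i hi q (by simp)).trans hgt
        · exact hgt
  · exact ⟨by simp, by simp, by simp [hx], by simp, [], t, by simp [hT.root_eq]⟩
  · rintro s' τ ⟨m', h0, ⟨h1, h2, h3, h4, c, u, h5, h6, h7, h8, h9, h10, h11, h12⟩, h13, h14⟩
    refine ⟨h1, h2, h3, h4, ?_, c, u, h5, h6, h7, h8, h9, h10, h11, ?_⟩
    · have h15 := hT.ht_le
      simp at h14
      have h16 : (t.ht + 1 - m') * 38 ≤ (2 * Nat.log 2 σ + 3) * 38 :=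
        Nat.mul_le_mul_right _ (by omega)
      omega
    · simp at h13
      rcases h12 with h12 | h12
      · exact .inr h12.2.1
      · exact h13.imp_right fun h => by split_ifs at h <;> simp_all

end

section

variable {α : Type*} [LinearOrder α] {A W : ℕ} {inp : List α} {s : State α}

theorem insertChar_spec {σ : ℕ} {t : Tr} {c : Ctx}
    (hT : Alphabet (s.arr aChild) (s.arr aHeight) (s.carr aChar) (s.reg rRoot) σ t)
    (hσ : s.reg rSigma = σ) (hc : c.plug .nil = t) (hs : c.Sides) (hd : s.reg rDepth = c.length)
    (hst : c.Stack (s.arr aPathNode) (s.arr aPathDir))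
    (hl : ∀ i ∈ c.left, s.carr aChar i < s.creg cInput)
    (hr : ∀ i ∈ c.right, s.creg cInput < s.carr aChar i)
    (hA : 3 * σ + 8 < A) (hAW : A ≤ W) :
    WP A W inp insertChar s fun s' τ =>
      SameOff [aChild, aHeight] s'.arr s.arr ∧
      SameOff [aChar] s'.carr s.carr ∧
      s'.carr aChar = Function.update (s.carr aChar) (σ + 1) (s.creg cInput) ∧
      s'.creg = s.creg ∧
      SameOff [rSigma, rId, rSub, rDepth, rTop, rDir, rSib, rIn, rRoot] s'.reg s.reg ∧
      s'.reg rId = σ + 1 ∧ s'.reg rSigma = σ + 1 ∧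
      τ ≤ 500 * (Nat.log 2 σ + 2) ∧
      ∃ t' : Tr, Alphabet (s'.arr aChild) (s'.arr aHeight) (s'.carr aChar) (s'.reg rRoot)
        (σ + 1) t' := by
  set x := s.creg cInput with hx
  set key := s.carr aChar with hkey
  have hlist := hc ▸ Ctx.toList_plug c .nil
  simp only [Tr.toList, List.nil_append] at hlist
  obtain ⟨L, hL⟩ : ∃ L, L = c.left ++ ((σ + 1) :: c.right) := ⟨_, rfl⟩
  have hperm : L.Perm (List.range' 1 (σ + 1)) := by
    rw [hL, List.range'_concat]
    refine List.perm_middle.trans ((hlist ▸ hT.perm).cons _ |>.trans ?_)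
    simpa [Nat.add_comm 1 σ] using List.perm_append_comm (l₁ := [σ + 1]) (l₂ := List.range' 1 σ)
  have hnd : L.Nodup := hperm.nodup_iff.2 List.nodup_range'
  have hmem : ∀ i, i ∈ L ↔ 1 ≤ i ∧ i ≤ σ + 1 := fun i => by
    rw [hperm.mem_iff, List.mem_range'_1]; omega
  have hlen : L.length = σ + 1 := by rw [hperm.length_eq, List.length_range']
  have hold : ∀ i ∈ t.toList, i ≠ σ + 1 := fun i hi => by
    have := hT.mem_iff.1 hi
    omega
  have hsort : L.Pairwise fun i j =>
      Function.update key (σ + 1) x i < Function.update key (σ + 1) x j := by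
    have h1 := hlist ▸ hT.sorted
    have h2 : ∀ i ∈ c.left ++ c.right, Function.update key (σ + 1) x i = key i := fun i hi =>
      Function.update_of_ne (hold i (hlist ▸ hi)) _ _
    rw [List.pairwise_append] at h1
    rw [hL, List.pairwise_append, List.pairwise_cons]
    refine ⟨h1.1.imp_of_mem ?_, ⟨?_, h1.2.1.imp_of_mem ?_⟩, ?_⟩
    · intro i j hi hj hij
      rwa [h2 i (by simp [hi]), h2 j (by simp [hj])]
    · intro j hj
      rw [Function.update_self, h2 j (by simp [hj])]
      exact hr j hj
    · intro i j hi hj hij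
      rwa [h2 i (by simp [hi]), h2 j (by simp [hj])]
    · intro i hi j hj
      rw [h2 i (by simp [hi])]
      rcases List.mem_cons.1 hj with rfl | hj
      · rw [Function.update_self]; exact hl i hi
      · rw [h2 j (by simp [hj])]
        exact h1.2.2 i hi j hj
  obtain ⟨-, hcr⟩ := Ctx.rep_of_plug (c := c) hs (hc.symm ▸ hT.rep)
  obtain ⟨-, hcb⟩ := Ctx.bal_of_plug (c := c) (hc.symm ▸ hT.bal)
  have hclen := hc ▸ c.length_add_ht_le .nil
  have hht := hT.ht_le
  have hht' : t.ht ≤ σ := hT.length_eq ▸ Tr.ht_le_length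
  let I : ℕ → State α → Prop := fun m s' =>
    SameOff [aChild, aHeight] s'.arr s.arr ∧
    SameOff [aChar] s'.carr s.carr ∧
    s'.carr aChar = Function.update key (σ + 1) x ∧ s'.creg = s.creg ∧
    SameOff [rSigma, rId, rSub, rDepth, rTop, rDir, rSib, rIn, rRoot] s'.reg s.reg ∧
    s'.reg rId = σ + 1 ∧ s'.reg rSigma = σ + 1 ∧ s'.arr aHeight 0 = 0 ∧
    ∃ (c' : Ctx) (t' : Tr) (H : ℕ), m = c'.length ∧ s'.reg rDepth = m ∧
      c'.Stack (s.arr aPathNode) (s.arr aPathDir) ∧ s'.reg rSub = t'.root ∧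
      t'.Rep (s'.arr aChild) (s'.arr aHeight) ∧ c'.Rep (s'.arr aChild) (s'.arr aHeight) ∧
      t'.Bal ∧ c'.Bal H ∧ H ≤ t'.ht ∧ t'.ht ≤ H + 1 ∧ (c'.plug t').toList = L
  rw [insertChar]
  simp only [wp_seq]
  simp [hσ, hkey.symm, hx.symm]
  refine ⟨⟨by omega, by omega⟩, by omega, ⟨by omega, by omega⟩,
    ⟨⟨by omega, by omega⟩, by omega, by omega⟩,
    ⟨⟨⟨by omega, by omega⟩, by omega, by omega⟩, by omega, by omega⟩, ?_⟩
  refine WP.mono (wp_loop 230 I ?_ (m := c.length) ?_) ?_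
  · rintro m s' ⟨h1, h2, h3, h4, h5, h6, h7, h8, c', t', H, h9, h10, h11, h12, h13, h14, h15, h16,
      h17, h18, h19⟩
    refine ⟨trivial, fun hne => ?_⟩
    rcases c' with _ | ⟨⟨d, q, b⟩, c'⟩
    · simp [h9, h10] at hne
    have hplen := Ctx.length_add_ht_le ((d, q, b) :: c') t'
    have hpl := hlen ▸ h19 ▸ Tr.ht_le_length (t := Ctx.plug ((d, q, b) :: c') t')
    rw [Ctx.plug] at h19 hplen hpl
    have hpl2 := Ctx.length_add_ht_le c' (Tr.join d t' q b)
    rw [Ctx.toList_plug] at h19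
    obtain ⟨g1, g2, g3, g4, g5⟩ := h14
    obtain ⟨k1, k2, k3, k4⟩ := h16
    obtain ⟨j1, j2, j3⟩ := h11
    have hpn : s'.arr aPathNode = s.arr aPathNode := h1 _ (by simp)
    have hpd : s'.arr aPathDir = s.arr aPathDir := h1 _ (by simp)
    simp only [List.length_cons] at h9 hplen
    simp only [Tr.ht_join] at hpl2 hpl
    have hin : ∀ r ∈ (Tr.join d t' q b).toList, r ∈ L := fun r hr => by
      rw [← h19]; simp [hr]
    have hnd' : (Tr.join d t' q b).toList.Nodup := by
      rw [← h19] at hnd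
      exact (List.nodup_append.1 (List.nodup_append.1 hnd).2.1).1
    simp only [wp_seq]
    simp [h10, hpn, hpd, h9, j1, j2]
    refine ⟨⟨by omega, by omega⟩, by omega, ?_⟩
    refine WP.mono (rebalance_spec
      (s := ((s'.setReg rDepth c'.length).setReg rTop q).setReg rDir d) (t := t') (b := b) (q := q) (d := d) (H := H) (M := σ + 1) g1
      (by simp) (by simp) (by simpa using h12) hnd' g2 h13 g4 g3 h8 h15 k1 h17 h18 k2 k3
      (fun r hr => ((hmem r).1 (hin r hr)).2) (by omega) hAW ?_ ?_ (by omega)) ?_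
    · have := le_max_left t'.ht b.ht
      omega
    · have := le_max_right t'.ht b.ht
      omega
    rintro s'' τ ⟨t'', f1, f2, f3, f4, f5, f6, f7, f8, f9, f10, f11, f12⟩
    simp at f8 f9 f10 f11
    have hreg : SameOff [rDepth, rTop, rDir, rSub, rSib, rIn] s''.reg s'.reg := by
      intro r hr
      simp at hr
      rw [f11 r (by simp; tauto)]
      simp [hr]
    refine ⟨by omega, c'.length, by omega, f8.trans h1, f9 ▸ h2, f9 ▸ h3, f10 ▸ h4,
      (hreg.mono (by simp)).trans h5, ?_, ?_, ?_, c', t'', 1 + max H b.ht, rfl, ?_, j3, f1, f2, ?_,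
      f3, k4, f4, by omega, ?_⟩
    · rw [hreg _ (by simp), h6]
    · rw [hreg _ (by simp), h7]
    · rw [(f7 0 fun h0 => by have := (hmem 0).1 (hin 0 h0); omega).2.2]
      exact h8
    · rw [f11 _ (by simp)]
      simp
    · refine g5.congr fun r hr => f7 r fun hr' => ?_
      rw [← h19, List.nodup_append] at hnd
      rcases List.mem_append.1 hr with hr | hr
      · exact hnd.2.2 r hr r (by simp [hr']) rfl
      · exact (List.nodup_append.1 hnd.2.1).2.2 r hr' r hr rfl
    · rw [Ctx.toList_plug, f6, h19]
  · have hne : ∀ r ∈ c.left ++ c.right, r ≠ σ + 1 := fun r hr => hold r (hlist ▸ hr)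
    refine ⟨by simp, by simp, by simp [hx, hkey], by simp, by simp, by simp, by simp, ?_, c, .node .nil (σ + 1) .nil, 0,
      rfl, by simp [hd], hst, by simp, ?_, ?_, by simp, hcb, by simp, by simp, ?_⟩
    · simp [hT.height_zero]
    · simp
    · refine hcr.congr fun r hr => ?_
      have := hne r hr
      simp
      rw [Function.update_of_ne (by omega), Function.update_of_ne (by omega),
        Function.update_of_ne (by omega), Function.update_of_ne (by omega),
        Function.update_of_ne this]
      exact ⟨rfl, rfl, rfl⟩
    · rw [Ctx.toList_plug, hL]
      simp
  · rintro s' τ ⟨m', h0, ⟨h1, h2, h3, h4, h5, h6, h7, h8, c', t', H, h9, h10, h11, h12, h13, h14,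
      h15, h16, h17, h18, h19⟩, h20, h21⟩
    simp at h20 h21
    have hm : c' = [] := by
      rw [← List.length_eq_zero_iff, ← h9, ← h10, h20]
    subst hm
    simp only [Ctx.plug] at h19
    simp [h6, h7, h1, h2, h3, h4, h5]
    refine ⟨?_, t', h12.symm, h13, h15, h8, ?_, ?_⟩
    · have h22 : (c.length - m') * 232 ≤ (2 * Nat.log 2 σ + 2) * 232 :=
        Nat.mul_le_mul_right _ (by omega)
      omega
    · rwa [h19]
    · rwa [h19]

theorem Alphabet.key_inj {ch h : ℕ → ℕ} {key : ℕ → WithBot α} {root σ : ℕ} {t : Tr}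
    (hT : Alphabet ch h key root σ t) {i j : ℕ} (hi : 1 ≤ i ∧ i ≤ σ) (hj : 1 ≤ j ∧ j ≤ σ)
    (hij : key i = key j) : i = j := by
  have h1 : t.toList.Pairwise fun i j => key i ≠ key j := hT.sorted.imp fun h => h.ne
  by_contra hne
  have : Std.Symm fun i j => key i ≠ key j := ⟨fun _ _ h => h.symm⟩
  exact h1.forall (hT.mem_iff.2 hi) (hT.mem_iff.2 hj) hne hij

theorem Ctx.sides_nil_root {ch h : ℕ → ℕ} {c : Ctx} {u t : Tr} (hc : c.plug u = t)
    (hs : c.Sides) (ht : t.Rep ch h) (hu : u.root = 0) : u = .nil := by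
  cases u with
  | nil => rfl
  | node l q r => exact absurd hu (Ctx.rep_of_plug (t := .node l q r) hs (hc.symm ▸ ht)).1.1

/-- The outcome of the search, regardless of the path. -/
theorem findChar_spec' {σ : ℕ} {t : Tr}
    (hT : Alphabet (s.arr aChild) (s.arr aHeight) (s.carr aChar) (s.reg rRoot) σ t)
    (hA : 3 * σ + 3 < A) (hAW : A ≤ W) (hW : 3 < W) :
    WP A W inp findChar s fun s' τ =>
      SameOff [aPathNode, aPathDir] s'.arr s.arr ∧ s'.carr = s.carr ∧
      s'.creg cInput = s.creg cInput ∧ SameOff [rId, rCmp, rDepth] s'.reg s.reg ∧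
      τ ≤ 100 * (Nat.log 2 σ + 2) ∧
      (s'.reg rId = 0 ∧ (∀ i, 1 ≤ i → i ≤ σ → s.carr aChar i ≠ s.creg cInput) ∨
        (1 ≤ s'.reg rId ∧ s'.reg rId ≤ σ) ∧ s.carr aChar (s'.reg rId) = s.creg cInput) := by
  refine WP.mono (findChar_spec hT hA hAW hW) ?_
  rintro s' τ ⟨h1, h2, h3, h4, h5, c, u, h6, h7, h8, h9, h10, h11, h12, h13⟩
  refine ⟨h1, h2, h3, h4, h5, ?_⟩
  by_cases h0 : s'.reg rId = 0
  · have hu := Ctx.sides_nil_root h6 h7 hT.rep (h8.trans h0)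
    subst hu
    refine .inl ⟨h0, fun i hi1 hi2 he => ?_⟩
    have hi := hT.mem_iff.2 ⟨hi1, hi2⟩
    rw [← h6, Ctx.toList_plug] at hi
    simp only [Tr.toList, List.nil_append, List.mem_append] at hi
    rcases hi with hi | hi
    · exact (h11 i hi).ne he
    · exact (h12 i hi).ne' he
  · refine .inr ⟨hT.mem_iff.1 ?_, h13.resolve_left h0⟩
    rw [← h6, Ctx.toList_plug, ← h8]
    cases u with
    | nil => exact absurd h8.symm h0
    | node l q r => simp

theorem charNumber_spec {σ : ℕ} {t : Tr}
    (hT : Alphabet (s.arr aChild) (s.arr aHeight) (s.carr aChar) (s.reg rRoot) σ t)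
    (hσ : s.reg rSigma = σ) (hA : 3 * σ + 8 < A) (hAW : A ≤ W) :
    WP A W inp charNumber s fun s' τ =>
      SameOff [aChild, aHeight, aPathNode, aPathDir] s'.arr s.arr ∧
      s'.creg cInput = s.creg cInput ∧
      SameOff [rSigma, rId, rCmp, rSub, rDepth, rTop, rDir, rSib, rIn, rRoot] s'.reg s.reg ∧
      τ ≤ 700 * (Nat.log 2 σ + 2) ∧
      (∀ i ≤ σ, s'.carr aChar i = s.carr aChar i) ∧
      s'.carr aChar (s'.reg rId) = s.creg cInput ∧
      (1 ≤ s'.reg rId ∧ s'.reg rId ≤ s'.reg rSigma) ∧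
      (s'.reg rSigma = σ ∧ s'.reg rId ≤ σ ∨
        s'.reg rSigma = σ + 1 ∧ s'.reg rId = σ + 1 ∧
          ∀ i, 1 ≤ i → i ≤ σ → s.carr aChar i ≠ s.creg cInput) ∧
      ∃ t' : Tr, Alphabet (s'.arr aChild) (s'.arr aHeight) (s'.carr aChar) (s'.reg rRoot)
        (s'.reg rSigma) t' := by
  rw [charNumber, wp_seq]
  refine WP.mono (findChar_spec hT (by omega) hAW (by omega)) ?_
  rintro s' τ ⟨h1, h2, h3, h4, h5, c, u, h6, h7, h8, h9, h10, h11, h12, h13⟩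
  rw [wp_branch]
  have hsig : s'.reg rSigma = σ := (h4 _ (by simp)).trans hσ
  have hroot : s'.reg rRoot = s.reg rRoot := h4 _ (by simp)
  have hch : s'.arr aChild = s.arr aChild := h1 _ (by simp)
  have hht : s'.arr aHeight = s.arr aHeight := h1 _ (by simp)
  have hT' : Alphabet (s'.arr aChild) (s'.arr aHeight) (s'.carr aChar) (s'.reg rRoot) σ t := by
    rwa [hch, hht, h2, hroot]
  refine ⟨trivial, fun h0 => ?_, fun h0 => ?_⟩
  · simp only [Expr.val] at h0
    have hid : 1 ≤ s'.reg rId ∧ s'.reg rId ≤ σ := by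
      rw [← hT.mem_iff, ← h6, Ctx.toList_plug, ← h8]
      cases u with
      | nil => exact absurd h8.symm h0
      | node l q r => simp
    rw [wp_skip]
    exact ⟨h1.mono (by simp), h3, h4.mono (by simp), by simp; omega, by simp [h2],
      by rw [h2]; exact h13.resolve_left h0, by omega, by omega, t, by rwa [hsig]⟩
  · simp only [Expr.val] at h0
    have hu := Ctx.sides_nil_root h6 h7 hT.rep (h8.trans h0)
    subst hu
    refine WP.mono (insertChar_spec hT' hsig h6 h7 h9 h10 (by rwa [h2, h3]) (by rwa [h2, h3])
      hA hAW) ?_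
    rintro s'' τ' ⟨k1, k2, k3, k4, k5, k6, k7, k8, t', k9⟩
    refine ⟨(k1.mono (by simp)).trans (h1.mono (by simp)), by rw [k4, h3],
      (k5.mono (by simp)).trans (h4.mono (by simp)), by simp; omega, ?_, ?_, ?_, ?_, t', ?_⟩
    · intro i hi
      rw [k3, Function.update_of_ne (by omega), h2]
    · rw [k6, k3, Function.update_self, h3]
    · omega
    · refine .inr ⟨k7, k6, fun i hi1 hi2 he => ?_⟩
      have hi := hT.mem_iff.2 ⟨hi1, hi2⟩
      rw [← h6, Ctx.toList_plug] at hi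
      simp only [Tr.toList, List.nil_append, List.mem_append] at hi
      rcases hi with hi | hi
      · exact (h11 i hi).ne he
      · exact (h12 i hi).ne' he
    · rwa [k7]

end

/-! ### How the suffix tree changes when a character arrives -/

section Step

variable {β : Type*} {x y : ℕ → β} {n k h l L : ℕ}

/-- `L` is the length of the longest prefix of suffix `k` that also starts another suffix. -/
def IsEll (x : ℕ → β) (n k L : ℕ) : Prop :=
  (∀ k' ≤ n, k' ≠ k → ¬ Agree x (L + 1) k k') ∧ (L = 0 ∨ ∃ k' ≤ n, k' ≠ k ∧ Agree x L k k')

theorem IsEll.le (hL : IsEll x n k L) : L ≤ k := by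
  rcases hL.2 with rfl | ⟨k', -, -, h⟩
  · omega
  · exact h.1

theorem IsEll.congr (hxy : ∀ i < n, x i = y i) (hk : k ≤ n) (hL : IsEll x n k L) :
    IsEll y n k L := by
  refine ⟨fun k' hk' hne ha => hL.1 k' hk' hne ((agree_congr hxy hk hk').2 ha),
    hL.2.imp_right ?_⟩
  rintro ⟨k', hk', hne, ha⟩
  exact ⟨k', hk', hne, (agree_congr hxy hk hk').1 ha⟩

theorem IsHead.isEll (hh : IsHead x n h) : IsEll x (n + 1) (n + 1) h := by
  refine ⟨fun k' hk' hne => hh.2 k' (by omega), .inr ?_⟩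
  obtain ⟨k, hk, ha⟩ := hh.1
  exact ⟨k, by omega, by omega, ha⟩

theorem IsHead.le (hh : IsHead x n h) : h ≤ n := by
  obtain ⟨k, hk, ha⟩ := hh.1
  exact ha.2.1.trans hk

/-- If the new suffix shares more with suffix `k` than any old suffix did, then the head of the new
suffix occurs in suffix `k` only. -/
theorem IsEll.step_of_agree (hL : IsEll x n k L) (hh : IsHead x n h) (hk : k ≤ n)
    (ha : Agree x (L + 1) k (n + 1)) :
    IsEll x (n + 1) k h ∧ Agree x h k (n + 1) ∧ L < h := by
  have h1 := hh.le_of_agree hk ha.symm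
  obtain ⟨k₀, hk₀, h2⟩ := hh.1
  have h3 : k₀ = k := by
    by_contra hne
    exact hL.1 k₀ hk₀ hne (ha.trans (h2.mono h1))
  subst h3
  refine ⟨⟨fun k' hk' hne h4 => ?_, .inr ⟨n + 1, le_rfl, by omega, h2.symm⟩⟩, h2.symm, h1⟩
  rcases Nat.lt_or_eq_of_le hk' with hk' | rfl
  · exact hL.1 k' (by omega) hne (h4.mono (by omega))
  · exact hh.2 _ hk₀ h4.symm

theorem IsEll.step_of_not (hL : IsEll x n k L) (ha : ¬ Agree x (L + 1) k (n + 1)) :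
    IsEll x (n + 1) k L := by
  refine ⟨fun k' hk' hne => ?_, hL.2.imp_right ?_⟩
  · rcases Nat.lt_or_eq_of_le hk' with hk' | rfl
    · exact hL.1 k' (by omega) hne
    · exact ha
  · rintro ⟨k', hk', h⟩
    exact ⟨k', by omega, h⟩

open Classical in
/-- The number of proper ancestors of the leaf of suffix `n`. -/
noncomputable def depth (x : ℕ → β) (n : ℕ) : ℕ := ((Finset.range n).filter (IsNode x n n)).card

theorem depth_congr (hxy : ∀ i < n, x i = y i) : depth x n = depth y n := by
  unfold depth
  congr 1
  ext l
  simp [isNode_congr hxy]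

end Step

namespace Tree

variable {x y : ℕ → ℕ} {n h : ℕ} {P : ℕ → ℕ → Prop} {len pos par : ℕ → ℕ} {F : ℕ → ℕ → ℕ}
  {V : Set ℕ}

/-- The tree of the first `n` characters does not depend on those that arrive later. -/
theorem congr_str (hT : Tree x n P len pos par F V) (hP : Invariant x n P)
    (hxy : ∀ i < n, x i = y i) : Tree y n P len pos par F V := by
  have hlp : ∀ v ∈ V, len v ≤ pos v := fun v hv => hP.1 _ _ (hT.node v hv)
  have hpos : ∀ v ∈ V, 0 < len v → ∀ j, x (pos v - 1 - j) = y (pos v - 1 - j) :=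
    fun v hv h0 j => hxy _ (by have := hlp v hv; have := hT.pos_le v hv; omega)
  exact {
    root := hT.root
    len_root := hT.len_root
    pos_le := hT.pos_le
    node := hT.node
    surj := fun k hk l h => by
      obtain ⟨v, hv, h1, h2⟩ := hT.surj k hk l h
      exact ⟨v, hv, h1, h2.congr hxy hk (hT.pos_le v hv)⟩
    inj := fun v hv w hw e ha => hT.inj v hv w hw e
      ((agree_congr hxy (hT.pos_le v hv) (hT.pos_le w hw)).2 ha)
    par_mem := hT.par_mem
    par_lt := hT.par_lt
    par_agree := fun v hv h0 => (hT.par_agree v hv h0).congr hxy (hT.pos_le v hv)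
      (hT.pos_le _ (hT.par_mem v hv h0))
    par_max := hT.par_max
    child_of := fun v c hc => by
      obtain ⟨h1, h2, h3⟩ := hT.child_of v c hc
      exact ⟨h1, h2, by rw [← hpos _ h1 (hT.len_pos h1 hc), h3]⟩
    of_child := fun z hz h0 => by
      rw [← hpos _ hz (hT.len_pos hz h0), hT.of_child z hz h0]
    link_of := fun v c hc => by
      obtain ⟨h1, h2, h3, h4, h5⟩ := hT.link_of v c hc
      have h6 := hpos _ h2 (by omega) 0
      rw [Nat.sub_zero] at h6
      have := hT.pos_le _ h2
      exact ⟨h1, h2, h3, by rw [← h6, h4], h5.congr hxy (by omega) (hT.pos_le v h1)⟩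
    of_link := fun v hv w hw e ha => by
      have h6 := hpos _ hw (by omega) 0
      rw [Nat.sub_zero] at h6
      have := hT.pos_le _ hw
      rw [← h6]
      exact hT.of_link v hv w hw e ((agree_congr hxy (by omega) (hT.pos_le v hv)).2 ha) }

theorem locus_unique (hT : Tree x n P len pos par F V) (hP : Invariant x n P) {z z' l : ℕ}
    (hz : z ∈ V) (hz0 : z ≠ 0) (hz' : z' ∈ V) (hz0' : z' ≠ 0) (h1 : len (par z) < l)
    (h2 : l ≤ len z) (h1' : len (par z') < l) (h2' : l ≤ len z')
    (ha : Agree x l (pos z) (pos z')) : z = z' := by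
  have key : ∀ {z z' : ℕ}, z ∈ V → z ≠ 0 → z' ∈ V → z' ≠ 0 → len (par z) < l → l ≤ len z →
      len (par z') < l → l ≤ len z' → Agree x l (pos z) (pos z') → len (par z) ≤ len (par z') →
      z = z' := by
    intro z z' hz hz0 hz' hz0' h1 h2 h1' h2' ha hle
    have hp : par z = par z' := hT.par_eq_of hP hz hz0 (hT.par_mem _ hz' hz0') (by omega) hle
      ((ha.mono h1'.le).trans (hT.par_agree z' hz' hz0'))
    have e := hT.of_child z hz hz0
    rw [hp, ha.2.2 _ h1', hT.of_child z' hz' hz0'] at e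
    exact e.symm
  rcases le_total (len (par z)) (len (par z')) with hle | hle
  · exact key hz hz0 hz' hz0' h1 h2 h1' h2' ha hle
  · exact (key hz' hz0' hz hz0 h1' h2' h1 h2 ha.symm hle).symm

/-- A suffix that does not occur elsewhere hangs from its longest prefix that does. -/
theorem len_par_suffix (hT : Tree x n (IsNode x n) len pos par F V) {v k L : ℕ} (hv : v ∈ V)
    (hl : len v = k) (hp : pos v = k) (hL : IsEll x n k L) (hlt : L < k) : len (par v) = L := by
  have hkn : k ≤ n := hp ▸ hT.pos_le v hv
  have hv0 : v ≠ 0 := by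
    rintro rfl
    rw [hT.len_root] at hl
    omega
  have h1 := hT.par_lt v hv hv0
  have h2 : IsNode x n k L := by
    rcases hL.2 with rfl | ⟨k', hk', hne, ha⟩
    · exact IsNode.zero hkn
    · exact ⟨hkn, k', hk', ha, hL.1 k' hk' hne⟩
  rcases lt_trichotomy (len (par v)) L with h3 | h3 | h3
  · exact absurd (hp.symm ▸ h2) (hT.par_max v hv hv0 L h3 (by omega))
  · exact h3
  · have h4 : IsNode x n k (len (par v)) := by
      have := (hT.node _ (hT.par_mem v hv hv0)).transfer (hT.par_agree v hv hv0).symm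
        (hT.pos_le v hv)
      rwa [hp] at this
    obtain ⟨-, k', hk', ha, hna⟩ := h4
    exfalso
    by_cases hkk : k' = k
    · subst hkk
      exact hna (Agree.refl (by omega))
    · exact hL.1 k' hk' hkk (ha.mono h3)

/-- The Weiner walk from the leaf of suffix `n` towards the root, looking for a link for the
character `c`: `stk` holds the `sp` nodes passed, none of which has such a link, and these are all
ancestors of depth at least `lo`. -/
structure Walk (x : ℕ → ℕ) (n : ℕ) (len pos : ℕ → ℕ) (F : ℕ → ℕ → ℕ) (V : Set ℕ) (c : ℕ)
    (stk : ℕ → ℕ) (sp lo : ℕ) : Prop where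
  mem : ∀ i < sp, stk i ∈ V ∧ Agree x (len (stk i)) n (pos (stk i)) ∧
    F (2 * stk i + 1) c = 0 ∧ lo ≤ len (stk i)
  anti : ∀ i j, i < j → j < sp → len (stk j) < len (stk i)
  all : ∀ l, IsNode x n n l → lo ≤ l → ∃ i < sp, len (stk i) = l

/-- One step of the walk: the node `v` has no link, and there is no node between `v` and the
depth `lo`. -/
theorem Walk.push {c sp v lo : ℕ} {stk : ℕ → ℕ} (hW : Walk x n len pos F V c stk sp (len v + 1))
    (hv : v ∈ V) (ha : Agree x (len v) n (pos v)) (hF : F (2 * v + 1) c = 0) (hlo : lo ≤ len v)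
    (hbetween : ∀ l, lo ≤ l → l < len v → ¬ IsNode x n n l) :
    Walk x n len pos F V c (Function.update stk sp v) (sp + 1) lo := by
  have hold : ∀ i < sp, Function.update stk sp v i = stk i := fun i hi =>
    Function.update_of_ne (by omega) _ _
  refine ⟨fun i hi => ?_, fun i j hij hj => ?_, fun l hl hlo' => ?_⟩
  · rcases Nat.lt_succ_iff_lt_or_eq.1 hi with hi | rfl
    · rw [hold i hi]
      obtain ⟨h1, h2, h3, h4⟩ := hW.mem i hi
      exact ⟨h1, h2, h3, by omega⟩
    · rw [Function.update_self]
      exact ⟨hv, ha, hF, hlo⟩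
  · rw [hold i (by omega)]
    rcases Nat.lt_succ_iff_lt_or_eq.1 hj with hj | rfl
    · rw [hold j hj]
      exact hW.anti i j hij hj
    · rw [Function.update_self]
      exact (hW.mem i hij).2.2.2
  · rcases lt_trichotomy l (len v) with h1 | rfl | h1
    · exact absurd hl (hbetween l hlo' h1)
    · exact ⟨sp, by omega, by rw [Function.update_self]⟩
    · obtain ⟨i, hi, he⟩ := hW.all l hl h1
      exact ⟨i, by omega, by rw [hold i hi, he]⟩

section Walk

variable {sp b : ℕ} {stk : ℕ → ℕ}

/-- No old node that is a prefix of the new suffix is longer than the node where the walk ends. -/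
theorem Walk.not_isNode (hT : Tree x n (IsNode x n) len pos par F V)
    (hW : Walk x n len pos F V (x n) stk sp (len b)) {k l : ℕ} (hk : k ≤ n) (hl : len b < l)
    (ha : Agree x l (n + 1) k) : ¬ IsNode x n k l := by
  intro hn
  obtain ⟨l, rfl⟩ : ∃ i, l = i + 1 := ⟨l - 1, by omega⟩
  obtain ⟨k, rfl⟩ : ∃ i, k = i + 1 := ⟨k - 1, by have := ha.2.1; omega⟩
  obtain ⟨w, hw, hwl, hwa⟩ := hT.surj _ hk _ hn
  rw [agree_cons_iff] at ha
  obtain ⟨i, hi, he⟩ := hW.all l (hn.tail.transfer ha.2.symm le_rfl) (by omega)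
  obtain ⟨h1, h2, h3, -⟩ := hW.mem i hi
  obtain ⟨p, hp⟩ : ∃ p, pos w = p + 1 := ⟨pos w - 1, by have := hwa.2.1; omega⟩
  rw [hp, agree_cons_iff] at hwa
  have := hT.of_link _ h1 w hw (by omega)
    (by rw [hp, he]; exact hwa.2.symm.trans (ha.2.symm.trans (he ▸ h2)))
  rw [hp, Nat.add_sub_cancel, ← hwa.1, ← ha.1, h3] at this
  rw [← this, hT.len_root] at hwl
  omega

/-- If the node at the end of the walk has no child for the next character of the new suffix, it is
the head. -/
theorem Walk.eq_of_child_eq_zero (hT : Tree x n (IsNode x n) len pos par F V) (hb : b ∈ V)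
    (ha : Agree x (len b) (n + 1) (pos b)) (hh : IsHead x n h) (hz : F (2 * b) (x (n - len b)) = 0) :
    h = len b := by
  have h1 := hh.le_of_agree (hT.pos_le b hb) ha
  by_contra hne
  obtain ⟨k, hk, hka⟩ := hh.1
  have h2 := hT.child_ne_zero (isNode_invariant x n) (fun k hk => IsNode.self hk) hb hk
    (by have := hka.2.1; omega) ((hka.mono h1).symm.trans ha)
  rw [← hka.2.2 _ (by omega), Nat.add_sub_cancel] at h2
  exact h2.2.1 hz

/-- If the node at the end of the walk has a child `z` for the next character of the new suffix, the
head lies inside the edge to `z`. Without its first character the head is an explicit node, which is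
one of the nodes passed. -/
theorem Walk.of_child_ne_zero (hT : Tree x n (IsNode x n) len pos par F V)
    (hW : Walk x n len pos F V (x n) stk sp (len b)) (hb : b ∈ V)
    (ha : Agree x (len b) (n + 1) (pos b)) (hh : IsHead x n h) {z : ℕ}
    (hz : F (2 * b) (x (n - len b)) = z) (hz0 : z ≠ 0) :
    z ∈ V ∧ par z = b ∧ len b < h ∧ h < len z ∧ Agree x h (n + 1) (pos z) ∧
      ∃ i < sp, len (stk i) + 1 = h := by
  obtain ⟨h1, h2, h3⟩ := hT.child_of b _ (hz ▸ hz0)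
  rw [hz] at h1 h2 h3
  have hp := hT.par_lt z h1 hz0
  rw [h2] at hp
  have hzp := (hT.node z h1).le
  have h4 : Agree x (len b + 1) (n + 1) (pos z) := by
    refine agree_succ_iff.2 ⟨?_, ?_, by omega, ?_⟩
    · have := hT.par_agree z h1 hz0
      rw [h2] at this
      exact ha.trans this.symm
    · have := hh.le_of_agree (hT.pos_le b hb) ha
      have := hh.le
      omega
    · rw [h3]; rfl
  have h5 := hh.le_of_agree (hT.pos_le z h1) h4
  obtain ⟨k, hk, hka⟩ := hh.1
  have h6 : Agree x (min h (len z)) k (pos z) := by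
    by_contra hc
    obtain ⟨i, hi1, hi2, hi3, hi4⟩ := exists_lcp ((hka.mono h5).symm.trans h4) hc
    exact hT.par_max z h1 hz0 i (by rw [h2]; omega) (by omega)
      ⟨hT.pos_le z h1, k, hk, hi3.symm, fun h => hi4 h.symm⟩
  have h7 : h < len z := by
    by_contra hc
    rw [min_eq_right (by omega)] at h6
    exact hW.not_isNode hT (hT.pos_le z h1) hp ((hka.mono (by omega)).trans h6) (hT.node z h1)
  rw [min_eq_left h7.le] at h6
  have h8 := hka.trans h6
  refine ⟨h1, h2, h5, h7, h8, ?_⟩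
  obtain ⟨p, hp⟩ : ∃ p, pos z = p + 1 := ⟨pos z - 1, by omega⟩
  obtain ⟨g, rfl⟩ : ∃ g, h = g + 1 := ⟨h - 1, by omega⟩
  have h9 := hh.2 _ (hT.pos_le z h1)
  have h10 := hT.pos_le z h1
  rw [hp, agree_cons_iff] at h8 h9
  obtain ⟨i, hi, he⟩ := hW.all g ⟨le_rfl, p, by omega, h8.2, fun h => h9 ⟨h8.1, h⟩⟩ (by omega)
  exact ⟨i, hi, by omega⟩

open Classical in
/-- The walk is paid for by the decrease of the depth of the current leaf. -/
theorem Walk.depth_le (hT : Tree x n (IsNode x n) len pos par F V)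
    (hW : Walk x n len pos F V (x n) stk sp (len b)) (hh : IsHead x n h) :
    sp + depth x (n + 1) ≤ depth x n + 3 := by
  -- the nodes passed are ancestors of the old leaf below the depth at which the walk ends
  have h1 : sp ≤ ((Finset.range (n + 1)).filter fun l => IsNode x n n l ∧ len b ≤ l).card := by
    have : (Finset.range sp).card ≤ _ := Finset.card_le_card_of_injOn (s := Finset.range sp)
      (t := (Finset.range (n + 1)).filter fun l => IsNode x n n l ∧ len b ≤ l)
      (fun i => len (stk i)) ?_ ?_
    · simpa using this
    · intro i hi
      obtain ⟨g1, g2, -, g3⟩ := hW.mem i (by simpa using hi)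
      have := g2.1
      simp
      exact ⟨by omega, (hT.node _ g1).transfer g2.symm le_rfl, g3⟩
    · intro i hi j hj hij
      simp at hi hj hij
      by_contra hne
      rcases Nat.lt_or_gt_of_ne hne with hlt | hlt
      · have := hW.anti i j hlt hj; omega
      · have := hW.anti j i hlt hi; omega
  -- an ancestor of the new leaf is the head, or the root, or the target of a Weiner link from a
  -- higher ancestor of the old leaf
  have h2 : depth x (n + 1) ≤ ((Finset.range (n + 1)).filter
      fun l => IsNode x n n l ∧ l < len b).card + 2 := by
    obtain ⟨k, hk, hka⟩ := hh.1
    have : (Finset.range (n + 1)).filter (IsNode x (n + 1) (n + 1)) ⊆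
        insert h (insert 0 (((Finset.range (n + 1)).filter
          fun l => IsNode x n n l ∧ l < len b).image (· + 1))) := by
      intro l hl
      simp only [Finset.mem_filter, Finset.mem_range] at hl
      simp only [Finset.mem_insert, Finset.mem_image, Finset.mem_filter, Finset.mem_range]
      rcases (isNode_new_iff hh hk hka).1 hl.2 with g | ⟨g1, g2 | g2⟩
      · omega
      · rcases Nat.eq_zero_or_pos l with rfl | hl0
        · simp
        · obtain ⟨l, rfl⟩ : ∃ i, l = i + 1 := ⟨l - 1, by omega⟩
          have g3 : l + 1 ≤ len b := by
            by_contra hc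
            exact hW.not_isNode hT hk (by omega) (hka.mono g1) g2
          obtain ⟨k, rfl⟩ : ∃ i, k = i + 1 := ⟨k - 1, by have := g2.le; omega⟩
          have g4 := (agree_cons_iff.1 (hka.mono g1)).2
          exact .inr (.inr ⟨l, ⟨by omega, g2.tail.transfer g4.symm le_rfl, by omega⟩, rfl⟩)
      · exact .inl g2
    refine (Finset.card_le_card this).trans ?_
    refine (Finset.card_insert_le _ _).trans ?_
    have g1 := Finset.card_insert_le 0 (((Finset.range (n + 1)).filter
      fun l => IsNode x n n l ∧ l < len b).image (· + 1))
    have g2 := Finset.card_image_le (f := (· + 1)) (s := ((Finset.range (n + 1)).filter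
      fun l => IsNode x n n l ∧ l < len b))
    omega
  have h3 : ((Finset.range (n + 1)).filter fun l => IsNode x n n l ∧ len b ≤ l).card +
      ((Finset.range (n + 1)).filter fun l => IsNode x n n l ∧ l < len b).card ≤ depth x n + 1 := by
    rw [← Finset.card_union_of_disjoint]
    · have : (Finset.range (n + 1)).filter (fun l => IsNode x n n l ∧ len b ≤ l) ∪
          (Finset.range (n + 1)).filter (fun l => IsNode x n n l ∧ l < len b) ⊆
          insert n ((Finset.range n).filter (IsNode x n n)) := by
        intro l hl
        simp only [Finset.mem_union, Finset.mem_filter, Finset.mem_range] at hl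
        simp only [Finset.mem_insert, Finset.mem_filter, Finset.mem_range]
        have : IsNode x n n l := by tauto
        by_cases hln : l = n
        · exact .inl hln
        · exact .inr ⟨by omega, this⟩
      exact (Finset.card_le_card this).trans (Finset.card_insert_le _ _)
    · rw [Finset.disjoint_filter]
      intro l _ g1 g2
      omega
  omega

end Walk

/-- The tree after the head has been made explicit. -/
theorem split_head (hT : Tree x n (IsNode x n) len pos par F V) (hh : IsHead x n h) {z y u : ℕ}
    (hz : z ∈ V) (hz0 : z ≠ 0) (hh1 : len (par z) < h) (hh2 : h < len z)
    (ha : Agree x h (n + 1) (pos z)) (hy : y ∈ V) (hyl : len y + 1 = h)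
    (hya : Agree x (len y) n (pos y)) (hu : u ∉ V) :
    Tree x n (IsNode x (n + 1)) (Function.update len u h) (Function.update pos u (pos z))
      (Function.update (Function.update par u (par z)) z u)
      (setEntry (setEntry (setEntry F (2 * par z) (x (n - len (par z))) u)
        (2 * u) (x (pos z - 1 - h)) z) (2 * y + 1) (x n) u)
      (insert u V) := by
  obtain ⟨p, hp⟩ : ∃ p, pos z = p + 1 := ⟨pos z - 1, by have := ha.2.1; omega⟩
  have h1 : x (pos z - 1 - len (par z)) = x (n - len (par z)) := (ha.2.2 _ hh1).symm
  have h2 : x (pos z - 1) = x n := by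
    simpa using (ha.2.2 0 (by omega)).symm
  have h3 : Agree x (len y) (pos z - 1) (pos y) := by
    have := ha
    rw [hp, ← hyl, agree_cons_iff] at this
    rw [hp, Nat.add_sub_cancel]
    exact this.2.symm.trans hya
  have h4 := hT.split (isNode_invariant x n) (fun k l h => h.tail) hz hz0 hh1 hh2 hy hyl h3 hu
  rw [h1, h2] at h4
  refine h4.congr_pred fun k hk l => ?_
  rw [isNode_succ_iff hh hk]
  refine or_congr_right (and_congr_right fun e => ?_)
  exact ⟨fun h => h.trans ha.symm, fun h => h.trans ha⟩

/-- Adding the leaf of the new suffix to a tree in which its head is explicit. -/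
theorem addLeaf_head (hT : Tree x n (IsNode x (n + 1)) len pos par F V) {q s u : ℕ}
    (hq : q ∈ V) (hqa : Agree x (len q) (n + 1) (pos q)) (hh : IsHead x n (len q))
    (hs : s ∈ V) (hsp : pos s = n) (hsl : len s = n) (hu : u ∉ V) :
    Tree x (n + 1) (IsNode x (n + 1))
      (Function.update len u (n + 1)) (Function.update pos u (n + 1))
      (Function.update par u q)
      (setEntry (setEntry F (2 * q) (x (n - len q)) u) (2 * s + 1) (x n) u)
      (insert u V) := by
  have h1 : Invariant x n (IsNode x (n + 1)) :=
    ⟨fun _ _ h => h.le, fun _ _ _ h hk ha => h.transfer ha (by omega)⟩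
  refine (hT.addLeaf h1 hq hqa hh hs hsp hsl hu).congr_pred fun k hk l => ?_
  have hqn := hT.pos_le q hq
  rcases Nat.lt_or_eq_of_le hk with hk | rfl
  · rw [and_iff_right (show k ≤ n by omega), or_iff_left (by omega)]
  · rw [isNode_new_iff hh hqn hqa, isNode_succ_iff hh hqn, or_iff_right (by omega),
      and_iff_right rfl]
    refine or_congr_right (and_congr_right fun _ => or_congr_right ?_)
    exact and_iff_left hqa.symm

theorem congr_head (hT : Tree x n (IsNode x n) len pos par F V) {b : ℕ} (hb : b ∈ V)
    (ha : Agree x (len b) (n + 1) (pos b)) (hh : IsHead x n (len b)) :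
    Tree x n (IsNode x (n + 1)) len pos par F V := by
  refine hT.congr_pred fun k hk l => ?_
  rw [isNode_succ_iff hh hk, or_iff_left_of_imp]
  rintro ⟨rfl, h⟩
  exact (hT.node b hb).transfer (h.trans ha).symm hk

/-- The suffix whose leaf is the locus `y` of the head, if it is unique, is the only one whose
longest repeated prefix changes. -/
theorem isEll_step (hT : Tree x n (IsNode x n) len pos par F V) (hh : IsHead x n h) {y : ℕ}
    (hsuf : ∀ k ≤ n, 2 * k ∈ V ∧ len (2 * k) = k ∧ pos (2 * k) = k) {ell : ℕ → ℕ}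
    (hell : ∀ k ≤ n, IsEll x n k (ell k)) (hy : y ∈ V) (hya : Agree x h (n + 1) (pos y))
    (hyh : h ≤ len y) (hyp : y ≠ 0 → len (par y) < h) {k : ℕ} (hk : k ≤ n) :
    IsEll x (n + 1) k (if y = 2 * k ∧ ell k < k then h else ell k) := by
  obtain ⟨s1, s2, s3⟩ := hsuf k hk
  split_ifs with hc
  · obtain ⟨rfl, hlt⟩ := hc
    have h1 := hT.len_par_suffix s1 s2 s3 (hell k hk) hlt
    have h2 := hyp (by omega)
    refine ((hell k hk).step_of_agree hh hk ?_).1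
    rw [s3] at hya
    exact (hya.mono (by omega)).symm
  · refine (hell k hk).step_of_not fun ha => hc ?_
    obtain ⟨-, h2, h3⟩ := (hell k hk).step_of_agree hh hk ha
    have hlt : ell k < k := h3.trans_le h2.1
    refine ⟨?_, hlt⟩
    have h1 := hT.len_par_suffix s1 s2 s3 (hell k hk) hlt
    have hy0 : y ≠ 0 := by
      rintro rfl
      rw [hT.len_root] at hyh
      omega
    refine hT.locus_unique (isNode_invariant x n) hy hy0 s1 (by omega) (hyp hy0) hyh (by omega)
      (by rw [s2]; exact h2.1) ?_
    rw [s3]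
    exact hya.symm.trans h2.symm

end Tree

/-! ### The update program: the Weiner walk -/

-- `aX` holds the numbers of the characters, in the order of arrival. `aLen`, `aPos` and `aPar`
-- describe the nodes of the suffix tree, as in `Tree`. `aEll k` is the length of the longest
-- repeated prefix of suffix `k`, `aOn k` is `0` or one more than the node at which suffix `k`
-- contributes to the net frequency, and `aPhi` holds the net frequencies of the nodes.
notation "aX" => 0
notation "aLen" => 1
notation "aPos" => 2
notation "aPar" => 3
notation "aStack" => 7
notation "aEll" => 8
notation "aOn" => 9
notation "aPhi" => 10
notation "rN" => 1
notation "rV" => 30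
notation "rSp" => 31
notation "rB" => 33
notation "rZ" => 34
notation "rLB" => 35
notation "rH" => 36
notation "rY" => 37
notation "rLeaf" => 38
notation "rQ" => 39
notation "rLocus" => 40
notation "rCont" => 41
notation "rJ" => 42
notation "rK" => 43

open NetFreq.Expr NetFreq.Cmd in
/-- The walk from the leaf of suffix `rN` to the first node with a Weiner link for `rId`. The target
of the link is `rB`, which is the root if there is no such node. -/
def walk : Cmd :=
  rV ≔ lit 2 *. reg rN ;;
  rSp ≔ lit 0 ;;
  rCont ≔ lit 1 ;;
  loop (reg rCont) (
    rOwner ≔ lit 2 *. reg rV +. lit 1 ;;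
    rKey ≔ reg rId ;;
    findEntry ;;
    branch (reg rFound) (rCont ≔ lit 0)
      (store aStack (reg rSp) (reg rV) ;;
       rSp ≔ reg rSp +. lit 1 ;;
       branch (reg rV) (rV ≔ get aPar (reg rV)) (rCont ≔ lit 0))) ;;
  rB ≔ reg rFound

section

variable {α : Type*} [LinearOrder α] {A W : ℕ} {inp : List α} {s : State α}
  {n σ : ℕ} {F : ℕ → ℕ → ℕ} {V : Set ℕ}

theorem find_spec (hD : HasDict s.arr (s.reg rCount) σ F) (hc : s.reg rKey ≤ σ)
    (hA : 3 * s.reg rOwner < A) (hA' : 3 * s.reg rCount + 2 < A) (hAW : A ≤ W) (hW : 3 < W)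
    (hσW : σ < W) :
    WP A W inp findEntry s fun s' t =>
      s'.arr = s.arr ∧ s'.carr = s.carr ∧ s'.creg = s.creg ∧
      SameOff [rEntry, rLoc, rBits, rFound] s'.reg s.reg ∧
      s'.reg rFound = F (s.reg rOwner) (s.reg rKey) ∧
      t ≤ 40 * (Nat.log 2 σ + 2) := by
  obtain ⟨⟨own, dep, hD⟩, hσ⟩ := hD
  refine (findEntry_spec hD hσ hc hA hA' hAW hW hσW).mono ?_
  rintro s' t ⟨h1, h2, h3, h4, h5, h6, -⟩
  exact ⟨h1, h2, h3, h4, h5, h6⟩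

theorem walk_spec (hn : s.reg rN = n)
    (hT : Tree (s.arr aX) n (IsNode (s.arr aX) n) (s.arr aLen) (s.arr aPos) (s.arr aPar) F V)
    (hD : HasDict s.arr (s.reg rCount) σ F) (hV : ∀ v ∈ V, v ≤ 2 * n)
    (hs : 2 * n ∈ V ∧ s.arr aLen (2 * n) = n ∧ s.arr aPos (2 * n) = n)
    (hx : s.arr aX n = s.reg rId) (hid : s.reg rId ≤ σ) (hσ : σ ≤ n + 1)
    (hE : s.reg rCount ≤ 5 * n) (hA : 100 * (n + 2) ≤ A) (hAW : A ≤ W) :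
    WP A W inp walk s fun s' τ =>
      SameOff [aStack] s'.arr s.arr ∧ s'.carr = s.carr ∧ s'.creg = s.creg ∧
      SameOff [rV, rSp, rCont, rB, rOwner, rKey, rEntry, rLoc, rBits, rFound] s'.reg s.reg ∧
      s'.reg rB ∈ V ∧
      Tree.Walk (s.arr aX) n (s.arr aLen) (s.arr aPos) F V (s.arr aX n) (s'.arr aStack)
        (s'.reg rSp) (s.arr aLen (s'.reg rB)) ∧
      Agree (s.arr aX) (s.arr aLen (s'.reg rB)) (n + 1) (s.arr aPos (s'.reg rB)) ∧
      s'.reg rSp ≤ n + 1 ∧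
      τ ≤ (s'.reg rSp + 1) * (40 * (Nat.log 2 σ + 2) + 40) + 20 := by
  set x := s.arr aX with hxdef
  set len := s.arr aLen with hlen
  set pos := s.arr aPos with hpos
  let I : ℕ → State α → Prop := fun m s' =>
    SameOff [aStack] s'.arr s.arr ∧ s'.carr = s.carr ∧ s'.creg = s.creg ∧
    SameOff [rV, rSp, rCont, rB, rOwner, rKey, rEntry, rLoc, rBits, rFound] s'.reg s.reg ∧
    (s'.reg rCont = 1 ∧ s'.reg rV ∈ V ∧ Agree x (len (s'.reg rV)) n (pos (s'.reg rV)) ∧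
      Tree.Walk x n len pos F V (x n) (s'.arr aStack) (s'.reg rSp) (len (s'.reg rV) + 1) ∧
      len (s'.reg rV) + s'.reg rSp ≤ n ∧ m + s'.reg rSp = n + 2 ∨
    s'.reg rCont = 0 ∧ s'.reg rFound ∈ V ∧
      Agree x (len (s'.reg rFound)) (n + 1) (pos (s'.reg rFound)) ∧
      Tree.Walk x n len pos F V (x n) (s'.arr aStack) (s'.reg rSp) (len (s'.reg rFound)) ∧
      m + s'.reg rSp = n + 1)
  rw [walk]
  simp only [wp_seq]
  simp [hn]
  refine ⟨⟨by omega, by omega⟩, by omega, by omega, ?_⟩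
  refine WP.mono (wp_loop (40 * (Nat.log 2 σ + 2) + 35) I ?_ (m := n + 2) ?_) ?_
  · rintro m s' ⟨h1, h2, h3, h4, h5⟩
    refine ⟨trivial, fun hne => ?_⟩
    simp only [Expr.val] at hne
    obtain ⟨h5, h6, h7, h8, h9, h10⟩ := h5.resolve_right fun h => hne h.1
    have hvn := hV _ h6
    obtain ⟨v, hv⟩ : ∃ v, v = s'.reg rV := ⟨_, rfl⟩
    obtain ⟨sp, hsp⟩ : ∃ sp, sp = s'.reg rSp := ⟨_, rfl⟩
    rw [← hv] at hvn h6 h7 h8 h9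
    rw [← hsp] at h8 h9 h10
    have hid' : s'.reg rId = s.reg rId := h4 _ (by simp)
    have hE' : s'.reg rCount = s.reg rCount := h4 _ (by simp)
    have hpar : s'.arr aPar = s.arr aPar := h1 _ (by simp)
    simp only [wp_seq]
    simp [← hv, hid']
    refine ⟨⟨⟨by omega, by omega⟩, by omega, by omega⟩, ?_⟩
    refine WP.mono (find_spec (σ := σ) (F := F) ?_ ?_ ?_ ?_ hAW (by omega) (by omega)) ?_
    · simpa [HasDict, hE', h1 4 (by simp), h1 5 (by simp), h1 6 (by simp)] using hD
    · simpa using hid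
    · simp; omega
    · simp [hE']; omega
    rintro s2 t ⟨k1, k2, k3, k4, k5, k6⟩
    have g1 : s2.reg rV = v := by rw [k4 _ (by simp)]; simp [hv]
    have g2 : s2.reg rSp = sp := by rw [k4 _ (by simp)]; simp [hsp]
    have g3 : s2.reg rFound = F (2 * v + 1) (x n) := by rw [k5, hx]; simp
    simp at k1 k2 k3
    have g4 : SameOff [rOwner, rKey, rEntry, rLoc, rBits, rFound] s2.reg s'.reg := by
      intro r hr
      simp at hr
      rw [k4 r (by simp; tauto)]
      simp [hr]
    have g5 := (g4.mono (l' := [rV, rSp, rCont, rB, rOwner, rKey, rEntry, rLoc, rBits, rFound])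
      (by simp)).trans h4
    rw [wp_branch]
    refine ⟨trivial, fun hf => ?_, fun hf => ?_⟩
    · simp only [Expr.val] at hf
      rw [g3] at hf
      obtain ⟨l1, l2, l3, l4, l5⟩ := hT.link_of _ _ hf
      rw [← g3] at l2 l3 l4 l5
      simp
      refine ⟨by omega, by omega, m - 1, by omega, by simpa [k1] using h1, by simpa [k2] using h2,
        by simpa [k3] using h3, by simpa using g5, .inr ⟨by simp, by simpa using l2, ?_, ?_, ?_⟩⟩
      · simp
        have hp := (hT.node _ l2).le
        obtain ⟨p, hp⟩ : ∃ p, pos (s2.reg rFound) = p + 1 :=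
          ⟨pos (s2.reg rFound) - 1, by omega⟩
        rw [hp, Nat.add_sub_cancel] at l4 l5
        rw [l3, hp, agree_cons_iff]
        exact ⟨l4.symm, h7.trans l5.symm⟩
      · simpa [k1, g2, l3] using h8
      · simp [g2]; omega
    · simp only [Expr.val] at hf
      rw [g3] at hf
      simp only [wp_seq]
      simp [g1, g2]
      refine ⟨by omega, ⟨by omega, by omega⟩, ?_⟩
      rw [wp_branch]
      simp [g1, g2]
      refine ⟨fun hv0 => ?_, fun hv0 => ?_⟩
      · have p1 := hT.par_mem v h6 hv0
        have p2 := hT.par_lt v h6 hv0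
        refine ⟨by omega, by omega, m - 1, by omega, by simpa [k1] using h1,
          by simpa [k2] using h2, by simpa [k3] using h3, by simpa using g5, .inl ?_⟩
        simp [k1, hpar]
        refine ⟨by rw [g4 _ (by simp), h5], p1, (h7.mono p2.le).trans (hT.par_agree v h6 hv0), ?_,
          by omega, by omega⟩
        refine h8.push h6 h7 hf (by omega) fun l hl1 hl2 hl => ?_
        exact hT.par_max v h6 hv0 l (by omega) hl2 (hl.transfer (h7.mono hl2.le) (hT.pos_le v h6))
      · subst hv0
        refine ⟨by omega, by omega, m - 2, by omega, by simpa [k1] using h1,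
          by simpa [k2] using h2, by simpa [k3] using h3, by simpa using g5, .inr ?_⟩
        simp [k1, g3, hf]
        refine ⟨hT.root, by rw [hT.len_root]; exact Agree.zero, ?_, by omega⟩
        exact h8.push h6 h7 hf le_rfl fun l hl1 hl2 => by omega
  · refine ⟨by simp, by simp, by simp, by simp, .inl ?_⟩
    simp [hs]
    exact ⟨Agree.refl le_rfl, ⟨by omega, by omega, fun l hl hl' => by have := hl.le; omega⟩⟩
  · rintro s' τ ⟨m', h0, ⟨h1, h2, h3, h4, h5⟩, h6, h7⟩
    simp only [Expr.val] at h6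
    obtain ⟨h5, h8, h9, h10, h11⟩ := h5.resolve_left fun h => by omega
    simp at h7 ⊢
    refine ⟨h1, h2, h3, h4, h8, h10, h9, by omega, ?_⟩
    have h12 : n + 2 - m' = s'.reg rSp + 1 := by omega
    rw [h12] at h7
    have h13 : (s'.reg rSp + 1) * (40 * (Nat.log 2 σ + 2) + 35 + 1 + 1) ≤
      (s'.reg rSp + 1) * (40 * (Nat.log 2 σ + 2) + 40) := Nat.mul_le_mul_left _ (by omega)
    omega

end

/-! ### The update program: the head and the new leaf -/

/-- Set the dictionary entry for owner `o` and key `k` to `v`. -/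
def setAt (o k v : Expr) : Cmd := rOwner ≔ o ;; rKey ≔ k ;; rValue ≔ v ;; setValue

open NetFreq.Expr NetFreq.Cmd in
/-- Look for the depth `rH` at which the new suffix leaves the edge to `rZ`, by going back along the
nodes passed in the walk. -/
def scan : Cmd :=
  rSp ≔ reg rSp -. lit 1 ;;
  rY ≔ get aStack (reg rSp) ;;
  rH ≔ get aLen (reg rY) +. lit 1 ;;
  loop (get aX (get aPos (reg rZ) -. lit 1 -. reg rH) =. get aX (reg rN -. reg rH)) (
    rSp ≔ reg rSp -. lit 1 ;;
    rY ≔ get aStack (reg rSp) ;;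
    rH ≔ get aLen (reg rY) +. lit 1)

open NetFreq.Expr NetFreq.Cmd in
/-- Split the edge from `rB` to `rZ` at depth `rH`. The new node is `rQ`. -/
def splitEdge : Cmd :=
  rQ ≔ lit 2 *. reg rN +. lit 1 ;;
  store aLen (reg rQ) (reg rH) ;;
  store aPos (reg rQ) (get aPos (reg rZ)) ;;
  store aPar (reg rQ) (reg rB) ;;
  store aPar (reg rZ) (reg rQ) ;;
  setAt (lit 2 *. reg rB) (get aX (reg rN -. reg rLB)) (reg rQ) ;;
  setAt (lit 2 *. reg rQ) (get aX (get aPos (reg rZ) -. lit 1 -. reg rH)) (reg rZ) ;;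
  setAt (lit 2 *. reg rY +. lit 1) (reg rId) (reg rQ) ;;
  rLocus ≔ reg rZ

open NetFreq.Expr NetFreq.Cmd in
/-- Make the head of the new suffix an explicit node `rQ`. Its length is `rH`, and `rLocus` is its
locus in the old tree. -/
def locate : Cmd :=
  rLB ≔ get aLen (reg rB) ;;
  rOwner ≔ lit 2 *. reg rB ;;
  rKey ≔ get aX (reg rN -. reg rLB) ;;
  findEntry ;;
  rZ ≔ reg rFound ;;
  branch (reg rZ) (scan ;; splitEdge) (rQ ≔ reg rB ;; rH ≔ reg rLB ;; rLocus ≔ reg rB)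

open NetFreq.Expr NetFreq.Cmd in
/-- Add the leaf of the new suffix below `rQ`. -/
def newLeaf : Cmd :=
  rLeaf ≔ lit 2 *. reg rN +. lit 2 ;;
  store aLen (reg rLeaf) (reg rN +. lit 1) ;;
  store aPos (reg rLeaf) (reg rN +. lit 1) ;;
  store aPar (reg rLeaf) (reg rQ) ;;
  setAt (lit 2 *. reg rQ) (get aX (reg rN -. reg rH)) (reg rLeaf) ;;
  setAt (lit 2 *. (lit 2 *. reg rN) +. lit 1) (reg rId) (reg rLeaf)

section

variable {α : Type*} [LinearOrder α] {A W : ℕ} {inp : List α} {s : State α}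
  {n σ : ℕ} {F : ℕ → ℕ → ℕ} {V : Set ℕ}

theorem setAt_spec {o k v : Expr} {vo vk vv : ℕ} (hD : HasDict s.arr (s.reg rCount) σ F)
    (ho : o.Ok A W inp s ∧ o.val inp s = vo)
    (hk : k.Ok A W inp (s.setReg rOwner vo) ∧ k.val inp (s.setReg rOwner vo) = vk)
    (hv : v.Ok A W inp ((s.setReg rOwner vo).setReg rKey vk) ∧
      v.val inp ((s.setReg rOwner vo).setReg rKey vk) = vv)
    (hsz : o.size + k.size + v.size ≤ 40) (hkσ : vk ≤ σ) (hv0 : vv ≠ 0)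
    (hA : 3 * vo < A) (hA' : 3 * s.reg rCount + 5 < A) (hAW : A ≤ W) (hW : 3 < W) (hσW : σ < W) :
    WP A W inp (setAt o k v) s fun s' t =>
      SameOff [aLink, aKey, aVal] s'.arr s.arr ∧ s'.carr = s.carr ∧ s'.creg = s.creg ∧
      SameOff [rOwner, rKey, rValue, rEntry, rLoc, rBits, rFound, rCount] s'.reg s.reg ∧
      s'.reg rCount ≤ s.reg rCount + 1 ∧
      HasDict s'.arr (s'.reg rCount) σ (setEntry F vo vk vv) ∧
      t ≤ 40 * (Nat.log 2 σ + 2) + 70 := by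
  obtain ⟨ho, rfl⟩ := ho
  obtain ⟨hk, rfl⟩ := hk
  obtain ⟨hv, rfl⟩ := hv
  rw [setAt, wp_seq, wp_assign]
  refine ⟨ho, ?_⟩
  rw [wp_seq, wp_assign]
  refine ⟨hk, ?_⟩
  rw [wp_seq, wp_assign]
  refine ⟨hv, ?_⟩
  refine WP.mono (setValue_spec (F := F) (σ := σ) ?_ ?_ ?_ ?_ ?_ hAW hW hσW) ?_
  · simpa using hD
  · simpa using hkσ
  · simpa using hv0
  · simpa using hA
  · simpa using hA'
  rintro s' t ⟨h1, h2, h3, h4, h5, h6, h7⟩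
  simp at h1 h2 h3 h5 h6
  refine ⟨h1, h2, h3, ?_, h5, h6, by omega⟩
  intro r hr
  simp at hr
  rw [h4 r (by simp; tauto)]
  simp [hr]

/-- The nodes passed are visited from the last to the first, so that the candidates for the length
of the head increase. The new suffix follows the edge to `z` up to the length of the head, which is
one of the candidates, and leaves it there. -/
theorem scan_spec (hn : s.reg rN = n) {c lo sp h z : ℕ} (hz : s.reg rZ = z) (hsp : s.reg rSp = sp)
    (hW : Tree.Walk (s.arr aX) n (s.arr aLen) (s.arr aPos) F V c (s.arr aStack) sp lo)
    (hh : IsHead (s.arr aX) n h) (ha : Agree (s.arr aX) h (n + 1) (s.arr aPos z))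
    (hzn : s.arr aPos z ≤ n) (hhz : h < s.arr aPos z)
    (hex : ∃ i < sp, s.arr aLen (s.arr aStack i) + 1 = h) (hspn : sp ≤ n + 1)
    (hV : ∀ v ∈ V, v ≤ 2 * n) (hz2 : z ≤ 2 * n)
    (hA : 100 * (n + 2) ≤ A) (hAW : A ≤ W) :
    WP A W inp scan s fun s' τ =>
      s'.arr = s.arr ∧ s'.carr = s.carr ∧ s'.creg = s.creg ∧
      SameOff [rSp, rY, rH] s'.reg s.reg ∧ s'.reg rH = h ∧ s'.reg rY ∈ V ∧
      s.arr aLen (s'.reg rY) + 1 = h ∧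
      Agree (s.arr aX) (s.arr aLen (s'.reg rY)) n (s.arr aPos (s'.reg rY)) ∧
      τ ≤ (sp + 1) * 40 := by
  obtain ⟨i₀, hi₀, he⟩ := hex
  set x := s.arr aX with hx
  set len := s.arr aLen with hlen
  set stk := s.arr aStack with hstk
  have hle := hh.le
  have hmono : ∀ j < sp, i₀ ≤ j → len (stk j) ≤ len (stk i₀) := by
    intro j hj hij
    rcases Nat.lt_or_eq_of_le hij with hij | rfl
    · exact (hW.anti _ _ hij hj).le
    · rfl
  have hlast := hmono (sp - 1) (by omega) (by omega)
  have hvl : ∀ j < sp, stk j ≤ 2 * n := fun j hj => hV _ (hW.mem j hj).1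
  have hvl' := hvl (sp - 1) (by omega)
  let I : ℕ → State α → Prop := fun m s' =>
    s'.arr = s.arr ∧ s'.carr = s.carr ∧ s'.creg = s.creg ∧
    SameOff [rSp, rY, rH] s'.reg s.reg ∧ s'.reg rSp = m ∧ m < sp ∧ i₀ ≤ m ∧
    s'.reg rY = stk m ∧ s'.reg rH = len (stk m) + 1
  rw [scan]
  simp only [wp_seq]
  simp [hsp, hz, ← hx, ← hlen, ← hstk]
  refine ⟨by omega, by omega, by omega, ?_⟩
  refine WP.mono (wp_loop 20 I ?_ (m := sp - 1) ?_) ?_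
  · rintro m s' ⟨h1, h2, h3, h4, h5, h6, h7, h8, h9⟩
    have hz' : s'.reg rZ = z := (h4 _ (by simp)).trans hz
    have hn' : s'.reg rN = n := (h4 _ (by simp)).trans hn
    have h10 := hmono m h6 h7
    have h11 := hmono (m - 1) (by omega)
    simp [h1, hz', hn', h9, ← hx]
    refine ⟨⟨by omega, by omega, ite_lt_of (by omega)⟩, fun heq => ?_⟩
    have hne : i₀ ≠ m := by
      rintro rfl
      rw [he] at heq
      refine hh.2 _ hzn (agree_succ_iff.2 ⟨ha, by omega, hhz, ?_⟩)
      simpa using heq.symm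
    have h12 := h11 (by omega)
    have h13 := hvl (m - 1) (by omega)
    simp [h5, ← hlen, ← hstk, h1]
    refine ⟨by omega, by omega, by omega, m - 1, by omega,
      by simpa using h1, by simpa using h2, by simpa using h3, by simpa using h4, by simp,
      by omega, by omega, by simp, by simp⟩
  · exact ⟨by simp, by simp, by simp, by simp, by simp, by omega, by omega, by simp, by simp⟩
  · rintro s' τ ⟨m, h0, ⟨h1, h2, h3, h4, h5, h6, h7, h8, h9⟩, h10, h11⟩
    have hz' : s'.reg rZ = z := (h4 _ (by simp)).trans hz
    have hn' : s'.reg rN = n := (h4 _ (by simp)).trans hn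
    have h12 := hmono m h6 h7
    simp [h1, hz', hn', h9, ← hx] at h10
    obtain ⟨g1, g2, -⟩ := hW.mem m h6
    have h13 : len (stk m) + 1 = h := by
      by_contra hne
      have := ha.2.2 (len (stk m) + 1) (by omega)
      exact h10 (by simpa using this.symm)
    refine ⟨h1, h2, h3, h4, h9.trans h13, h8 ▸ g1, h8 ▸ h13, h8 ▸ g2, ?_⟩
    simp at h11
    have : (sp - 1 - m) * 33 ≤ sp * 33 := Nat.mul_le_mul_right _ (by omega)
    omega

theorem HasDict.congr {arr arr' : ℕ → ℕ → ℕ} {E : ℕ} (hD : HasDict arr E σ F)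
    (h1 : arr' aLink = arr aLink) (h2 : arr' aKey = arr aKey) (h3 : arr' aVal = arr aVal) :
    HasDict arr' E σ F := by
  simpa [HasDict, h1, h2, h3] using hD

theorem splitEdge_spec (hn : s.reg rN = n) {z y h : ℕ} (hz : s.reg rZ = z)
    (hT : Tree (s.arr aX) n (IsNode (s.arr aX) n) (s.arr aLen) (s.arr aPos) (s.arr aPar) F V)
    (hD : HasDict s.arr (s.reg rCount) σ F) (hV : ∀ v ∈ V, v ≤ 2 * n)
    (hx : s.arr aX n = s.reg rId) (hX : ∀ i ≤ n, s.arr aX i ≤ σ) (hσ : σ ≤ n + 1)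
    (hE : s.reg rCount ≤ 5 * n) (hh : IsHead (s.arr aX) n h) (hzV : z ∈ V) (hz0 : z ≠ 0)
    (hb : s.reg rB = s.arr aPar z) (hLB : s.reg rLB = s.arr aLen (s.arr aPar z))
    (hh1 : s.arr aLen (s.arr aPar z) < h) (hh2 : h < s.arr aLen z)
    (ha : Agree (s.arr aX) h (n + 1) (s.arr aPos z)) (hH : s.reg rH = h) (hY : s.reg rY = y)
    (hy : y ∈ V) (hyl : s.arr aLen y + 1 = h)
    (hya : Agree (s.arr aX) (s.arr aLen y) n (s.arr aPos y))
    (hA : 100 * (n + 2) ≤ A) (hAW : A ≤ W) :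
    WP A W inp splitEdge s fun s' τ =>
      SameOff [aLen, aPos, aPar, aLink, aKey, aVal] s'.arr s.arr ∧ s'.carr = s.carr ∧
      s'.creg = s.creg ∧
      SameOff [rQ, rLocus, rOwner, rKey, rValue, rEntry, rLoc, rBits, rFound, rCount]
        s'.reg s.reg ∧
      s'.reg rQ = 2 * n + 1 ∧ s'.reg rLocus = z ∧ s'.reg rCount ≤ s.reg rCount + 3 ∧
      s'.arr aLen = Function.update (s.arr aLen) (2 * n + 1) h ∧
      s'.arr aPos = Function.update (s.arr aPos) (2 * n + 1) (s.arr aPos z) ∧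
      s'.arr aPar = Function.update (Function.update (s.arr aPar) (2 * n + 1) (s.arr aPar z)) z
        (2 * n + 1) ∧
      τ ≤ 120 * (Nat.log 2 σ + 2) + 300 ∧
      ∃ F', HasDict s'.arr (s'.reg rCount) σ F' ∧
        Tree (s.arr aX) n (IsNode (s.arr aX) (n + 1)) (s'.arr aLen) (s'.arr aPos) (s'.arr aPar) F'
          (insert (2 * n + 1) V) := by
  have hu : 2 * n + 1 ∉ V := fun h => by have := hV _ h; omega
  have hT' := hT.split_head hh hzV hz0 hh1 hh2 ha hy hyl hya hu
  have hzn := hV _ hzV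
  have hyn := hV _ hy
  have hbV := hT.par_mem z hzV hz0
  have hbn := hV _ hbV
  have hzp := (hT.node z hzV).le
  have hzpn := hT.pos_le z hzV
  have hzu : z ≠ 2 * n + 1 := by omega
  rw [splitEdge]
  simp only [wp_seq]
  simp [hn, hz, hb, hH]
  refine ⟨by omega, by omega, by omega, by omega, by omega, ?_⟩
  refine WP.mono (setAt_spec (σ := σ) (F := F) (vo := 2 * s.arr aPar z)
    (vk := s.arr aX (n - s.arr aLen (s.arr aPar z))) (vv := 2 * n + 1)
    (hD.congr (by simp) (by simp) (by simp))
    ⟨by simp [hb]; omega, by simp [hb]⟩ ⟨by simp [hn, hLB]; omega, by simp [hn, hLB]⟩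
    ⟨by simp, by simp⟩ (by simp) (hX _ (by omega)) (by omega) (by omega) (by simp; omega) hAW
    (by omega) (by omega)) ?_
  rintro s1 t1 ⟨a1, a2, a3, a4, a5, a6, a7⟩
  simp at a2 a3 a5
  have r1 : SameOff [rQ, rOwner, rKey, rValue, rEntry, rLoc, rBits, rFound, rCount]
      s1.reg s.reg := (a4.mono (by simp)).trans (by simp)
  have q1 : s1.reg rQ = 2 * n + 1 := by rw [a4 _ (by simp)]; simp
  have x1 : s1.arr aX = s.arr aX := by rw [a1 _ (by simp)]; simp
  have l1 : s1.arr aLen = Function.update (s.arr aLen) (2 * n + 1) h := by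
    rw [a1 _ (by simp)]; simp
  have p1 : s1.arr aPos = Function.update (s.arr aPos) (2 * n + 1) (s.arr aPos z) := by
    rw [a1 _ (by simp)]; simp
  have f1 : s1.arr aPar = Function.update (Function.update (s.arr aPar) (2 * n + 1)
      (s.arr aPar z)) z (2 * n + 1) := by
    rw [a1 _ (by simp)]; simp
  have z1 : s1.reg rZ = z := (r1 _ (by simp)).trans hz
  have h1 : s1.reg rH = h := (r1 _ (by simp)).trans hH
  have y1 : s1.reg rY = y := (r1 _ (by simp)).trans hY
  have i1 : s1.reg rId = s.reg rId := r1 _ (by simp)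
  refine WP.mono (setAt_spec (σ := σ) (vo := 2 * (2 * n + 1))
    (vk := s.arr aX (s.arr aPos z - 1 - h)) (vv := z) a6
    ⟨by simp [q1]; omega, by simp [q1]⟩
    ⟨by simp [z1, h1, x1, p1, Function.update_of_ne hzu]; omega,
      by simp [z1, h1, x1, p1, Function.update_of_ne hzu]⟩
    ⟨by simp [z1], by simp [z1]⟩ (by simp) (hX _ (by omega)) hz0 (by omega) (by omega) hAW
    (by omega) (by omega)) ?_
  rintro s2 t2 ⟨b1, b2, b3, b4, b5, b6, b7⟩
  have q2 : s2.reg rQ = 2 * n + 1 := by rw [b4 _ (by simp), q1]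
  have y2 : s2.reg rY = y := by rw [b4 _ (by simp), y1]
  have i2 : s2.reg rId = s.reg rId := by rw [b4 _ (by simp), i1]
  refine WP.mono (setAt_spec (σ := σ) (vo := 2 * y + 1) (vk := s.arr aX n) (vv := 2 * n + 1) b6
    ⟨by simp [y2]; omega, by simp [y2]⟩ ⟨by simp [i2], by simp [i2, hx]⟩
    ⟨by simp [q2], by simp [q2]⟩ (by simp) (hX _ (by omega)) (by omega) (by omega) (by omega) hAW
    (by omega) (by omega)) ?_
  rintro s3 t3 ⟨c1, c2, c3, c4, c5, c6, c7⟩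
  have hreg : SameOff [rQ, rOwner, rKey, rValue, rEntry, rLoc, rBits, rFound, rCount]
      s3.reg s.reg := (c4.mono (by simp)).trans ((b4.mono (by simp)).trans r1)
  have harr : SameOff [aLink, aKey, aVal] s3.arr s1.arr := c1.trans b1
  have l3 := (harr aLen (by simp)).trans l1
  have p3 := (harr aPos (by simp)).trans p1
  have f3 := (harr aPar (by simp)).trans f1
  have z3 : s3.reg rZ = z := (hreg _ (by simp)).trans hz
  simp [z3]
  refine ⟨(harr.mono (by simp)).trans ((a1.mono (by simp)).trans (by simp)), by rw [c2, b2, a2],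
    by rw [c3, b3, a3], hreg.mono (by simp), ?_, by omega, l3, p3, f3, by omega, _, c6, ?_⟩
  · rw [c4 _ (by simp), q2]
  · rw [l3, p3, f3]
    exact hT'

end

section

variable {α : Type*} [LinearOrder α] {A W : ℕ} {inp : List α} {s : State α}
  {n σ : ℕ} {F : ℕ → ℕ → ℕ} {V : Set ℕ}

theorem locate_spec (hn : s.reg rN = n) {sp : ℕ} (hsp : s.reg rSp = sp)
    (hT : Tree (s.arr aX) n (IsNode (s.arr aX) n) (s.arr aLen) (s.arr aPos) (s.arr aPar) F V)
    (hD : HasDict s.arr (s.reg rCount) σ F) (hV : ∀ v ∈ V, v ≤ 2 * n)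
    (hx : s.arr aX n = s.reg rId) (hX : ∀ i ≤ n, s.arr aX i ≤ σ) (hσ : σ ≤ n + 1)
    (hE : s.reg rCount ≤ 5 * n) (hb : s.reg rB ∈ V)
    (hW : Tree.Walk (s.arr aX) n (s.arr aLen) (s.arr aPos) F V (s.arr aX n) (s.arr aStack) sp
      (s.arr aLen (s.reg rB)))
    (ha : Agree (s.arr aX) (s.arr aLen (s.reg rB)) (n + 1) (s.arr aPos (s.reg rB)))
    (hspn : sp ≤ n + 1) (hA : 100 * (n + 2) ≤ A) (hAW : A ≤ W) :
    WP A W inp locate s fun s' τ =>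
      SameOff [aLen, aPos, aPar, aLink, aKey, aVal] s'.arr s.arr ∧ s'.carr = s.carr ∧
      s'.creg = s.creg ∧
      SameOff [rQ, rLocus, rOwner, rKey, rValue, rEntry, rLoc, rBits, rFound, rCount, rLB, rZ, rSp,
        rY, rH] s'.reg s.reg ∧
      τ ≤ (sp + 1) * 40 + 160 * (Nat.log 2 σ + 2) + 400 ∧
      s'.reg rCount ≤ s.reg rCount + 3 ∧
      IsHead (s.arr aX) n (s'.reg rH) ∧
      (s'.reg rLocus ∈ V ∧
        Agree (s.arr aX) (s'.reg rH) (n + 1) (s.arr aPos (s'.reg rLocus)) ∧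
        s'.reg rH ≤ s.arr aLen (s'.reg rLocus) ∧
        (s'.reg rLocus ≠ 0 → s.arr aLen (s.arr aPar (s'.reg rLocus)) < s'.reg rH)) ∧
      (∀ v ∈ V, s'.arr aLen v = s.arr aLen v ∧ s'.arr aPos v = s.arr aPos v ∧
        (v ≠ s'.reg rLocus → s'.arr aPar v = s.arr aPar v)) ∧
      ∃ F' V', HasDict s'.arr (s'.reg rCount) σ F' ∧ V ⊆ V' ∧ (∀ v ∈ V', v ≤ 2 * n + 1) ∧
        s'.reg rQ ∈ V' ∧ s'.arr aLen (s'.reg rQ) = s'.reg rH ∧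
        Agree (s.arr aX) (s'.reg rH) (n + 1) (s'.arr aPos (s'.reg rQ)) ∧
        Tree (s.arr aX) n (IsNode (s.arr aX) (n + 1)) (s'.arr aLen) (s'.arr aPos) (s'.arr aPar) F'
          V' := by
  obtain ⟨h, hh⟩ := exists_isHead (s.arr aX) n
  have hhn := hh.le
  have hbh := hh.le_of_agree (hT.pos_le _ hb) ha
  have hbn := hV _ hb
  rw [locate]
  simp only [wp_seq]
  simp [hn]
  refine ⟨by omega, by omega, by omega, ?_⟩
  refine WP.mono (find_spec (σ := σ) (F := F) (hD.congr rfl rfl rfl) ?_ ?_ ?_ hAW (by omega)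
    (by omega)) ?_
  · simpa using hX _ (by omega)
  · simp; omega
  · simp; omega
  rintro s1 t1 ⟨a1, a2, a3, a4, a5, a6⟩
  simp at a1 a2 a3 a5
  rw [wp_branch]
  obtain ⟨z, hz⟩ : ∃ z, z = s1.reg rFound := ⟨_, rfl⟩
  rw [← hz] at a5
  obtain ⟨b, hbdef⟩ : ∃ b, b = s.reg rB := ⟨_, rfl⟩
  rw [← hbdef] at hb hW ha hbh hbn a5
  have r1 : SameOff [rLB, rOwner, rKey, rEntry, rLoc, rBits, rFound] s1.reg s.reg :=
    (a4.mono (by simp)).trans (by simp)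
  have n1 : s1.reg rN = n := (r1 _ (by simp)).trans hn
  have b1 : s1.reg rB = b := (r1 _ (by simp)).trans hbdef.symm
  have lb1 : s1.reg rLB = s.arr aLen b := by rw [a4 _ (by simp)]; simp [hbdef]
  simp [← hz, b1, lb1]
  refine ⟨fun hz0 => ?_, fun hz0 => ?_⟩
  · obtain ⟨z1, z2, z3, z4, z5, z6⟩ := hW.of_child_ne_zero hT hb ha hh a5.symm hz0
    have hzp := (hT.node z z1).le
    refine WP.mono (scan_spec (n := n) (V := V) (F := F) (h := h) (z := z) (sp := sp) ?_ ?_ ?_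
      (by simpa [a1] using hW) (by simpa [a1] using hh) (by simpa [a1] using z5)
      (by simpa [a1] using hT.pos_le z z1) (by simp [a1]; omega) (by simpa [a1] using z6) hspn hV
      (hV _ z1) hA hAW) ?_
    · simp [n1]
    · simp
    · simp [r1 _, hsp]
    rintro s2 t2 ⟨c1, c2, c3, c4, c5, c6, c7, c8, c9⟩
    simp [a1] at c1 c2 c3 c6 c7 c8
    have r2 : SameOff [rLB, rOwner, rKey, rEntry, rLoc, rBits, rFound, rZ, rSp, rY, rH]
        s2.reg s.reg := (c4.mono (by simp)).trans (by simpa using r1.mono (by simp))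
    have e2 : s2.reg rCount = s.reg rCount := r2 _ (by simp)
    refine WP.mono (splitEdge_spec (n := n) (z := z) (y := s2.reg rY) (h := h) (F := F) (V := V)
      (σ := σ) ((r2 _ (by simp)).trans hn) ?_ (by simpa [c1] using hT) ?_ hV ?_
      (by simpa [c1] using hX) hσ (by omega) (by simpa [c1] using hh) z1 hz0 ?_ ?_
      (by simpa [c1, z2] using z3) (by simpa [c1] using z4) (by simpa [c1] using z5) c5 rfl c6
      (by simpa [c1] using c7) (by simpa [c1] using c8) hA hAW) ?_
    · rw [c4 _ (by simp)]; simp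
    · rw [c1, e2]; exact hD
    · rw [c1, hx]; exact (r2 _ (by simp)).symm
    · rw [c1, z2, hbdef]; exact r2 _ (by simp)
    · rw [c1, z2, c4 _ (by simp)]; simp [lb1]
    rintro s3 t3 ⟨d1, d2, d3, d4, d5, d6, d7, d8, d9, f1, f2, F', f3, f4⟩
    rw [c1] at d1 d8 d9 f1 f4
    have h3 : s3.reg rH = h := by rw [d4 _ (by simp), c5]
    have hne : ∀ v ∈ V, v ≠ 2 * n + 1 := fun v hv => by have := hV _ hv; omega
    rw [h3, d5, d6]
    refine ⟨d1, d2.trans (c2.trans a2), d3.trans (c3.trans a3),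
      (d4.mono (by simp)).trans (r2.mono (by simp)), by omega, by omega, hh,
      ⟨z1, z5, z4.le, fun _ => by rw [z2]; exact z3⟩, ?_, F', f3, _, Set.subset_insert _ _, ?_,
      Set.mem_insert _ _, by rw [d8, Function.update_self], by rwa [d9, Function.update_self], f4⟩
    · intro v hv
      rw [d8, d9, f1, Function.update_of_ne (hne v hv), Function.update_of_ne (hne v hv)]
      refine ⟨rfl, rfl, fun hvz => ?_⟩
      rw [Function.update_of_ne hvz, Function.update_of_ne (hne v hv)]
    · rintro v (rfl | hv)
      · omega
      · have := hV v hv; omega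
  · have hb' := Tree.Walk.eq_of_child_eq_zero hT hb ha hh (a5.symm.trans hz0)
    rw [hb'] at hh
    have a4' : s1.reg rCount = s.reg rCount := r1 _ (by simp)
    simp [a1, a2, a3, a4', b1]
    refine ⟨r1.mono (by simp), by omega, hh, ⟨hb, ha, fun hb0 => hT.par_lt b hb hb0⟩, F, hD, V,
      subset_rfl, fun v hv => by have := hV v hv; omega, hb, ha, ?_⟩
    exact hT.congr_head hb ha hh

theorem newLeaf_spec (hn : s.reg rN = n)
    (hT : Tree (s.arr aX) n (IsNode (s.arr aX) (n + 1)) (s.arr aLen) (s.arr aPos) (s.arr aPar) F V)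
    (hD : HasDict s.arr (s.reg rCount) σ F) (hV : ∀ v ∈ V, v ≤ 2 * n + 1)
    (hs : 2 * n ∈ V ∧ s.arr aLen (2 * n) = n ∧ s.arr aPos (2 * n) = n)
    (hx : s.arr aX n = s.reg rId) (hX : ∀ i ≤ n, s.arr aX i ≤ σ) (hσ : σ ≤ n + 1)
    (hE : s.reg rCount ≤ 5 * n + 3) (hq : s.reg rQ ∈ V)
    (hql : s.arr aLen (s.reg rQ) = s.reg rH)
    (hqa : Agree (s.arr aX) (s.reg rH) (n + 1) (s.arr aPos (s.reg rQ)))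
    (hh : IsHead (s.arr aX) n (s.reg rH))
    (hA : 100 * (n + 2) ≤ A) (hAW : A ≤ W) :
    WP A W inp newLeaf s fun s' τ =>
      SameOff [aLen, aPos, aPar, aLink, aKey, aVal] s'.arr s.arr ∧ s'.carr = s.carr ∧
      s'.creg = s.creg ∧
      SameOff [rLeaf, rOwner, rKey, rValue, rEntry, rLoc, rBits, rFound, rCount] s'.reg s.reg ∧
      τ ≤ 80 * (Nat.log 2 σ + 2) + 200 ∧
      s'.reg rCount ≤ s.reg rCount + 2 ∧
      s'.arr aLen = Function.update (s.arr aLen) (2 * n + 2) (n + 1) ∧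
      s'.arr aPos = Function.update (s.arr aPos) (2 * n + 2) (n + 1) ∧
      s'.arr aPar = Function.update (s.arr aPar) (2 * n + 2) (s.reg rQ) ∧
      ∃ F', HasDict s'.arr (s'.reg rCount) σ F' ∧
        Tree (s.arr aX) (n + 1) (IsNode (s.arr aX) (n + 1)) (s'.arr aLen) (s'.arr aPos)
          (s'.arr aPar) F' (insert (2 * n + 2) V) := by
  have hu : 2 * n + 2 ∉ V := fun h => by have := hV _ h; omega
  have hT' := hT.addLeaf_head hq (hql ▸ hqa) (hql ▸ hh) hs.1 hs.2.2 hs.2.1 hu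
  rw [hql] at hT'
  have hqn := hV _ hq
  rw [newLeaf]
  simp only [wp_seq]
  simp [hn]
  refine ⟨by omega, by omega, by omega, ?_⟩
  refine WP.mono (setAt_spec (σ := σ) (F := F) (vo := 2 * s.reg rQ)
    (vk := s.arr aX (n - s.reg rH)) (vv := 2 * n + 2)
    (hD.congr (by simp) (by simp) (by simp))
    ⟨by simp; omega, by simp⟩ ⟨by simp [hn]; omega, by simp [hn]⟩
    ⟨by simp, by simp⟩ (by simp) (hX _ (by omega)) (by omega) (by omega) (by simp; omega) hAW
    (by omega) (by omega)) ?_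
  rintro s1 t1 ⟨a1, a2, a3, a4, a5, a6, a7⟩
  simp at a2 a3 a5
  have r1 : SameOff [rLeaf, rOwner, rKey, rValue, rEntry, rLoc, rBits, rFound, rCount]
      s1.reg s.reg := (a4.mono (by simp)).trans (by simp)
  have n1 : s1.reg rN = n := (r1 _ (by simp)).trans hn
  have i1 : s1.reg rId = s.reg rId := r1 _ (by simp)
  have u1 : s1.reg rLeaf = 2 * n + 2 := by rw [a4 _ (by simp)]; simp
  refine WP.mono (setAt_spec (σ := σ) (vo := 2 * (2 * n) + 1) (vk := s.arr aX n)
    (vv := 2 * n + 2) a6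
    ⟨by simp [n1]; omega, by simp [n1]⟩ ⟨by simp [i1], by simp [i1, hx]⟩
    ⟨by simp [u1], by simp [u1]⟩ (by simp) (hX _ (by omega)) (by omega) (by omega) (by omega) hAW
    (by omega) (by omega)) ?_
  rintro s2 t2 ⟨b1, b2, b3, b4, b5, b6, b7⟩
  have harr : SameOff [aLink, aKey, aVal] s2.arr s1.arr := b1
  have l2 : s2.arr aLen = Function.update (s.arr aLen) (2 * n + 2) (n + 1) := by
    rw [b1 _ (by simp), a1 _ (by simp)]; simp
  have p2 : s2.arr aPos = Function.update (s.arr aPos) (2 * n + 2) (n + 1) := by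
    rw [b1 _ (by simp), a1 _ (by simp)]; simp
  have f2 : s2.arr aPar = Function.update (s.arr aPar) (2 * n + 2) (s.reg rQ) := by
    rw [b1 _ (by simp), a1 _ (by simp)]; simp
  refine ⟨(b1.mono (by simp)).trans ((a1.mono (by simp)).trans (by simp)), by rw [b2, a2],
    by rw [b3, a3], (b4.mono (by simp)).trans r1, by omega, by omega, l2, p2, f2, _, b6, ?_⟩
  rw [l2, p2, f2]
  exact hT'

end

/-! ### The update program: net frequencies -/

/-- The number of suffixes below `N` that are counted at the node `v`. -/
def countOn (on : ℕ → ℕ) (N v : ℕ) : ℕ := ((Finset.range N).filter fun k => on k = v + 1).card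

theorem countOn_le (on : ℕ → ℕ) (N v : ℕ) : countOn on N v ≤ N :=
  (Finset.card_filter_le _ _).trans (by simp)

theorem countOn_update {on : ℕ → ℕ} {N k : ℕ} (hk : k < N) (h0 : on k = 0) (v w : ℕ) :
    countOn (Function.update on k (w + 1)) N v = countOn on N v + if v = w then 1 else 0 := by
  unfold countOn
  split_ifs with h
  · subst h
    have : (Finset.range N).filter (fun i => Function.update on k (v + 1) i = v + 1) =
        insert k ((Finset.range N).filter fun i => on i = v + 1) := by
      ext i
      by_cases hi : i = k
      · subst hi; simp [hk]
      · simp [hi]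
    rw [this, Finset.card_insert_of_notMem (by simp [h0])]
  · refine (congrArg Finset.card ?_).trans (Nat.add_zero _).symm
    ext i
    by_cases hi : i = k
    · subst hi; simp [h0, Ne.symm h]
    · simp [hi]

theorem countOn_clear {on : ℕ → ℕ} {N k w : ℕ} (hk : k < N) (hw : on k = w + 1) (v : ℕ) :
    countOn (Function.update on k 0) N v = countOn on N v - if v = w then 1 else 0 := by
  have h := countOn_update (on := Function.update on k 0) hk (by simp) v w
  rw [Function.update_idem, ← hw, Function.update_eq_self] at h
  omega

open NetFreq.Expr NetFreq.Cmd in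
/-- Update the contribution of the suffix `rK` to the net frequencies. -/
def refresh : Cmd :=
  branch (get aOn (reg rK))
    (rV ≔ get aOn (reg rK) -. lit 1 ;;
     store aPhi (reg rV) (get aPhi (reg rV) -. lit 1) ;;
     store aOn (reg rK) (lit 0)) skip ;;
  branch ((reg rK <. reg rN) *. ((get aEll (reg rK) <. reg rK) *.
      (get aEll (reg rK +. lit 1) <. get aEll (reg rK) +. lit 1)))
    (rV ≔ get aPar (lit 2 *. reg rK) ;;
     store aOn (reg rK) (reg rV +. lit 1) ;;
     store aPhi (reg rV) (get aPhi (reg rV) +. lit 1)) skip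

open NetFreq.Expr NetFreq.Cmd in
/-- Update the lengths of the longest repeated prefixes of the suffixes. Afterwards `rJ` is the old
suffix for which it changed, if there is one. -/
def setEll : Cmd :=
  rJ ≔ reg rN ;;
  branch ((reg rLocus %. lit 2 =. lit 0) *.
      (get aEll (reg rLocus /. lit 2) <. reg rLocus /. lit 2))
    (rJ ≔ reg rLocus /. lit 2 ;; store aEll (reg rJ) (reg rH)) skip ;;
  store aEll (reg rN +. lit 1) (reg rH)

section

variable {α : Type*} [LinearOrder α] {A W : ℕ} {inp : List α} {s : State α}

theorem refresh_spec {k n N : ℕ} (hk : s.reg rK = k) (hn : s.reg rN = n)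
    (hphi : ∀ v, s.arr aPhi v = countOn (s.arr aOn) N v) (hkN : k < N) (hon : s.arr aOn k ≤ A)
    (hpar : 0 < k → s.arr aPar (2 * k) + 1 < A) (hell : s.arr aEll k + 1 < W) (hN : N + 1 < W)
    (hkA : 2 * k + 1 < A) (hAW : A ≤ W) :
    WP A W inp refresh s fun s' τ =>
      SameOff [aOn, aPhi] s'.arr s.arr ∧ s'.carr = s.carr ∧ s'.creg = s.creg ∧
      SameOff [rV] s'.reg s.reg ∧
      s'.arr aOn = Function.update (s.arr aOn) k
        (if k < n ∧ s.arr aEll k < k ∧ s.arr aEll (k + 1) ≤ s.arr aEll k then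
          s.arr aPar (2 * k) + 1 else 0) ∧
      (∀ v, s'.arr aPhi v = countOn (s'.arr aOn) N v) ∧ τ ≤ 100 := by
  have hW : 2 < W := by omega
  rw [refresh, wp_seq]
  refine WP.mono (R := _) (Q := fun s1 t1 => SameOff [aOn, aPhi] s1.arr s.arr ∧
    s1.carr = s.carr ∧ s1.creg = s.creg ∧ SameOff [rV] s1.reg s.reg ∧
    s1.arr aOn = Function.update (s.arr aOn) k 0 ∧
    (∀ v, s1.arr aPhi v = countOn (s1.arr aOn) N v) ∧ t1 ≤ 40) ?_ ?_
  · rw [wp_branch]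
    simp [hk]
    refine ⟨by omega, fun h0 => ?_, fun h0 => ?_⟩
    · obtain ⟨w, hw⟩ : ∃ w, s.arr aOn k = w + 1 := ⟨s.arr aOn k - 1, by omega⟩
      have hp := hphi w
      have hle := countOn_le (s.arr aOn) N w
      simp only [hw, Nat.add_sub_cancel]
      refine ⟨by omega, ⟨by omega, by omega⟩, by omega, fun v => ?_⟩
      rw [countOn_clear hkN hw, ← hphi]
      by_cases hv : v = w
      · subst hv; simp
      · simp [hv]
    · exact ⟨by omega, hphi⟩
  rintro s1 t1 ⟨a1, a2, a3, a4, a5, a6, a7⟩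
  have k1 : s1.reg rK = k := (a4 _ (by simp)).trans hk
  have n1 : s1.reg rN = n := (a4 _ (by simp)).trans hn
  have e1 : s1.arr aEll = s.arr aEll := a1 _ (by simp)
  have p1 : s1.arr aPar = s.arr aPar := a1 _ (by simp)
  rw [wp_branch]
  simp [k1, n1, e1, p1, Nat.lt_succ_iff]
  refine ⟨by split_ifs <;> omega, ?_, ?_⟩
  · intro c3 c2 c1
    have hpar := hpar (by omega)
    have hle := countOn_le (s1.arr aOn) N (s.arr aPar (2 * k))
    rw [← a6] at hle
    refine ⟨by omega, by omega, by omega, a1, a2, a3, a4, ?_, ?_, by omega⟩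
    · rw [if_pos ⟨c1, c2, c3⟩, a5, Function.update_idem]
    · intro v
      rw [countOn_update hkN (by rw [a5]; simp), ← a6]
      by_cases hv : v = s.arr aPar (2 * k)
      · subst hv; simp
      · simp [hv]
  · intro hc
    refine ⟨a1, a2, a3, a4, ?_, a6, by omega⟩
    rw [if_neg fun h => by have := hc h.2.2 h.2.1; omega, a5]

theorem setEll_spec {n : ℕ} (hn : s.reg rN = n) (hl : s.reg rLocus ≤ 2 * n)
    (hA : 2 * n + 5 < A) (hAW : A ≤ W) :
    WP A W inp setEll s fun s' τ =>
      SameOff [aEll] s'.arr s.arr ∧ s'.carr = s.carr ∧ s'.creg = s.creg ∧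
      SameOff [rJ] s'.reg s.reg ∧ s'.reg rJ ≤ n ∧ s'.arr aEll (n + 1) = s.reg rH ∧
      (∀ k ≤ n, s'.arr aEll k =
        if s.reg rLocus = 2 * k ∧ s.arr aEll k < k then s.reg rH else s.arr aEll k) ∧
      (∀ k ≤ n, s.reg rLocus = 2 * k → s.arr aEll k < k → s'.reg rJ = k) ∧ τ ≤ 100 := by
  obtain ⟨y, hy⟩ : ∃ y, y = s.reg rLocus := ⟨_, rfl⟩
  rw [← hy] at hl
  rw [setEll]
  simp only [wp_seq]
  simp [hn, ← hy]
  rw [wp_branch]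
  simp [hn, ← hy]
  refine ⟨by split_ifs <;> omega, ?_, ?_⟩
  · intro h2 h1
    obtain ⟨j, rfl⟩ : ∃ j, y = 2 * j := ⟨y / 2, by omega⟩
    rw [Nat.mul_div_cancel_left j (by omega)] at h2 ⊢
    refine ⟨by omega, by omega, by omega, by omega, fun k hk => ?_, fun k hk h3 h4 => by omega⟩
    rw [Function.update_of_ne (by omega)]
    by_cases hkj : k = j
    · subst hkj; simp [h2]
    · rw [Function.update_of_ne hkj, if_neg (by omega)]
  · intro hc
    have hc' : ∀ k, ¬ (y = 2 * k ∧ s.arr aEll k < k) := by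
      rintro k ⟨rfl, h⟩
      rw [Nat.mul_div_cancel_left k (by omega)] at hc
      have := hc h
      omega
    refine ⟨⟨by omega, by omega⟩, fun k hk => ?_, fun k hk h1 h2 => absurd ⟨h1, h2⟩ (hc' k)⟩
    rw [Function.update_of_ne (by omega), if_neg (hc' k)]

end

/-! ### The update program and its invariant -/

open NetFreq.Expr NetFreq.Cmd in
/-- Store the number of the arriving character. -/
def readChar : Cmd :=
  inputChar cInput (lit 0) ;; charNumber ;; store aX (reg rN) (reg rId)

/-- Extend the suffix tree by the new suffix. -/
def growTree : Cmd := walk ;; locate ;; newLeaf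

open NetFreq.Expr NetFreq.Cmd in
/-- Adjust the net frequencies. The contribution of suffix `k` depends on the longest repeated
prefixes of the suffixes `k` and `k + 1`, so it can only change for the suffix `rJ` whose longest
repeated prefix changed, for the next shorter one, and for the suffix just below the new one. -/
def recount : Cmd :=
  setEll ;;
  rN ≔ reg rN +. lit 1 ;;
  rK ≔ reg rJ ;;
  refresh ;;
  rK ≔ reg rJ -. lit 1 ;;
  refresh ;;
  rK ≔ reg rN -. lit 1 ;;
  refresh

/-- The update program. -/
def update : Cmd := readChar ;; growTree ;; recount

/-- The memory represents the string whose characters arrived in the order `R`: it holds the search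
tree of the characters, the string, its suffix tree with the leaf `2 * k` for the suffix `k`, the
longest repeated prefixes, and for every node the number of suffixes that contribute to its net
frequency. -/
structure Core {α : Type*} [LinearOrder α] (s : State α) (R : List α) : Prop where
  n_eq : s.reg rN = R.length
  alphabet : ∃ t, Alphabet (s.arr aChild) (s.arr aHeight) (s.carr aChar) (s.reg rRoot)
    (s.reg rSigma) t
  id_mem : ∀ i < R.length, 1 ≤ s.arr aX i ∧ s.arr aX i ≤ s.reg rSigma
  id_key : ∀ i (hi : i < R.length), s.carr aChar (s.arr aX i) = (R[i] : WithBot α)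
  used : ∀ c, 1 ≤ c → c ≤ s.reg rSigma → ∃ i < R.length, s.arr aX i = c
  count_le : s.reg rCount ≤ 5 * R.length
  tree : ∃ F V, HasDict s.arr (s.reg rCount) (s.reg rSigma) F ∧
    Tree (s.arr aX) R.length (IsNode (s.arr aX) R.length) (s.arr aLen) (s.arr aPos) (s.arr aPar)
      F V ∧ (∀ v ∈ V, v ≤ 2 * R.length) ∧
    ∀ k ≤ R.length, 2 * k ∈ V ∧ s.arr aLen (2 * k) = k ∧ s.arr aPos (2 * k) = k
  ell : ∀ k ≤ R.length, IsEll (s.arr aX) R.length k (s.arr aEll k)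
  on : ∀ k, s.arr aOn k = if k < R.length ∧ s.arr aEll k < k ∧
    s.arr aEll (k + 1) ≤ s.arr aEll k then s.arr aPar (2 * k) + 1 else 0
  phi : ∀ v, s.arr aPhi v = countOn (s.arr aOn) R.length v

section

variable {α : Type*} [LinearOrder α] {A W : ℕ} {inp : List α} {s : State α} {R : List α}
  {n σ : ℕ} {F : ℕ → ℕ → ℕ} {V : Set ℕ}

theorem HasDict.mono {arr : ℕ → ℕ → ℕ} {E σ' : ℕ} (hD : HasDict arr E σ F) (h : σ ≤ σ') :
    HasDict arr E σ' F := ⟨hD.1, fun e he => (hD.2 e he).trans h⟩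

theorem Core.sigma_le (hC : Core s R) : s.reg rSigma ≤ R.length := by
  have h : Finset.Icc 1 (s.reg rSigma) ⊆ (Finset.range R.length).image (s.arr aX) := by
    intro c hc
    rw [Finset.mem_Icc] at hc
    obtain ⟨i, hi, he⟩ := hC.used c hc.1 hc.2
    exact Finset.mem_image.2 ⟨i, by simpa using hi, he⟩
  have h1 := (Finset.card_le_card h).trans Finset.card_image_le
  simpa using h1

theorem readChar_spec (hC : Core s R) (a : α) (hA : 100 * (R.length + 2) ≤ A) (hAW : A ≤ W) :
    WP A W [a] readChar s fun s' τ =>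
      SameOff [aChild, aHeight, aPathNode, aPathDir, aX] s'.arr s.arr ∧
      SameOff [rSigma, rId, rCmp, rSub, rDepth, rTop, rDir, rSib, rIn, rRoot] s'.reg s.reg ∧
      τ ≤ 700 * (Nat.log 2 (s.reg rSigma) + 2) + 20 ∧
      s.reg rSigma ≤ s'.reg rSigma ∧ s'.arr aX R.length = s'.reg rId ∧
      (∀ i < R.length, s'.arr aX i = s.arr aX i) ∧
      (∃ t, Alphabet (s'.arr aChild) (s'.arr aHeight) (s'.carr aChar) (s'.reg rRoot)
        (s'.reg rSigma) t) ∧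
      (∀ i < (R ++ [a]).length, 1 ≤ s'.arr aX i ∧ s'.arr aX i ≤ s'.reg rSigma) ∧
      (∀ i (hi : i < (R ++ [a]).length),
        s'.carr aChar (s'.arr aX i) = ((R ++ [a])[i] : WithBot α)) ∧
      (∀ c, 1 ≤ c → c ≤ s'.reg rSigma → ∃ i < (R ++ [a]).length, s'.arr aX i = c) := by
  obtain ⟨t, ht⟩ := hC.alphabet
  have hσ := hC.sigma_le
  rw [readChar]
  simp only [wp_seq]
  simp only [wp_inputChar]
  refine ⟨by simp; omega, ?_⟩
  refine WP.mono (charNumber_spec (t := t) (by simpa using ht) (by simp) (by omega) hAW) ?_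
  rintro s1 t1 ⟨a1, a2, a3, a4, a5, a6, a7, a8, a9⟩
  simp [inputAt] at a1 a2 a3 a5 a6 a8
  have n1 : s1.reg rN = R.length := (a3 _ (by simp)).trans hC.n_eq
  have x1 : s1.arr aX = s.arr aX := a1 _ (by simp)
  have hσ' : s.reg rSigma ≤ s1.reg rSigma := by omega
  have hXn : ∀ i < R.length, Function.update (s.arr aX) R.length (s1.reg rId) i = s.arr aX i :=
    fun i hi => Function.update_of_ne (by omega) _ _
  simp [n1, x1]
  refine ⟨by omega, a1.mono (by simp), a3, by omega, hσ', hXn, a9, ?_, ?_, ?_⟩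
  · intro i hi
    rcases Nat.lt_or_eq_of_le hi with hi | rfl
    · rw [hXn i hi]
      have := hC.id_mem i hi
      omega
    · rw [Function.update_self]
      exact a7
  · intro i hi
    rcases Nat.lt_or_eq_of_le hi with hi | rfl
    · rw [hXn i hi, a5 _ (hC.id_mem i hi).2, hC.id_key i hi, List.getElem_append_left hi]
    · rw [Function.update_self, a6]
      simp
  · intro c hc1 hc2
    by_cases hc : c ≤ s.reg rSigma
    · obtain ⟨i, hi, he⟩ := hC.used c hc1 hc
      exact ⟨i, by omega, by rw [hXn i hi, he]⟩
    · exact ⟨R.length, by omega, by rw [Function.update_self]; omega⟩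

theorem growTree_spec (hn : s.reg rN = n)
    (hT : Tree (s.arr aX) n (IsNode (s.arr aX) n) (s.arr aLen) (s.arr aPos) (s.arr aPar) F V)
    (hD : HasDict s.arr (s.reg rCount) σ F) (hV : ∀ v ∈ V, v ≤ 2 * n)
    (hs : ∀ k ≤ n, 2 * k ∈ V ∧ s.arr aLen (2 * k) = k ∧ s.arr aPos (2 * k) = k)
    (hx : s.arr aX n = s.reg rId) (hX : ∀ i ≤ n, s.arr aX i ≤ σ) (hσ : σ ≤ n + 1)
    (hE : s.reg rCount ≤ 5 * n) (hA : 100 * (n + 2) ≤ A) (hAW : A ≤ W) :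
    WP A W inp growTree s fun s' τ =>
      SameOff [aLen, aPos, aPar, aLink, aKey, aVal, aStack] s'.arr s.arr ∧ s'.carr = s.carr ∧
      s'.creg = s.creg ∧
      SameOff [rV, rCont, rB, rLeaf, rQ, rLocus, rOwner, rKey, rValue, rEntry, rLoc, rBits, rFound,
        rCount, rLB, rZ, rSp, rY, rH] s'.reg s.reg ∧
      s'.reg rCount ≤ s.reg rCount + 5 ∧
      IsHead (s.arr aX) n (s'.reg rH) ∧
      (s'.reg rLocus ∈ V ∧
        Agree (s.arr aX) (s'.reg rH) (n + 1) (s.arr aPos (s'.reg rLocus)) ∧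
        s'.reg rH ≤ s.arr aLen (s'.reg rLocus) ∧
        (s'.reg rLocus ≠ 0 → s.arr aLen (s.arr aPar (s'.reg rLocus)) < s'.reg rH)) ∧
      (∀ k ≤ n, 2 * k ≠ s'.reg rLocus → s'.arr aPar (2 * k) = s.arr aPar (2 * k)) ∧
      (∃ sp, sp + depth (s.arr aX) (n + 1) ≤ depth (s.arr aX) n + 3 ∧
        τ ≤ (sp + 1) * (40 * (Nat.log 2 σ + 2) + 80) + 240 * (Nat.log 2 σ + 2) + 700) ∧
      ∃ F' V', HasDict s'.arr (s'.reg rCount) σ F' ∧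
        Tree (s.arr aX) (n + 1) (IsNode (s.arr aX) (n + 1)) (s'.arr aLen) (s'.arr aPos)
          (s'.arr aPar) F' V' ∧ (∀ v ∈ V', v ≤ 2 * (n + 1)) ∧
        ∀ k ≤ n + 1, 2 * k ∈ V' ∧ s'.arr aLen (2 * k) = k ∧ s'.arr aPos (2 * k) = k := by
  rw [growTree]
  simp only [wp_seq]
  refine WP.mono (walk_spec hn hT hD hV (hs n le_rfl) hx (hx ▸ hX n le_rfl) hσ hE hA hAW) ?_
  rintro s1 t1 ⟨a1, a2, a3, a4, a5, a6, a7, a8, a9⟩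
  have x1 : s1.arr aX = s.arr aX := a1 _ (by simp)
  have l1 : s1.arr aLen = s.arr aLen := a1 _ (by simp)
  have p1 : s1.arr aPos = s.arr aPos := a1 _ (by simp)
  have f1 : s1.arr aPar = s.arr aPar := a1 _ (by simp)
  have e1 : s1.reg rCount = s.reg rCount := a4 _ (by simp)
  have i1 : s1.reg rId = s.reg rId := a4 _ (by simp)
  refine WP.mono (locate_spec (s := s1) (n := n) (F := F) (V := V) (σ := σ)
    ((a4 _ (by simp)).trans hn) rfl (by rwa [x1, l1, p1, f1])
    (by rw [e1]; exact hD.congr (a1 _ (by simp)) (a1 _ (by simp)) (a1 _ (by simp))) hV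
    (by rw [x1, i1, hx]) (by rwa [x1]) hσ (by omega) a5 (by rwa [x1, l1, p1]) (by rwa [x1, l1, p1])
    a8 hA hAW) ?_
  rintro s2 t2 ⟨b1, b2, b3, b4, b5, b6, b7, b8, b9, F', V', c1, c2, c3, c4, c5, c6, c7⟩
  rw [x1] at b7 b8 c6 c7
  rw [l1, p1, f1] at b8
  rw [l1, p1, f1] at b9
  have x2 : s2.arr aX = s.arr aX := (b1 _ (by simp)).trans x1
  have n2 : s2.reg rN = n := (b4 _ (by simp)).trans ((a4 _ (by simp)).trans hn)
  have i2 : s2.reg rId = s.reg rId := (b4 _ (by simp)).trans i1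
  obtain ⟨g1, g2, g3⟩ := hs n le_rfl
  refine WP.mono (newLeaf_spec (s := s2) (n := n) (F := F') (V := V') (σ := σ) n2
    (by rwa [x2]) c1 c3 ⟨c2 g1, by rw [(b9 _ g1).1, g2], by rw [(b9 _ g1).2.1, g3]⟩
    (by rw [x2, i2, hx]) (by rwa [x2]) hσ (by omega) c4 c5 (by rwa [x2]) (by rwa [x2]) hA hAW) ?_
  rintro s3 t3 ⟨d1, d2, d3, d4, d5, d6, d7, d8, d9, F'', e2, e3⟩
  rw [x2] at e3
  have h3 : s3.reg rH = s2.reg rH := d4 _ (by simp)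
  have y3 : s3.reg rLocus = s2.reg rLocus := d4 _ (by simp)
  rw [h3, y3]
  refine ⟨(d1.mono (by simp)).trans ((b1.mono (by simp)).trans (a1.mono (by simp))),
    by rw [d2, b2, a2], by rw [d3, b3, a3],
    (d4.mono (by simp)).trans ((b4.mono (by simp)).trans (a4.mono (by simp))), by omega, b7, b8, ?_,
    ⟨s1.reg rSp, a6.depth_le hT b7, ?_⟩, F'', _, e2, e3, ?_, ?_⟩
  · intro k hk hne
    rw [d9, Function.update_of_ne (by omega), (b9 _ (hs k hk).1).2.2 hne]
  · have : (s1.reg rSp + 1) * (40 * (Nat.log 2 σ + 2) + 80) =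
      (s1.reg rSp + 1) * (40 * (Nat.log 2 σ + 2) + 40) + (s1.reg rSp + 1) * 40 := by ring
    omega
  · rintro v (rfl | hv)
    · omega
    · have := c3 v hv; omega
  · intro k hk
    rw [d7, d8]
    rcases Nat.lt_or_eq_of_le hk with hk | rfl
    · obtain ⟨k1, k2, k3⟩ := hs k (by omega)
      rw [Function.update_of_ne (by omega), Function.update_of_ne (by omega), (b9 _ k1).1, k2,
        (b9 _ k1).2.1, k3]
      exact ⟨.inr (c2 k1), rfl, rfl⟩
    · rw [show 2 * (n + 1) = 2 * n + 2 by ring, Function.update_self, Function.update_self]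
      exact ⟨.inl rfl, rfl, rfl⟩

end

theorem countOn_succ {on : ℕ → ℕ} {n : ℕ} (h : on n = 0) (v : ℕ) :
    countOn on (n + 1) v = countOn on n v := by
  unfold countOn
  rw [Finset.range_add_one, Finset.filter_insert, if_neg (by omega)]

section

variable {α : Type*} [LinearOrder α] {A W : ℕ} {inp : List α} {s : State α} {R : List α}
  {n σ : ℕ} {F : ℕ → ℕ → ℕ} {V : Set ℕ}

theorem recount_spec (hn : s.reg rN = n) (hl : s.reg rLocus ≤ 2 * n) {par : ℕ → ℕ}
    (hon : ∀ k, s.arr aOn k = if k < n ∧ s.arr aEll k < k ∧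
      s.arr aEll (k + 1) ≤ s.arr aEll k then par (2 * k) + 1 else 0)
    (hpar : ∀ k ≤ n, 2 * k ≠ s.reg rLocus → s.arr aPar (2 * k) = par (2 * k))
    (hpA : ∀ k ≤ n, 0 < k → s.arr aPar (2 * k) + 1 < A) (honA : ∀ k, s.arr aOn k ≤ A)
    (hell : ∀ k ≤ n, s.arr aEll k ≤ k) (hh : s.reg rH ≤ n)
    (hphi : ∀ v, s.arr aPhi v = countOn (s.arr aOn) n v)
    (hA : 100 * (n + 2) ≤ A) (hAW : A ≤ W) :
    WP A W inp recount s fun s' τ =>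
      SameOff [aEll, aOn, aPhi] s'.arr s.arr ∧ s'.carr = s.carr ∧ s'.creg = s.creg ∧
      SameOff [rJ, rN, rK, rV] s'.reg s.reg ∧ s'.reg rN = n + 1 ∧
      s'.arr aEll (n + 1) = s.reg rH ∧
      (∀ k ≤ n, s'.arr aEll k =
        if s.reg rLocus = 2 * k ∧ s.arr aEll k < k then s.reg rH else s.arr aEll k) ∧
      (∀ k, s'.arr aOn k = if k < n + 1 ∧ s'.arr aEll k < k ∧
        s'.arr aEll (k + 1) ≤ s'.arr aEll k then s'.arr aPar (2 * k) + 1 else 0) ∧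
      (∀ v, s'.arr aPhi v = countOn (s'.arr aOn) (n + 1) v) ∧ τ ≤ 500 := by
  rw [recount]
  simp only [wp_seq]
  refine WP.mono (setEll_spec hn hl (by omega) hAW) ?_
  rintro s1 t1 ⟨a1, a2, a3, a4, a5, a6, a7, a8, a9⟩
  obtain ⟨j, hj⟩ : ∃ j, j = s1.reg rJ := ⟨_, rfl⟩
  rw [← hj] at a5 a8
  have n1 : s1.reg rN = n := (a4 _ (by simp)).trans hn
  obtain ⟨ell', hell'⟩ : ∃ f, f = s1.arr aEll := ⟨_, rfl⟩
  have on1 : s1.arr aOn = s.arr aOn := a1 _ (by simp)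
  have phi1 : s1.arr aPhi = s.arr aPhi := a1 _ (by simp)
  have par1 : s1.arr aPar = s.arr aPar := a1 _ (by simp)
  obtain ⟨w, hw⟩ : ∃ w : ℕ → ℕ, w = fun k => if k < n + 1 ∧ ell' k < k ∧ ell' (k + 1) ≤ ell' k then
    s.arr aPar (2 * k) + 1 else 0 := ⟨_, rfl⟩
  have hwA : ∀ k ≤ n, w k ≤ A := fun k hk => by
    rw [hw]
    dsimp only
    split_ifs with hc
    · have := hpA k hk (by omega)
      omega
    · omega
  have hellW : ∀ k ≤ n, ell' k + 1 < W := fun k hk => by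
    have := hell k hk
    rw [hell', a7 k hk]
    split_ifs <;> omega
  have hon0 : s.arr aOn n = 0 := by rw [hon, if_neg (by omega)]
  have hupd : ∀ {f : ℕ → ℕ} {k : ℕ}, (∀ i, f i ≤ A) → k ≤ n →
      ∀ i, Function.update f k (w k) i ≤ A := fun {f k} hf hk i => by
    by_cases hi : i = k
    · subst hi; simpa using hwA i hk
    · simpa [hi] using hf i
  simp [n1, ← hj]
  refine ⟨by omega, ?_⟩
  refine WP.mono (refresh_spec (k := j) (n := n + 1) (N := n + 1) (by simp) (by simp)
    (by simpa [on1, phi1, countOn_succ hon0] using hphi) (by omega) (by simpa [on1] using honA j)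
    (by simpa [par1] using hpA j a5) (by simpa [← hell'] using hellW j a5) (by omega) (by omega)
    hAW) ?_
  rintro s2 t2 ⟨b1, b2, b3, b4, b5, b6, b7⟩
  simp at b1 b2 b3
  simp [on1, par1, ← hell', ← hj] at b5
  have b5' : s2.arr aOn = Function.update (s.arr aOn) j (w j) := by
    rw [b5, hw]
    simp only [Nat.lt_succ_iff]
  have n2 : s2.reg rN = n + 1 := by rw [b4 _ (by simp)]; simp
  have j2 : s2.reg rJ = j := by rw [b4 _ (by simp)]; simp [hj]
  have ell2 : s2.arr aEll = ell' := (b1 _ (by simp)).trans hell'.symm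
  have par2 : s2.arr aPar = s.arr aPar := (b1 _ (by simp)).trans par1
  simp [j2]
  refine ⟨by omega, ?_⟩
  refine WP.mono (refresh_spec (k := j - 1) (n := n + 1) (N := n + 1) (by simp) (by simp [n2])
    (by simpa using b6) (by omega) (by simpa [b5'] using hupd honA a5 (j - 1))
    (by simpa [par2] using hpA (j - 1) (by omega)) (by simpa [ell2] using hellW (j - 1) (by omega))
    (by omega) (by omega) hAW) ?_
  rintro s3 t3 ⟨c1, c2, c3, c4, c5, c6, c7⟩
  simp at c1 c2 c3
  have c5' : s3.arr aOn = Function.update (Function.update (s.arr aOn) j (w j)) (j - 1)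
      (w (j - 1)) := by
    rw [c5, hw]
    simp [b5', hw, par2, ell2]
  have n3 : s3.reg rN = n + 1 := by rw [c4 _ (by simp)]; simp [n2]
  have ell3 : s3.arr aEll = ell' := (c1 _ (by simp)).trans ell2
  have par3 : s3.arr aPar = s.arr aPar := (c1 _ (by simp)).trans par2
  simp [n3]
  refine ⟨by omega, ?_⟩
  refine WP.mono (refresh_spec (k := n) (n := n + 1) (N := n + 1) (by simp) (by simp [n3])
    (by simpa using c6) (by omega)
    (by simpa [c5'] using hupd (hupd honA a5) (by omega : j - 1 ≤ n) n)
    (by simpa [par3] using hpA n le_rfl) (by simpa [ell3] using hellW n le_rfl)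
    (by omega) (by omega) hAW) ?_
  rintro s4 t4 ⟨d1, d2, d3, d4, d5, d6, d7⟩
  simp at d1 d2 d3
  have d5' : s4.arr aOn = Function.update (Function.update (Function.update (s.arr aOn) j (w j))
      (j - 1) (w (j - 1))) n (w n) := by
    rw [d5, hw]
    simp [c5', hw, par3, ell3]
  have ell4 : s4.arr aEll = ell' := (d1 _ (by simp)).trans ell3
  have par4 : s4.arr aPar = s.arr aPar := (d1 _ (by simp)).trans par3
  have harr : SameOff [aOn, aPhi] s4.arr s1.arr := d1.trans (c1.trans b1)
  have hreg : SameOff [rJ, rN, rK, rV] s4.reg s.reg := by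
    intro r hr
    simp at hr
    rw [d4 r (by simp; tauto)]
    simp [hr]
    rw [c4 r (by simp; tauto)]
    simp [hr]
    rw [b4 r (by simp; tauto)]
    simp [hr]
    exact a4 r (by simp; tauto)
  refine ⟨(harr.mono (by simp)).trans (a1.mono (by simp)), by rw [d2, c2, b2, a2],
    by rw [d3, c3, b3, a3], hreg, by rw [d4 _ (by simp)]; simp [n3], by rw [ell4, hell', a6], ?_,
    ?_, d6, by omega⟩
  · rw [ell4, hell']
    exact a7
  · intro k
    have hgoal : s4.arr aOn k = w k := by
      rw [d5']
      by_cases h1 : k = n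
      · rw [h1, Function.update_self]
      rw [Function.update_of_ne h1]
      by_cases h2 : k = j - 1
      · rw [h2, Function.update_self]
      rw [Function.update_of_ne h2]
      by_cases h3 : k = j
      · rw [h3, Function.update_self]
      rw [Function.update_of_ne h3, hon, hw]
      dsimp only
      by_cases hkn : k < n
      · have e1 : ell' k = s.arr aEll k := by
          rw [hell', a7 k hkn.le, if_neg]
          rintro ⟨h4, h5⟩
          exact h3 (a8 k hkn.le h4 h5).symm
        have e2 : ell' (k + 1) = s.arr aEll (k + 1) := by
          rw [hell', a7 (k + 1) hkn, if_neg]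
          rintro ⟨h4, h5⟩
          have := a8 (k + 1) hkn h4 h5
          omega
        rw [e1, e2]
        by_cases h4 : 2 * k = s.reg rLocus
        · have h5 : ¬ s.arr aEll k < k := fun h5 => h3 (a8 k hkn.le h4.symm h5).symm
          rw [if_neg (by tauto), if_neg (by tauto)]
        · rw [hpar k hkn.le h4]
          simp [hkn, show k < n + 1 by omega]
      · rw [if_neg (by omega), if_neg (by omega)]
    rw [hgoal, ell4, par4, hw]
    simp only [Nat.lt_succ_iff]

/-- The update program is correct, and its number of steps is bounded by a constant number of
dictionary operations and by the decrease of the depth of the current leaf. -/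
theorem update_spec (hC : Core s R) (a : α) (hA : 100 * (R.length + 2) ≤ A) (hAW : A ≤ W) :
    WP A W [a] update s fun s' τ => Core s' (R ++ [a]) ∧ s.reg rSigma ≤ s'.reg rSigma ∧
      τ + (Nat.log 2 (s'.reg rSigma) + 1) * (160 * depth (s'.arr aX) (R.length + 1)) ≤
        (Nat.log 2 (s'.reg rSigma) + 1) * (5000 + 160 * depth (s.arr aX) R.length) := by
  obtain ⟨n, hnR⟩ : ∃ n, n = R.length := ⟨_, rfl⟩
  obtain ⟨F, V, hD, hT, hV, hs⟩ := hC.tree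
  have hσn := hC.sigma_le
  have hCon := hC.on
  have hCphi := hC.phi
  have hCell := hC.ell
  have hCcount := hC.count_le
  have hCn := hC.n_eq
  have hlen : (R ++ [a]).length = n + 1 := by simp [hnR]
  rw [update]
  simp only [wp_seq]
  refine WP.mono (readChar_spec hC a hA hAW) ?_
  rintro s1 t1 ⟨a1, a2, a3, a4, a5, a6, a7, a8, a9, a10⟩
  rw [hlen] at a8 a10
  rw [← hnR] at hT hV hs hCon hCphi hCell hCcount hCn hA a5 a6 ⊢
  clear hC
  have hxy : ∀ i < n, s.arr aX i = s1.arr aX i := fun i hi => (a6 i hi).symm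
  have l1 : s1.arr aLen = s.arr aLen := a1 _ (by simp)
  have p1 : s1.arr aPos = s.arr aPos := a1 _ (by simp)
  have f1 : s1.arr aPar = s.arr aPar := a1 _ (by simp)
  have e1 : s1.reg rCount = s.reg rCount := a2 _ (by simp)
  have hσ1 : s1.reg rSigma ≤ n + 1 := by
    have h : Finset.Icc 1 (s1.reg rSigma) ⊆ (Finset.range (n + 1)).image (s1.arr aX) := by
      intro c hc
      rw [Finset.mem_Icc] at hc
      obtain ⟨i, hi, he⟩ := a10 c hc.1 hc.2
      exact Finset.mem_image.2 ⟨i, by simpa using hi, he⟩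
    have h1 := (Finset.card_le_card h).trans Finset.card_image_le
    simpa using h1
  have hT1 : Tree (s1.arr aX) n (IsNode (s1.arr aX) n) (s1.arr aLen) (s1.arr aPos) (s1.arr aPar)
      F V := by
    rw [l1, p1, f1]
    exact (hT.congr_str (isNode_invariant _ _) hxy).congr_pred fun k hk l => isNode_congr hxy
  refine WP.mono (growTree_spec (s := s1) (n := n) (σ := s1.reg rSigma) (F := F) (V := V)
    ((a2 _ (by simp)).trans hCn) hT1
    (by rw [e1]; exact (hD.mono a4).congr (a1 _ (by simp)) (a1 _ (by simp)) (a1 _ (by simp)))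
    hV (by rwa [l1, p1]) a5 (fun i hi => (a8 i (by omega)).2) hσ1 (by omega) hA hAW) ?_
  rintro s2 t2 ⟨b1, b2, b3, b4, b5, b6, b7, b8, ⟨sp, b9, b10⟩, F', V', c1, c2, c3, c4⟩
  have x2 : s2.arr aX = s1.arr aX := b1 _ (by simp)
  have ell2 : s2.arr aEll = s.arr aEll := (b1 _ (by simp)).trans (a1 _ (by simp))
  have on2 : s2.arr aOn = s.arr aOn := (b1 _ (by simp)).trans (a1 _ (by simp))
  have phi2 : s2.arr aPhi = s.arr aPhi := (b1 _ (by simp)).trans (a1 _ (by simp))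
  have hyn := hV _ b7.1
  refine WP.mono (recount_spec (s := s2) (n := n) (par := s.arr aPar)
    ((b4 _ (by simp)).trans ((a2 _ (by simp)).trans hCn)) hyn (by rwa [on2, ell2])
    (fun k hk hne => by rw [b8 k hk hne, f1]) ?_ ?_
    (fun k hk => by rw [ell2]; exact (hCell k hk).le) b6.le (by rwa [phi2, on2]) hA hAW) ?_
  · intro k hk hk0
    have h1 := c3 _ (c2.par_mem _ (c4 k (by omega)).1 (by omega))
    omega
  · intro k
    rw [on2, hCon]
    split_ifs with hk
    · have h1 := hV _ (hT.par_mem _ (hs k hk.1.le).1 (by omega))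
      omega
    · omega
  rintro s3 t3 ⟨d1, d2, d3, d4, d5, d6, d7, d8, d9, d10⟩
  have x3 : s3.arr aX = s1.arr aX := (d1 _ (by simp)).trans x2
  have l3 : s3.arr aLen = s2.arr aLen := d1 _ (by simp)
  have p3 : s3.arr aPos = s2.arr aPos := d1 _ (by simp)
  have f3 : s3.arr aPar = s2.arr aPar := d1 _ (by simp)
  have sg3 : s3.reg rSigma = s1.reg rSigma := (d4 _ (by simp)).trans (b4 _ (by simp))
  have ct3 : s3.reg rCount = s2.reg rCount := d4 _ (by simp)
  have rt3 : s3.reg rRoot = s1.reg rRoot := (d4 _ (by simp)).trans (b4 _ (by simp))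
  have ch3 : s3.arr aChild = s1.arr aChild := (d1 _ (by simp)).trans (b1 _ (by simp))
  have ht3 : s3.arr aHeight = s1.arr aHeight := (d1 _ (by simp)).trans (b1 _ (by simp))
  have cr3 : s3.carr = s1.carr := d2.trans b2
  refine ⟨?_, by omega, ?_⟩
  · constructor
    · rw [d5, hlen]
    · rwa [ch3, ht3, cr3, rt3, sg3]
    · rwa [hlen, x3, sg3]
    · rw [x3, cr3]
      exact a9
    · rwa [hlen, x3, sg3]
    · rw [hlen, ct3]
      omega
    · rw [hlen, sg3, ct3, x3, l3, p3, f3]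
      exact ⟨F', V', c1.congr (d1 _ (by simp)) (d1 _ (by simp)) (d1 _ (by simp)), c2, c3, c4⟩
    · rw [hlen, x3]
      intro k hk
      rcases Nat.lt_or_eq_of_le hk with hk | rfl
      · rw [d7 k (by omega), ell2]
        exact hT1.isEll_step b6 (by rwa [l1, p1]) (fun k hk => (hCell k hk).congr hxy hk) b7.1
          b7.2.1 b7.2.2.1 b7.2.2.2 (by omega)
      · rw [d6]
        exact b6.isEll
    · rwa [hlen]
    · rwa [hlen]
  · rw [sg3, x3, depth_congr hxy]
    have hL := Nat.log_mono_right (b := 2) a4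
    generalize Nat.log 2 (s1.reg rSigma) = L at *
    generalize Nat.log 2 (s.reg rSigma) = L₀ at *
    generalize depth (s1.arr aX) (n + 1) = y at *
    generalize depth (s1.arr aX) n = z at *
    have h1 : (sp + 1) * (40 * (L + 2) + 80) ≤ (sp + 1) * (160 * (L + 1)) :=
      Nat.mul_le_mul_left _ (by omega)
    have h2 : (sp + y) * (160 * (L + 1)) ≤ (z + 3) * (160 * (L + 1)) :=
      Nat.mul_le_mul_right _ b9
    nlinarith

end

/-! ### The query program -/

notation "rAnswer" => 0

open NetFreq.Expr NetFreq.Cmd in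
/-- The query program: descend from the root, reading the pattern at the positions `idx`, which
depend on the number `rJ` of characters read so far. The node `rZ` is the locus of the part read,
provided that `rCont` is not `0`. -/
def query (idx : Expr) : Cmd :=
  rZ ≔ lit 0 ;;
  rJ ≔ lit 0 ;;
  rCont ≔ lit 1 ;;
  loop (reg rCont *. (reg rJ <. inputLen)) (
    inputChar cInput idx ;;
    findChar ;;
    branch (reg rId)
      (branch (get aLen (reg rZ) =. reg rJ)
        (rOwner ≔ lit 2 *. reg rZ ;;
         rKey ≔ reg rId ;;
         findEntry ;;
         rZ ≔ reg rFound ;;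
         branch (reg rZ) skip (rCont ≔ lit 0))
        (branch (get aX (get aPos (reg rZ) -. lit 1 -. reg rJ) =. reg rId) skip
          (rCont ≔ lit 0)))
      (rCont ≔ lit 0) ;;
    rJ ≔ reg rJ +. lit 1) ;;
  branch (reg rCont *. (get aLen (reg rZ) =. inputLen))
    (rAnswer ≔ get aPhi (reg rZ)) (rAnswer ≔ lit 0)

/-- The first `l` characters of suffix `k` are the first `l` characters of `y`, where `x` lists the
characters in the order of arrival. -/
def Matches {β : Type*} (x y : ℕ → β) (l k : ℕ) : Prop := l ≤ k ∧ ∀ j < l, x (k - 1 - j) = y j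

section

variable {α : Type*} [LinearOrder α] {A W : ℕ} {w : List α} {s : State α} {R : List α}
  {n σ : ℕ} {F : ℕ → ℕ → ℕ} {V : Set ℕ}

theorem Matches.mono {β : Type*} {x y : ℕ → β} {l l' k : ℕ} (h : Matches x y l k) (hl : l' ≤ l) :
    Matches x y l' k := ⟨hl.trans h.1, fun j hj => h.2 j (by omega)⟩

theorem Matches.of_agree {β : Type*} {x : ℕ → ℕ} {κ : ℕ → β} {y : ℕ → β} {l k k' : ℕ}
    (h : Matches (fun i => κ (x i)) y l k) (ha : Agree x l k k') :
    Matches (fun i => κ (x i)) y l k' :=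
  ⟨ha.2.1, fun j hj => by
    have := h.2 j hj
    simp only at this ⊢
    rw [← ha.2.2 j hj, this]⟩

theorem Core.congr {s' : State α} (hC : Core s R)
    (harr : SameOff [aPathNode, aPathDir, aStack] s'.arr s.arr) (hcarr : s'.carr = s.carr)
    (hreg : ∀ r ∈ [rN, rSigma, rRoot, rCount], s'.reg r = s.reg r) : Core s' R := by
  have h0 := harr aX (by simp)
  have h1 := harr aLen (by simp)
  have h2 := harr aPos (by simp)
  have h3 := harr aPar (by simp)
  have h8 := harr aEll (by simp)
  have h9 := harr aOn (by simp)
  have h10 := harr aPhi (by simp)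
  have h11 := harr aChild (by simp)
  have h12 := harr aHeight (by simp)
  have g1 := hreg rN (by simp)
  have g2 := hreg rSigma (by simp)
  have g3 := hreg rRoot (by simp)
  have g4 := hreg rCount (by simp)
  constructor
  · rw [g1, hC.n_eq]
  · rw [h11, h12, hcarr, g2, g3]; exact hC.alphabet
  · rw [h0, g2]; exact hC.id_mem
  · rw [h0, hcarr]; exact hC.id_key
  · rw [h0, g2]; exact hC.used
  · rw [g4]; exact hC.count_le
  · obtain ⟨F, V, hD, hT⟩ := hC.tree
    rw [h0, h1, h2, h3, g2, g4]
    exact ⟨F, V, hD.congr (harr _ (by simp)) (harr _ (by simp)) (harr _ (by simp)), hT⟩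
  · rw [h0, h8]; exact hC.ell
  · rw [h3, h8, h9]; exact hC.on
  · rw [h9, h10]; exact hC.phi

/-- Equal characters have equal numbers. -/
theorem Core.agree_of_matches (hC : Core s R) {y : ℕ → WithBot α} {l k k' : ℕ}
    (hk : k ≤ R.length) (hk' : k' ≤ R.length)
    (h : Matches (fun i => s.carr aChar (s.arr aX i)) y l k)
    (h' : Matches (fun i => s.carr aChar (s.arr aX i)) y l k') : Agree (s.arr aX) l k k' := by
  obtain ⟨t, ht⟩ := hC.alphabet
  have h1 := h.1
  have h1' := h'.1
  refine ⟨h1, h1', fun j hj => ht.key_inj (hC.id_mem _ (by omega)) (hC.id_mem _ (by omega)) ?_⟩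
  exact (h.2 j hj).trans (h'.2 j hj).symm

/-- The number that a node contributes. -/
theorem Core.phi_eq (hC : Core s R)
    (hT : Tree (s.arr aX) R.length (IsNode (s.arr aX) R.length) (s.arr aLen) (s.arr aPos)
      (s.arr aPar) F V)
    (hs : ∀ k ≤ R.length, 2 * k ∈ V ∧ s.arr aLen (2 * k) = k ∧ s.arr aPos (2 * k) = k)
    {y : ℕ → WithBot α} {z m : ℕ} (hz : z ∈ V) (hm : m ≤ s.arr aLen z)
    (hp : z ≠ 0 → m ≠ s.arr aLen z → s.arr aLen (s.arr aPar z) < m)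
    (hy : Matches (fun i => s.carr aChar (s.arr aX i)) y m (s.arr aPos z)) [DecidablePred
      (Matches (fun i => s.carr aChar (s.arr aX i)) y m)] :
    (if s.arr aLen z = m then s.arr aPhi z else 0) =
      ((Finset.range R.length).filter fun k => (s.arr aEll k < k ∧
        s.arr aEll (k + 1) ≤ s.arr aEll k) ∧ s.arr aEll k = m ∧
        Matches (fun i => s.carr aChar (s.arr aX i)) y m k).card := by
  have hpar : ∀ k < R.length, s.arr aEll k < k → s.arr aPar (2 * k) ∈ V ∧
      s.arr aLen (s.arr aPar (2 * k)) = s.arr aEll k ∧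
      Agree (s.arr aX) (s.arr aEll k) k (s.arr aPos (s.arr aPar (2 * k))) := by
    intro k hk hlt
    obtain ⟨h1, h2, h3⟩ := hs k hk.le
    have h4 := hT.len_par_suffix h1 h2 h3 (hC.ell k hk.le) hlt
    have h5 := hT.par_agree _ h1 (by omega)
    rw [h4, h3] at h5
    exact ⟨hT.par_mem _ h1 (by omega), h4, h5⟩
  split_ifs with hlen
  · rw [hC.phi, countOn]
    congr 1
    ext k
    simp only [Finset.mem_filter, Finset.mem_range, hC.on]
    refine and_congr_right fun hk => ?_
    constructor
    · intro h
      split_ifs at h with hc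
      rw [Nat.add_right_cancel_iff] at h
      obtain ⟨h1, h2, h3⟩ := hpar k hk hc.2.1
      rw [h] at h2 h3
      rw [hlen] at h2
      exact ⟨hc.2, h2.symm, hy.of_agree (h2 ▸ h3.symm)⟩
    · rintro ⟨h1, h2, h3⟩
      rw [if_pos ⟨hk, h1⟩]
      obtain ⟨g1, g2, g3⟩ := hpar k hk h1.1
      rw [hT.inj _ g1 z hz (by omega)]
      rw [h2] at g2 g3
      rw [g2]
      exact hC.agree_of_matches (hT.pos_le _ g1) (hT.pos_le _ hz) (h3.of_agree g3) hy
  · symm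
    rw [Finset.card_eq_zero, Finset.filter_eq_empty_iff]
    rintro k hk ⟨h1, h2, h3⟩
    rw [Finset.mem_range] at hk
    obtain ⟨g1, g2, g3⟩ := hpar k hk h1.1
    have hz0 : z ≠ 0 := by
      rintro rfl
      have := hT.len_root
      omega
    rw [h2] at g2 g3
    refine hT.par_max z hz hz0 m (hp hz0 (Ne.symm hlen)) (by omega) ?_
    have h4 := hT.node _ g1
    rw [g2] at h4
    exact h4.transfer (hC.agree_of_matches (hT.pos_le _ g1) (hT.pos_le _ hz) (h3.of_agree g3) hy)
      (hT.pos_le _ hz)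

end

section

variable {α : Type*} [LinearOrder α] {A W : ℕ} {w : List α} {s : State α} {R : List α}
  {n σ : ℕ} {F : ℕ → ℕ → ℕ} {V : Set ℕ}

theorem matches_succ_iff {β : Type*} {x y : ℕ → β} {l k : ℕ} :
    Matches x y (l + 1) k ↔ Matches x y l k ∧ l < k ∧ x (k - 1 - l) = y l := by
  constructor
  · exact fun h => ⟨h.mono (by omega), h.1, h.2 l (by omega)⟩
  · rintro ⟨h1, h2, h3⟩
    refine ⟨h2, fun j hj => ?_⟩
    rcases Nat.lt_succ_iff_lt_or_eq.1 hj with hj | rfl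
    · exact h1.2 j hj
    · exact h3

theorem Core.id_eq (hC : Core s R) {i c : ℕ} (hi : i < R.length)
    (hc : 1 ≤ c ∧ c ≤ s.reg rSigma) (h : s.carr aChar (s.arr aX i) = s.carr aChar c) :
    s.arr aX i = c := by
  obtain ⟨t, ht⟩ := hC.alphabet
  exact ht.key_inj (hC.id_mem i hi) hc h

/-- If the locus is a node without a child for the next character of the pattern, the pattern does
not occur. -/
theorem Core.child_eq_zero (hC : Core s R)
    (hT : Tree (s.arr aX) R.length (IsNode (s.arr aX) R.length) (s.arr aLen) (s.arr aPos)
      (s.arr aPar) F V) {y : ℕ → WithBot α} {z c : ℕ} (hz : z ∈ V)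
    (hy : Matches (fun i => s.carr aChar (s.arr aX i)) y (s.arr aLen z) (s.arr aPos z))
    (hc : 1 ≤ c ∧ c ≤ s.reg rSigma) (hcy : s.carr aChar c = y (s.arr aLen z))
    (h0 : F (2 * z) c = 0) {k : ℕ} (hk : k ≤ R.length) :
    ¬ Matches (fun i => s.carr aChar (s.arr aX i)) y (s.arr aLen z + 1) k := by
  intro h
  obtain ⟨h1, h2, h3⟩ := matches_succ_iff.1 h
  have h4 := hC.agree_of_matches hk (hT.pos_le z hz) h1 hy
  have h5 := hT.child_ne_zero (isNode_invariant _ _) (fun k hk => IsNode.self hk) hz hk h2 h4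
  rw [hC.id_eq (by omega) hc (h3.trans hcy.symm)] at h5
  exact h5.2.1 h0

omit [LinearOrder α] in
theorem Tree.child_matches
    (hT : Tree (s.arr aX) R.length (IsNode (s.arr aX) R.length) (s.arr aLen) (s.arr aPos)
      (s.arr aPar) F V) {y : ℕ → WithBot α} {z c z' : ℕ}
    (hy : Matches (fun i => s.carr aChar (s.arr aX i)) y (s.arr aLen z) (s.arr aPos z))
    (hcy : s.carr aChar c = y (s.arr aLen z))
    (hz' : F (2 * z) c = z') (h0 : z' ≠ 0) :
    z' ∈ V ∧ s.arr aLen z < s.arr aLen z' ∧ s.arr aPar z' = z ∧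
      Matches (fun i => s.carr aChar (s.arr aX i)) y (s.arr aLen z + 1) (s.arr aPos z') := by
  obtain ⟨h1, h2, h3⟩ := hT.child_of z c (hz' ▸ h0)
  rw [hz'] at h1 h2 h3
  have h4 := hT.par_lt z' h1 h0
  have h5 := hT.par_agree z' h1 h0
  rw [h2] at h4 h5
  refine ⟨h1, h4, h2, matches_succ_iff.2 ⟨hy.of_agree h5.symm, h4.trans_le (hT.node z' h1).le, ?_⟩⟩
  rw [h3, hcy]

/-- If the next character of the pattern differs from the next character on the edge to the locus,
the pattern does not occur. -/
theorem Core.not_matches_of_edge (hC : Core s R)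
    (hT : Tree (s.arr aX) R.length (IsNode (s.arr aX) R.length) (s.arr aLen) (s.arr aPos)
      (s.arr aPar) F V) {y : ℕ → WithBot α} {z c i : ℕ} (hz : z ∈ V) (hz0 : z ≠ 0)
    (hi : i < s.arr aLen z) (hpi : s.arr aLen (s.arr aPar z) < i)
    (hy : Matches (fun i => s.carr aChar (s.arr aX i)) y i (s.arr aPos z))
    (hc : 1 ≤ c ∧ c ≤ s.reg rSigma) (hcy : s.carr aChar c = y i)
    (hne : s.arr aX (s.arr aPos z - 1 - i) ≠ c) {k : ℕ} (hk : k ≤ R.length) :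
    ¬ Matches (fun i => s.carr aChar (s.arr aX i)) y (i + 1) k := by
  intro h
  obtain ⟨h1, h2, h3⟩ := matches_succ_iff.1 h
  have hinv := isNode_invariant (s.arr aX) R.length
  have h4 := hC.agree_of_matches hk (hT.pos_le z hz) h1 hy
  obtain ⟨z', g1, g2, g3, g4, g5⟩ := hT.exists_locus hinv (fun k hk => IsNode.self hk) hk
    (Nat.succ_pos i) h2
  have h6 : s.arr aLen (s.arr aPar z') < i := by
    by_contra hcon
    have e : s.arr aLen (s.arr aPar z') = i := by omega
    have h7 := hT.node _ (hT.par_mem z' g1 g2)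
    have h8 := hT.par_agree z' g1 g2
    rw [e] at h7 h8
    exact hT.par_max z hz hz0 i hpi hi (h7.transfer
      (h8.symm.trans ((g4.mono (by omega)).symm.trans h4)) (hT.pos_le z hz))
  have h7 := hT.locus_unique hinv hz hz0 g1 g2 hpi hi.le h6 (by omega)
    (h4.symm.trans (g4.mono (by omega)))
  subst h7
  have h8 := (agree_succ_iff.1 g4).2.2.2
  rw [← h8] at hne
  exact hne (hC.id_eq (by omega) hc (h3.trans hcy.symm))

open Classical in
/-- The query program counts the suffixes that contribute to the net frequency of the string `y`,
provided that the expression `idx` reads the characters of `y` one by one. -/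
theorem query_spec (hC : Core s R) {idx : Expr} {y : ℕ → WithBot α}
    (hidx : ∀ s' : State α, s'.reg rJ < w.length →
      idx.Ok A W w s' ∧ inputAt w (idx.val w s') = y (s'.reg rJ)) (hsz : idx.size ≤ 10)
    (hA : 100 * (R.length + 1) ≤ A) (hAW : A + w.length ≤ W) :
    WP A W w (query idx) s fun s' τ =>
      SameOff [aPathNode, aPathDir] s'.arr s.arr ∧ Core s' R ∧ s'.reg rSigma = s.reg rSigma ∧
      s'.reg rAnswer = ((Finset.range R.length).filter fun k => (s.arr aEll k < k ∧
        s.arr aEll (k + 1) ≤ s.arr aEll k) ∧ s.arr aEll k = w.length ∧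
        Matches (fun i => s.carr aChar (s.arr aX i)) y w.length k).card ∧
      τ ≤ (w.length + 1) * (140 * (Nat.log 2 (s.reg rSigma) + 2) + 200) := by
  obtain ⟨F, V, hD, hT, hV, hs⟩ := hC.tree
  obtain ⟨t, ht⟩ := hC.alphabet
  have hσn := hC.sigma_le
  have hcnt := hC.count_le
  obtain ⟨n, hn⟩ : ∃ n, n = R.length := ⟨_, rfl⟩
  rw [← hn] at hV hA hσn hcnt
  have hAW' : A ≤ W := by omega
  set κ : ℕ → WithBot α := fun i => s.carr aChar (s.arr aX i) with hκ
  obtain ⟨L, hL⟩ : ∃ L, L = Nat.log 2 (s.reg rSigma) + 2 := ⟨_, rfl⟩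
  have hpos : ∀ v ∈ V, s.arr aPos v ≤ n := fun v hv => hn ▸ hT.pos_le v hv
  have hlenpos : ∀ v ∈ V, s.arr aLen v ≤ s.arr aPos v := fun v hv => (hT.node v hv).le
  -- either the locus of the part read has been found, or the pattern does not occur
  let I : ℕ → State α → Prop := fun f s' =>
    SameOff [aPathNode, aPathDir] s'.arr s.arr ∧ s'.carr = s.carr ∧
    SameOff [rZ, rJ, rCont, rId, rCmp, rDepth, rOwner, rKey, rEntry, rLoc, rBits, rFound]
      s'.reg s.reg ∧ f + s'.reg rJ = w.length ∧
    (s'.reg rCont = 1 ∧ s'.reg rZ ∈ V ∧ s'.reg rJ ≤ s.arr aLen (s'.reg rZ) ∧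
      (s'.reg rZ ≠ 0 → s.arr aLen (s.arr aPar (s'.reg rZ)) < s'.reg rJ) ∧
      Matches κ y (s'.reg rJ) (s.arr aPos (s'.reg rZ)) ∨
    s'.reg rCont = 0 ∧ s'.reg rZ ≤ 2 * n ∧ ∀ k ≤ n, ¬ Matches κ y w.length k)
  rw [query]
  simp only [wp_seq]
  simp
  refine ⟨by omega, by omega, ?_⟩
  refine WP.mono (wp_loop (140 * L + 70) I ?_ (m := w.length) ?_) ?_
  · rintro f s' ⟨h1, h2, h3, h4, h5⟩
    obtain ⟨i, hi⟩ : ∃ i, i = s'.reg rJ := ⟨_, rfl⟩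
    have hcont : s'.reg rCont ≤ 1 := by omega
    rw [← hi] at h4 h5
    simp [← hi]
    refine ⟨⟨⟨by omega, ite_lt_of (by omega)⟩, by split_ifs <;> omega⟩, fun hiw hc0 => ?_⟩
    obtain ⟨h5, h6, h7, h8, h9⟩ := h5.resolve_right fun h => hc0 h.1
    obtain ⟨z, hz⟩ : ∃ z, z = s'.reg rZ := ⟨_, rfl⟩
    rw [← hz] at h6 h7 h8 h9
    obtain ⟨hx1, hx2⟩ := hidx s' (by omega)
    refine ⟨hx1, ?_⟩
    rw [hx2, ← hi]
    have ch1 : s'.arr aChild = s.arr aChild := h1 _ (by simp)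
    have hg1 : s'.arr aHeight = s.arr aHeight := h1 _ (by simp)
    have rt1 : s'.reg rRoot = s.reg rRoot := h3 _ (by simp)
    refine WP.mono (findChar_spec' (σ := s.reg rSigma) (t := t) (by simpa [ch1, hg1, rt1, h2] using ht)
      (by omega) hAW' (by omega)) ?_
    rintro s1 t1 ⟨a1, a2, -, a4, a5, a6⟩
    simp [h2] at a1 a2 a4 a6
    have z1 : s1.reg rZ = z := (a4 _ (by simp)).trans hz.symm
    have j1 : s1.reg rJ = i := (a4 _ (by simp)).trans hi.symm
    have c1 : s1.reg rCont = 1 := (a4 _ (by simp)).trans h5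
    have b1 : SameOff [aPathNode, aPathDir] s1.arr s.arr := a1.trans h1
    have b3 : SameOff [rZ, rJ, rCont, rId, rCmp, rDepth, rOwner, rKey, rEntry, rLoc, rBits,
      rFound] s1.reg s.reg := (a4.mono (by simp)).trans h3
    have len1 : s1.arr aLen = s.arr aLen := b1 _ (by simp)
    have pos1 : s1.arr aPos = s.arr aPos := b1 _ (by simp)
    have x1 : s1.arr aX = s.arr aX := b1 _ (by simp)
    have hzn := hV z h6
    have hzp := hpos z h6
    have hzl := hlenpos z h6
    rw [wp_branch]
    refine ⟨trivial, fun hid => ?_, fun hid => ?_⟩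
    · simp only [Expr.val] at hid
      obtain ⟨a6, a7⟩ := a6.resolve_left fun h => hid h.1
      rw [wp_branch]
      simp [z1, j1, len1]
      refine ⟨⟨by omega, ite_lt_of (by omega)⟩, fun hlen => ?_, fun hlen => ?_⟩
      · refine ⟨by omega, ?_⟩
        refine WP.mono (find_spec (σ := s.reg rSigma) (F := F) ?_ ?_ ?_ ?_ hAW' (by omega)
          (by omega)) ?_
        · have e : s1.reg rCount = s.reg rCount := b3 _ (by simp)
          simpa [e] using hD.congr (b1 _ (by simp)) (b1 _ (by simp)) (b1 _ (by simp))
        · simpa using a6.2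
        · simp; omega
        · have e : s1.reg rCount = s.reg rCount := b3 _ (by simp)
          simp [e]; omega
        rintro s2 t2 ⟨d1, d2, -, d4, d5, d6⟩
        simp at d1 d2 d5
        have j2 : s2.reg rJ = i := by rw [d4 _ (by simp)]; simp [j1]
        have c2 : s2.reg rCont = 1 := by rw [d4 _ (by simp)]; simp [c1]
        have b4 : SameOff [rZ, rJ, rCont, rId, rCmp, rDepth, rOwner, rKey, rEntry, rLoc, rBits,
          rFound] s2.reg s.reg := (d4.mono (by simp)).trans (by simpa using b3)
        rw [← hlen] at h9
        rw [wp_branch]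
        simp [j2]
        refine ⟨fun hz' => ?_, fun hz' => ?_⟩
        · rw [d5] at hz'
          obtain ⟨e1, e2, e3, e4⟩ := hT.child_matches h9 (by rw [a7, hlen]) rfl hz'
          refine ⟨by omega, by omega, f - 1, by omega, by simpa [d1] using b1,
            by simp [d2, a2], by simpa using b4, by simp; omega, .inl ?_⟩
          simp [c2, d5]
          refine ⟨e1, by omega, fun _ => ?_, by rwa [hlen] at e4⟩
          rw [e3]
          omega
        · rw [d5] at hz'
          have e1 := fun k hk => hC.child_eq_zero hT (k := k) h6 h9 a6 (by rw [a7, hlen]) hz' hk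
          refine ⟨by omega, by omega, by omega, f - 1, by omega, by simpa [d1] using b1,
            by simp [d2, a2], by simpa using b4, by simp; omega, .inr ?_⟩
          simp [d5, hz']
          intro k hk hm
          exact e1 k (by omega) (hm.mono (by omega))
      · have hz0 : z ≠ 0 := by
          rintro rfl
          have := hT.len_root
          omega
        rw [wp_branch]
        simp [z1, j1, pos1, x1]
        refine ⟨⟨by omega, ite_lt_of (by omega)⟩, fun heq => ?_, fun heq => ?_⟩
        · refine ⟨by omega, by omega, f - 1, by omega, by simpa using b1,
            by simp [a2], by simpa using b3, by simp; omega, .inl ?_⟩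
          simp [c1, z1]
          refine ⟨h6, by omega, fun h => by have := h8 h; omega,
            matches_succ_iff.2 ⟨h9, by omega, ?_⟩⟩
          rw [hκ]
          simp only [heq, a7]
        · have e1 := fun k hk => hC.not_matches_of_edge hT (k := k) h6 hz0 (by omega) (h8 hz0) h9
            a6 a7 heq hk
          refine ⟨by omega, by omega, by omega, f - 1, by omega, by simpa using b1,
            by simp [a2], by simpa using b3, by simp; omega, .inr ?_⟩
          simp [z1]
          refine ⟨hzn, fun k hk hm => e1 k (by omega) (hm.mono (by omega))⟩
    · simp only [Expr.val] at hid
      obtain ⟨-, a7⟩ := a6.resolve_right fun h => by omega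
      simp [j1]
      refine ⟨by omega, by omega, by omega, f - 1, by omega, by simpa using b1,
        by simp [a2], by simpa using b3, by simp; omega, .inr ?_⟩
      simp [z1]
      refine ⟨hzn, fun k hk hm => ?_⟩
      have e1 := hC.id_mem (k - 1 - i) (by have := hm.1; omega)
      exact a7 _ e1.1 e1.2 (hm.2 i hiw)
  · refine ⟨by simp, by simp, by simp, by simp, .inl ?_⟩
    simp
    exact ⟨hT.root, by omega, by simp⟩
  · rintro s' τ ⟨f, h0, ⟨h1, h2, h3, h4, h5⟩, h6, h7⟩
    have len1 : s'.arr aLen = s.arr aLen := h1 _ (by simp)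
    have phi1 : s'.arr aPhi = s.arr aPhi := h1 _ (by simp)
    have hcont : s'.reg rCont ≤ 1 := by omega
    have hzn : s'.reg rZ ≤ 2 * n := by
      rcases h5 with h5 | h5
      · exact hV _ h5.2.1
      · exact h5.2.1
    have htime : ∀ u ≤ 30, 2 + (2 + (2 + (τ + u))) ≤ (w.length + 1) * (140 * L + 200) := by
      intro u hu
      have e : (w.length - f) * (140 * L + 70 + 5 + 1) ≤ w.length * (140 * L + 200) :=
        Nat.mul_le_mul (by omega) (by omega)
      simp at h7
      rw [Nat.add_mul, Nat.one_mul]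
      omega
    have hcore : ∀ v, Core (s'.setReg rAnswer v) R := fun v =>
      hC.congr (by simpa using h1.mono (by simp)) (by simpa using h2) (by
        intro r hr
        simp at hr
        rcases hr with rfl | rfl | rfl | rfl <;> simp <;> exact h3 _ (by simp))
    have hsig : s'.reg rSigma = s.reg rSigma := h3 _ (by simp)
    rw [wp_branch]
    simp [len1, phi1, hsig, ← hL, h1, hcore]
    have hj : s'.reg rCont = 1 → s'.reg rJ = w.length := by
      intro hc
      by_contra hne
      have hlt : s'.reg rJ < w.length := by omega
      simp [hc, hlt] at h6
    refine ⟨⟨⟨by omega, by omega, ite_lt_of (by omega)⟩, by split_ifs <;> omega⟩,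
      fun hc1 hc2 => ⟨by omega, ?_, htime _ (by omega)⟩,
      fun hc => ⟨by omega, ?_, htime _ (by omega)⟩⟩
    · obtain ⟨g0, g1, g2, g3, g4⟩ := h5.resolve_right fun h => hc2 h.1
      rw [hj g0] at g2 g3 g4
      rw [← hC.phi_eq hT hs g1 g2 (fun h _ => g3 h) g4, if_pos hc1]
    · rcases h5 with ⟨g0, g1, g2, g3, g4⟩ | ⟨-, -, g⟩
      · rw [hj g0] at g2 g3 g4
        rw [← hC.phi_eq hT hs g1 g2 (fun h _ => g3 h) g4, if_neg fun h => by have := hc h; omega]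
      · symm
        rw [Finset.card_eq_zero, Finset.filter_eq_empty_iff]
        intro k hk h
        rw [Finset.mem_range] at hk
        exact g k (by omega) h.2.2

end

/-! ### Net frequency in terms of longest repeated prefixes -/

section

variable {α : Type*} {R S w u : List α} {a b : α} {k l m n L L' : ℕ}

theorem inputAt_eq_iff {l l' : List α} {i j : ℕ} :
    inputAt l i = inputAt l' j ↔ l[i]? = l'[j]? := by
  unfold inputAt
  rcases h : l[i]? with _ | a <;> rcases h' : l'[j]? with _ | b <;> simp

theorem inputAt_of_lt {i : ℕ} (h : i < R.length) : inputAt R i = (R[i] : WithBot α) := by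
  simp [inputAt, h]

/-- `u` is a prefix of suffix `k` of the string `R.reverse`, whose characters arrived in the order
`R`. -/
def Occurs (R u : List α) (k : ℕ) : Prop :=
  k ≤ R.length ∧ Matches (inputAt R) (inputAt u) u.length k

theorem take_drop_reverse_iff (hk : k ≤ R.length) :
    (R.reverse.drop (R.length - k)).take w.length = w ↔
      Matches (inputAt R) (inputAt w) w.length k := by
  constructor
  · intro h
    have hl := congrArg List.length h
    simp at hl
    refine ⟨by omega, fun j hj => ?_⟩
    rw [inputAt_eq_iff, ← h, List.getElem?_take_of_lt hj, List.getElem?_drop,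
      List.getElem?_reverse (by omega)]
    congr 1
    omega
  · rintro ⟨h1, h2⟩
    refine List.ext_getElem? fun j => ?_
    by_cases hj : j < w.length
    · rw [List.getElem?_take_of_lt hj, List.getElem?_drop, List.getElem?_reverse (by omega),
        ← inputAt_eq_iff.1 (h2 j hj)]
      congr 1
      omega
    · rw [List.getElem?_eq_none (by simp; omega), List.getElem?_eq_none (by omega)]

open Classical in
theorem occ_reverse_eq : occ R.reverse w =
    ((Finset.range (R.length + 1)).filter fun k => Occurs R w k).card := by
  unfold occ
  refine Finset.card_nbij' (fun i => R.length - i) (fun k => R.length - k) ?_ ?_ ?_ ?_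
  · intro i hi
    simp only [Finset.coe_filter, Finset.mem_range, List.length_reverse, Set.mem_ofPred_eq] at hi ⊢
    refine ⟨by omega, by omega, (take_drop_reverse_iff (by omega)).1 ?_⟩
    rw [Nat.sub_sub_self (by omega)]
    convert hi.2
  · intro k hk
    simp only [Finset.coe_filter, Finset.mem_range, List.length_reverse, Set.mem_ofPred_eq] at hk ⊢
    exact ⟨by omega, by convert (take_drop_reverse_iff hk.2.1).2 hk.2.2⟩
  · intro i hi
    simp at hi
    simp only
    omega
  · intro k hk
    simp at hk
    simp only
    omega

theorem occ_reverse_eq_one_iff [DecidableEq α] :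
    occ R.reverse w = 1 ↔ ∃ k, Occurs R w k ∧ ∀ k', Occurs R w k' → k' = k := by
  classical
  have e : occ R.reverse w = ((Finset.range (R.length + 1)).filter fun k => Occurs R w k).card := by
    rw [← occ_reverse_eq]
    congr!
  rw [e, Finset.card_eq_one]
  constructor
  · rintro ⟨k, hk⟩
    have h : ∀ k', Occurs R w k' ↔ k' = k := fun k' => by
      rw [← Finset.mem_singleton, ← hk, Finset.mem_filter, Finset.mem_range]
      exact ⟨fun h => ⟨Nat.lt_succ_of_le h.1, h⟩, fun h => h.2⟩
    exact ⟨k, (h k).2 rfl, fun k' hk' => (h k').1 hk'⟩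
  · rintro ⟨k, hk, h⟩
    refine ⟨k, Finset.ext fun k' => ?_⟩
    rw [Finset.mem_singleton, Finset.mem_filter, Finset.mem_range]
    refine ⟨fun h' => h k' h'.2, ?_⟩
    rintro rfl
    exact ⟨Nat.lt_succ_of_le hk.1, hk⟩

theorem isRepeat_reverse_iff [DecidableEq α] :
    IsRepeat R.reverse w ↔ ∃ k k', Occurs R w k ∧ Occurs R w k' ∧ k ≠ k' := by
  classical
  have e : occ R.reverse w = ((Finset.range (R.length + 1)).filter fun k => Occurs R w k).card := by
    rw [← occ_reverse_eq]
    congr!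
  rw [IsRepeat, e, Nat.succ_le_iff, Finset.one_lt_card]
  simp only [Finset.mem_filter, Finset.mem_range]
  constructor
  · rintro ⟨k, hk, k', hk', h⟩
    exact ⟨k, k', hk.2, hk'.2, h⟩
  · rintro ⟨k, k', hk, hk', h⟩
    exact ⟨k, ⟨Nat.lt_succ_of_le hk.1, hk⟩, k', ⟨Nat.lt_succ_of_le hk'.1, hk'⟩, h⟩

theorem occurs_append_singleton_iff :
    Occurs R (w ++ [b]) k ↔
      Occurs R w k ∧ w.length < k ∧ inputAt R (k - 1 - w.length) = (b : WithBot α) := by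
  have hb : inputAt (w ++ [b]) w.length = (b : WithBot α) := by simp [inputAt]
  have hw : ∀ j < w.length, inputAt (w ++ [b]) j = inputAt w j := fun j hj => by
    rw [inputAt_eq_iff, List.getElem?_append_left hj]
  rw [Occurs, List.length_append, List.length_singleton, matches_succ_iff, hb, Occurs, Matches,
    Matches]
  constructor
  · rintro ⟨h0, ⟨h1, h2⟩, h3⟩
    exact ⟨⟨h0, h1, fun j hj => (h2 j hj).trans (hw j hj)⟩, h3⟩
  · rintro ⟨⟨h0, h1, h2⟩, h3⟩
    exact ⟨h0, ⟨h1, fun j hj => (h2 j hj).trans (hw j hj).symm⟩, h3⟩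

theorem occurs_cons_iff :
    Occurs R (a :: w) (k + 1) ↔
      k < R.length ∧ inputAt R k = (a : WithBot α) ∧ Occurs R w k := by
  have hw : ∀ j, inputAt (a :: w) (j + 1) = inputAt w j := fun j => by
    rw [inputAt_eq_iff, List.getElem?_cons_succ]
  have ha : inputAt (a :: w) 0 = (a : WithBot α) := by simp [inputAt]
  constructor
  · rintro ⟨h0, h1, h2⟩
    rw [List.length_cons] at h1 h2
    refine ⟨by omega, ?_, by omega, by omega, fun j hj => ?_⟩
    · simpa [ha] using h2 0 (by omega)
    · have := h2 (j + 1) (by omega)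
      rwa [hw, show k + 1 - 1 - (j + 1) = k - 1 - j by omega] at this
  · rintro ⟨h0, h1, h2, h3, h4⟩
    refine ⟨h0, by simp; omega, fun j hj => ?_⟩
    rw [List.length_cons] at hj
    cases j with
    | zero => simpa [ha] using h1
    | succ j =>
      rw [hw, show k + 1 - 1 - (j + 1) = k - 1 - j by omega]
      exact h4 j (by omega)

theorem Occurs.agree (h : Occurs R w k) {k' : ℕ} (h' : Occurs R w k') :
    Agree (inputAt R) w.length k k' :=
  ⟨h.2.1, h'.2.1, fun j hj => (h.2.2 j hj).trans (h'.2.2 j hj).symm⟩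

theorem Occurs.of_agree (h : Occurs R w k) {k' : ℕ} (hk' : k' ≤ R.length)
    (ha : Agree (inputAt R) w.length k k') : Occurs R w k' :=
  ⟨hk', ha.2.1, fun j hj => (ha.2.2 j hj).symm.trans (h.2.2 j hj)⟩

theorem IsEll.le_of_agree {β : Type*} {x : ℕ → β} (hL : IsEll x n k L) {k' : ℕ} (hk' : k' ≤ n)
    (hne : k' ≠ k) (ha : Agree x l k k') : l ≤ L := by
  by_contra h
  exact hL.1 k' hk' hne (ha.mono (by omega))

/-- The net frequency counts the suffixes `k` whose longest repeated prefix is `w`, is properly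
contained in the suffix, and does not become a longer repeat by putting the character that
precedes the suffix in front: the characters around this occurrence of `w` are the two that the
definition of net frequency asks for. -/
theorem netFreq_reverse_eq [DecidableEq α] {ell : ℕ → ℕ}
    (hell : ∀ k ≤ R.length, IsEll (inputAt R) R.length k (ell k))
    [DecidablePred (Matches (inputAt R) (inputAt w) w.length)] :
    netFreq R.reverse w = ((Finset.range R.length).filter fun k => (ell k < k ∧
      ell (k + 1) ≤ ell k) ∧ ell k = w.length ∧
      Matches (inputAt R) (inputAt w) w.length k).card := by
  rw [netFreq, ← Set.ncard_coe_finset]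
  symm
  have hK : ∀ k, k ∈ ((Finset.range R.length).filter fun k => (ell k < k ∧
      ell (k + 1) ≤ ell k) ∧ ell k = w.length ∧
      Matches (inputAt R) (inputAt w) w.length k : Set ℕ) ↔ k < R.length ∧ w.length < k ∧
      ell (k + 1) ≤ w.length ∧ ell k = w.length ∧ Occurs R w k := by
    intro k
    simp only [Finset.coe_filter, Finset.mem_range, Set.mem_ofPred_eq, Occurs]
    constructor
    · rintro ⟨h1, ⟨h2, h3⟩, h4, h5⟩
      exact ⟨h1, h4 ▸ h2, h4 ▸ h3, h4, h1.le, h5⟩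
    · rintro ⟨h1, h2, h3, h4, h5, h6⟩
      exact ⟨h1, ⟨h4.symm ▸ h2, h4.symm ▸ h3⟩, h4, h6⟩
  refine Set.ncard_congr (fun k hk => (R[k]'((hK k).1 hk).1,
    R[k - 1 - w.length]'(by have := (hK k).1 hk; omega))) ?_ ?_ ?_
  · intro k hk
    obtain ⟨h1, h2, h3, h4, h5⟩ := (hK k).1 hk
    have hc : ∀ u, Occurs R u k → Occurs R (R[k] :: u) (k + 1) := fun u hu =>
      occurs_cons_iff.2 ⟨h1, inputAt_of_lt h1, hu⟩
    have hb : Occurs R (w ++ [R[k - 1 - w.length]'(by omega)]) k :=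
      occurs_append_singleton_iff.2 ⟨h5, h2, inputAt_of_lt _⟩
    have hu : ∀ k', Occurs R (R[k] :: w) k' → k' = k + 1 := by
      intro k' hk'
      by_contra hne
      have := (hell (k + 1) h1).le_of_agree hk'.1 hne ((hc _ h5).agree hk')
      rw [List.length_cons] at this
      omega
    refine ⟨isRepeat_reverse_iff.2 ?_, occ_reverse_eq_one_iff.2 ⟨k + 1, hc _ hb, fun k' hk' => ?_⟩,
      occ_reverse_eq_one_iff.2 ⟨k + 1, hc _ h5, hu⟩,
      occ_reverse_eq_one_iff.2 ⟨k, hb, fun k' hk' => ?_⟩⟩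
    · rcases (hell k h1.le).2 with h0 | ⟨k', g1, g2, g3⟩
      · refine ⟨k, k + 1, h5, h5.of_agree h1 ?_, by omega⟩
        rw [← h4, h0]
        exact Agree.zero
      · exact ⟨k, k', h5, h5.of_agree g1 (h4 ▸ g3), g2.symm⟩
    · refine hu k' ?_
      rw [← List.cons_append] at hk'
      exact (occurs_append_singleton_iff.1 hk').1
    · by_contra hne
      have := (hell k h1.le).le_of_agree hk'.1 hne (hb.agree hk')
      rw [List.length_append, List.length_singleton] at this
      omega
  · intro k k' hk hk' he
    obtain ⟨h1, h2, h3, h4, h5⟩ := (hK k).1 hk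
    obtain ⟨g1, g2, g3, g4, g5⟩ := (hK k').1 hk'
    rw [Prod.mk.injEq] at he
    by_contra hne
    have := (hell (k + 1) h1).le_of_agree (k' := k' + 1) g1 (by omega)
      (agree_cons_iff.2 ⟨by rw [inputAt_of_lt h1, inputAt_of_lt g1, he.1], h5.agree g5⟩)
    omega
  · rintro ⟨a, b⟩ ⟨hr, hab, ha, hb⟩
    simp only at hab ha hb
    obtain ⟨k, hk, -⟩ := occ_reverse_eq_one_iff.1 hab
    obtain ⟨k, rfl⟩ : ∃ i, k = i + 1 := ⟨k - 1, by
      have := hk.2.1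
      rw [List.length_cons] at this
      omega⟩
    obtain ⟨h1, h2, h3⟩ := occurs_cons_iff.1 hk
    obtain ⟨h4, h5, h6⟩ := occurs_append_singleton_iff.1 h3
    have haw := occurs_cons_iff.2 ⟨h1, h2, h4⟩
    have hk' : k ∈ ((Finset.range R.length).filter fun k => (ell k < k ∧
        ell (k + 1) ≤ ell k) ∧ ell k = w.length ∧
        Matches (inputAt R) (inputAt w) w.length k : Set ℕ) := by
      refine (hK k).2 ⟨h1, h5, ?_, le_antisymm ?_ ?_, h4⟩
      · by_contra hlt
        rcases (hell (k + 1) h1).2 with h0 | ⟨k', g1, g2, g3⟩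
        · omega
        · obtain ⟨i, -, hi⟩ := occ_reverse_eq_one_iff.1 ha
          exact g2 ((hi _ (haw.of_agree g1 (g3.mono (by simp; omega)))).trans (hi _ haw).symm)
      · by_contra hlt
        rcases (hell k h1.le).2 with h0 | ⟨k', g1, g2, g3⟩
        · omega
        · obtain ⟨i, -, hi⟩ := occ_reverse_eq_one_iff.1 hb
          exact g2 ((hi _ (h3.of_agree g1 (g3.mono (by simp; omega)))).trans (hi _ h3).symm)
      · obtain ⟨i, j, hi, hj, hij⟩ := isRepeat_reverse_iff.1 hr
        by_cases hik : i = k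
        · exact (hell k h1.le).le_of_agree hj.1 (by omega) (h4.agree hj)
        · exact (hell k h1.le).le_of_agree hi.1 hik (h4.agree hi)
    refine ⟨k, hk', Prod.ext ?_ ?_⟩
    · rwa [inputAt_of_lt h1, WithBot.coe_inj] at h2
    · rwa [inputAt_of_lt (by omega), WithBot.coe_inj] at h6

theorem occ_reverse_reverse [DecidableEq α] : occ S.reverse w.reverse = occ S w := by
  classical
  have e : occ S.reverse w.reverse =
      ((Finset.range (S.length + 1)).filter fun k => Occurs S w.reverse k).card := by
    rw [← occ_reverse_eq]
    congr!
  have hiff : ∀ i, i + w.length ≤ S.length →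
      (Occurs S w.reverse (i + w.length) ↔ (S.drop i).take w.length = w) := by
    intro i hi
    rw [Occurs, Matches, List.length_reverse]
    constructor
    · rintro ⟨-, -, h⟩
      refine List.ext_getElem? fun j => ?_
      by_cases hj : j < w.length
      · have h1 := inputAt_eq_iff.1 (h (w.length - 1 - j) (by omega))
        rw [List.getElem?_reverse (by omega)] at h1
        rw [List.getElem?_take_of_lt hj, List.getElem?_drop]
        convert h1 using 2 <;> omega
      · rw [List.getElem?_eq_none (by simp; omega), List.getElem?_eq_none (by omega)]
    · intro h
      refine ⟨hi, by omega, fun j hj => ?_⟩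
      rw [inputAt_eq_iff, List.getElem?_reverse hj, ← h, List.length_take, List.length_drop,
        List.getElem?_take_of_lt (by omega), List.getElem?_drop]
      congr 1
      omega
  rw [e, occ]
  symm
  refine Finset.card_nbij' (fun i => i + w.length) (fun k => k - w.length) ?_ ?_ ?_ ?_
  · intro i hi
    simp only [Finset.coe_filter, Finset.mem_range, Set.mem_ofPred_eq] at hi ⊢
    have hl := congrArg List.length hi.2
    simp at hl
    exact ⟨by omega, (hiff i (by omega)).2 hi.2⟩
  · intro k hk
    simp only [Finset.coe_filter, Finset.mem_range, Set.mem_ofPred_eq] at hk ⊢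
    have h1 := hk.2.2.1
    rw [List.length_reverse] at h1
    refine ⟨by omega, (hiff _ (by omega)).1 ?_⟩
    rw [Nat.sub_add_cancel h1]
    exact hk.2
  · intro i hi
    simp
  · intro k hk
    simp only [Finset.coe_filter, Finset.mem_range, Set.mem_ofPred_eq] at hk ⊢
    have h1 := hk.2.2.1
    rw [List.length_reverse] at h1
    omega

theorem netFreq_reverse_reverse [DecidableEq α] : netFreq S.reverse w.reverse = netFreq S w := by
  have h : ∀ a b, (a, b) ∈ netPairs S.reverse w.reverse ↔ (b, a) ∈ netPairs S w := by
    intro a b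
    have e1 : a :: (w.reverse ++ [b]) = (b :: (w ++ [a])).reverse := by simp
    have e2 : a :: w.reverse = (w ++ [a]).reverse := by simp
    have e3 : w.reverse ++ [b] = (b :: w).reverse := by simp
    simp only [netPairs, IsRepeat, Set.mem_ofPred_eq]
    rw [e1, e2, e3]
    simp only [occ_reverse_reverse]
    tauto
  refine Set.ncard_congr (fun p _ => p.swap) ?_ ?_ ?_
  · rintro ⟨a, b⟩ hp
    exact (h a b).1 hp
  · intro p q _ _ hpq
    exact Prod.swap_injective hpq
  · rintro ⟨a, b⟩ hp
    exact ⟨(b, a), (h b a).2 hp, rfl⟩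

end

/-! ### Sessions -/

/-- The characters of `S` in the order of their arrival. -/
def Direction.arrivals {α : Type*} : Direction → List α → List α
  | .rightToLeft, S => S.reverse
  | .leftToRight, S => S

open NetFreq.Expr in
/-- The position of the character of a pattern that the query program reads after `rJ` others: a
pattern is read from the end at which characters arrive. -/
def Direction.position : Direction → Expr
  | .rightToLeft => reg rJ
  | .leftToRight => inputLen -. lit 1 -. reg rJ

/-- The online data structure. -/
def Direction.dataStructure (dir : Direction) : OnlineDS := ⟨update, query dir.position⟩

section

variable {α : Type*} {S w : List α} {dir : Direction}

theorem Direction.arrivals_extend (dir : Direction) (S : List α) (a : α) :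
    dir.arrivals (dir.extend S a) = dir.arrivals S ++ [a] := by
  cases dir <;> simp [arrivals, extend]

@[simp] theorem Direction.length_arrivals : (dir.arrivals S).length = S.length := by
  cases dir <;> simp [arrivals]

theorem Direction.netFreq_arrivals [DecidableEq α] :
    netFreq (dir.arrivals S).reverse (dir.arrivals w).reverse = netFreq S w := by
  cases dir
  · simp [arrivals]
  · exact netFreq_reverse_reverse

theorem Direction.alphabetSize_arrivals [DecidableEq α] :
    alphabetSize (dir.arrivals S) = alphabetSize S := by
  cases dir <;> simp [arrivals, alphabetSize]

theorem depth_le {β : Type*} (x : ℕ → β) (n : ℕ) : depth x n ≤ n :=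
  by
  classical
  exact (Finset.card_filter_le _ _).trans (by simp)

variable [LinearOrder α] {s : State α} {R : List α} {A W T : ℕ}

theorem Core.init : Core (State.init α) ([] : List α) where
  n_eq := rfl
  alphabet := ⟨.nil, rfl, trivial, trivial, rfl, by simp, by simp [State.init]⟩
  id_mem := by simp
  id_key := by simp
  used := by
    intro c h1 h2
    simp [State.init] at h2
    omega
  count_le := by simp [State.init]
  tree := by
    refine ⟨fun _ _ => 0, {0}, ⟨⟨fun _ => 0, fun _ => 0, ?_⟩, by simp [State.init]⟩, ?_,
      by simp, ?_⟩
    · constructor <;> simp [State.init] <;> omega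
    · constructor <;> simp [State.init]
      · exact IsNode.zero le_rfl
      · intro l hl
        have := hl.le
        exact ⟨by omega, by rw [show l = 0 by omega]; exact Agree.zero⟩
    · intro k hk
      have : k = 0 := by simpa using hk
      subst this
      simp [State.init]
  ell := by
    intro k hk
    have : k = 0 := by simpa using hk
    subst this
    exact ⟨fun k' hk' hne => absurd (Nat.le_zero.1 hk') hne, .inl rfl⟩
  on := by simp [State.init]
  phi := by simp [State.init, countOn]

theorem Core.alphabetSize_eq (hC : Core s R) : alphabetSize R = s.reg rSigma := by
  obtain ⟨t, ht⟩ := hC.alphabet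
  have h : R.toFinset.image (WithBot.some : α → WithBot α) =
      (Finset.Icc 1 (s.reg rSigma)).image (s.carr aChar) := by
    ext c
    simp only [Finset.mem_image, List.mem_toFinset, Finset.mem_Icc]
    constructor
    · rintro ⟨a, ha, rfl⟩
      obtain ⟨i, hi, rfl⟩ := List.getElem_of_mem ha
      exact ⟨_, hC.id_mem i hi, hC.id_key i hi⟩
    · rintro ⟨c, hc, rfl⟩
      obtain ⟨i, hi, rfl⟩ := hC.used c hc.1 hc.2
      exact ⟨R[i], List.getElem_mem hi, (hC.id_key i hi).symm⟩
  have h1 := congrArg Finset.card h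
  rw [Finset.card_image_of_injective _ WithBot.coe_injective, Finset.card_image_of_injOn] at h1
  · simpa [alphabetSize] using h1
  · intro i hi j hj hij
    exact ht.key_inj (by simpa using hi) (by simpa using hj) hij

theorem Core.key_eq (hC : Core s R) {i : ℕ} (hi : i < R.length) :
    s.carr aChar (s.arr aX i) = inputAt R i := by
  rw [hC.id_key i hi, inputAt_of_lt hi]

theorem Core.isEll_inputAt (hC : Core s R) {k : ℕ} (hk : k ≤ R.length) :
    IsEll (inputAt R) R.length k (s.arr aEll k) := by
  obtain ⟨t, ht⟩ := hC.alphabet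
  have h : ∀ l, ∀ k' ≤ R.length, Agree (inputAt R) l k k' ↔ Agree (s.arr aX) l k k' := by
    intro l k' hk'
    refine and_congr_right fun h1 => and_congr_right fun h2 => forall₂_congr fun j hj => ?_
    rw [← hC.key_eq (by omega), ← hC.key_eq (by omega)]
    exact ⟨fun h => ht.key_inj (hC.id_mem _ (by omega)) (hC.id_mem _ (by omega)) h,
      fun h => by rw [h]⟩
  obtain ⟨h1, h2⟩ := hC.ell k hk
  refine ⟨fun k' hk' hne ha => h1 k' hk' hne ((h _ k' hk').1 ha), h2.imp_right ?_⟩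
  rintro ⟨k', hk', hne, ha⟩
  exact ⟨k', hk', hne, (h _ k' hk').2 ha⟩

/-- The query program is correct and fast. -/
theorem query_correct (hC : Core s (dir.arrivals S)) (w : List α)
    (hA : 100 * (S.length + 1) ≤ A) (hAW : A + w.length ≤ W) :
    WP A W w (query dir.position) s fun s' τ => Core s' (dir.arrivals S) ∧
      s'.arr aX = s.arr aX ∧ s'.reg rAnswer = netFreq S w ∧
      τ ≤ 500 * ((w.length + 1) * (Nat.log 2 (s.reg rSigma) + 1)) := by
  classical
  refine WP.mono (query_spec (y := inputAt (dir.arrivals w).reverse) hC ?_ ?_ (by simpa) hAW) ?_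
  · intro s' hj
    cases dir
    · simp [Direction.position, Direction.arrivals]
    · simp [Direction.position, Direction.arrivals]
      refine ⟨by omega, ?_⟩
      rw [inputAt_eq_iff, List.getElem?_reverse hj]
  · cases dir <;> simp [Direction.position]
  · rintro s' τ ⟨h1, h2, -, h4, h5⟩
    refine ⟨h2, h1 _ (by simp), ?_, h5.trans ?_⟩
    · rw [h4, ← Direction.netFreq_arrivals (dir := dir),
        netFreq_reverse_eq (ell := s.arr aEll) fun k hk => hC.isEll_inputAt hk]
      congr 1
      refine Finset.filter_congr fun k hk => ?_
      rw [Finset.mem_range] at hk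
      simp only [List.length_reverse, Direction.length_arrivals]
      refine and_congr_right fun _ => and_congr_right fun _ => and_congr_right fun h =>
        forall₂_congr fun j hj => ?_
      simp only [hC.key_eq (i := k - 1 - j) (by omega)]
    · rw [Nat.mul_left_comm]
      exact Nat.mul_le_mul_left _ (by omega)

/-- In every session the memory represents the current string, and the updates have been paid for:
each of them pays for its own constant number of dictionary operations, and for the walk by the
decrease of the depth of the current leaf. -/
theorem Direction.reaches_spec
    (h : dir.dataStructure.Reaches 5000 dir S s T) : Core s (dir.arrivals S) ∧
      T + (Nat.log 2 (s.reg rSigma) + 1) * (160 * depth (s.arr aX) S.length) ≤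
        (Nat.log 2 (s.reg rSigma) + 1) * (5000 * S.length) := by
  induction h with
  | start => exact ⟨by cases dir <;> exact Core.init, by simp [depth]⟩
  | @update S s s' T t a h hu ih =>
    obtain ⟨hC, hT⟩ := ih
    obtain ⟨s₁, t₁, he, h1, h2, h3⟩ := (update_spec (A := 5000 * (S.length + 1 + 1))
      (W := 5000 * (S.length + 1 + [a].length + 1)) hC a (by simp)
      (by simp)).exists_exec
    obtain ⟨rfl, rfl⟩ := hu.deterministic he
    have hl : (dir.extend S a).length = S.length + 1 := by cases dir <;> simp [Direction.extend]
    rw [Direction.arrivals_extend, hl]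
    refine ⟨h1, ?_⟩
    rw [Direction.length_arrivals] at h3
    have hL := Nat.log_mono_right (b := 2) h2
    have hd := depth_le (s.arr aX) S.length
    generalize depth (s.arr aX) S.length = y at *
    generalize depth (s'.arr aX) (S.length + 1) = z at *
    obtain ⟨u, hu⟩ : ∃ u, 5000 * S.length = 160 * y + u := ⟨5000 * S.length - 160 * y, by omega⟩
    have h4 := Nat.mul_le_mul_right u (Nat.add_le_add_right hL 1)
    rw [hu, Nat.mul_add] at hT
    calc T + t + (Nat.log 2 (s'.reg rSigma) + 1) * (160 * z)
        ≤ (Nat.log 2 (s'.reg rSigma) + 1) * u +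
          (Nat.log 2 (s'.reg rSigma) + 1) * (5000 + 160 * y) := by omega
      _ = (Nat.log 2 (s'.reg rSigma) + 1) * (5000 * (S.length + 1)) := by
        rw [Nat.mul_add 5000, hu]
        ring
  | @query S s s' T t w h hq ih =>
    obtain ⟨hC, hT⟩ := ih
    obtain ⟨s₁, t₁, he, h1, h2, -⟩ := (query_correct (A := 5000 * (S.length + 1))
      (W := 5000 * (S.length + w.length + 1)) hC w (by omega) (by omega)).exists_exec
    obtain ⟨rfl, rfl⟩ := hq.deterministic he
    rw [← h1.alphabetSize_eq, h2]
    rw [← hC.alphabetSize_eq] at hT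
    exact ⟨h1, hT⟩

end

end NetFreq

theorem mainTheorem2 (dir : NetFreq.Direction) :
    ∃ (D : NetFreq.OnlineDS) (C : ℕ), ∀ (α : Type*) [LinearOrder α]
      (S : List α) (s : NetFreq.State α) (T : ℕ), D.Reaches C dir S s T →
        T ≤ C * (S.length * (Nat.log 2 (NetFreq.alphabetSize S) + 1)) ∧
        (∀ a : α, ∃ (s' : NetFreq.State α) (t : ℕ),
          NetFreq.OnlineDS.Runs C (S.length + 1) D.update [a] s s' t) ∧
        (∀ w : List α, ∃ (s' : NetFreq.State α) (t : ℕ),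
          NetFreq.OnlineDS.Runs C S.length D.query w s s' t ∧
          s'.reg 0 = NetFreq.netFreq S w ∧
          t ≤ C * ((w.length + 1) * (Nat.log 2 (NetFreq.alphabetSize S) + 1))) := by
  refine ⟨dir.dataStructure, 5000, fun α _ S s T h => ?_⟩
  obtain ⟨hC, hT⟩ := dir.reaches_spec h
  have hσ : NetFreq.alphabetSize S = s.reg 2 := by
    rw [← dir.alphabetSize_arrivals, hC.alphabetSize_eq]
  rw [hσ]
  refine ⟨?_, fun a => ?_, fun w => ?_⟩
  · calc T ≤ (Nat.log 2 (s.reg 2) + 1) * (5000 * S.length) := le_of_add_le_left hT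
      _ = _ := by ring
  · obtain ⟨s', t, he, -⟩ := (NetFreq.update_spec (A := 5000 * (S.length + 1 + 1))
      (W := 5000 * (S.length + 1 + [a].length + 1)) hC a (by simp)
      (by simp)).exists_exec
    exact ⟨s', t, he⟩
  · obtain ⟨s', t, he, -, -, h3, h4⟩ := (NetFreq.query_correct (A := 5000 * (S.length + 1))
      (W := 5000 * (S.length + w.length + 1)) hC w (by omega) (by omega)).exists_exec
    exact ⟨s', t, he, h3, by omega⟩
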